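/- Let $u_1\ge u_2\ge u_3\ge\dots$ be a non-increasing sequence of numbers in $[0,1]$ such that $$u_n\cdot\frac{n^{1/2}}{\log^{3+\delta}n}\to\infty\ \text{ for some }\delta>0,\qquad\text{and}\qquad u_n\to 0 .$$ Let $U_1,U_2,\dots$ be independent $\{0,1\}$-valued random variables on a probability space $(\Omega,P)$ with $P(U_n=1)=u_n$, and let $R^\omega=\{n\ge 1: U_n(\omega)=1\}$ be the set of selected integers. Then for $P$-almost every $\omega$ the set $R^\omega=\{r_1<r_2<r_3<\dots\}$ is infinite and has the following property: for every probability space $(X,\Sigma,\mu)$, every measurable measure-preserving (not necessarily invertible) transformation $T:X\to X$, and all bounded measurable (real- or complex-valued) functions $F_1,F_2$ on $X$, $$\lim_{N\to\infty}\frac1N\sum_{1\le n<N}F_1(T^nx)\,F_2(T^{r_n}x)=\overline F_1(x)\,\overline F_2(x)\qquad\text{for $\mu$-a.e. }x\in X,$$ where $\overline F_i$ is the orthogonal projection of $F_i$ in $L^2(\mu)$ to the closed subspace of $T$-invariant functions $\{f\in L^2(\mu): f\circ T=f\}$. (The exceptional null set of $\omega$ depends neither on the system nor on $F_1,F_2$.)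 -/

import Mathlib

open MeasureTheory Filter Topology

noncomputable section

/-- The random set of positive integers `n` that are selected, i.e. those with `U n ω = 1`. -/
def selectedSet {Ω : Type*} (U : ℕ → Ω → ℕ) (ω : Ω) : Set ℕ :=
  {n | 1 ≤ n ∧ U n ω = 1}

/-- `selectedSeq U ω n` is the `n`-th smallest selected integer, for `n = 1, 2, 3, …`
(`Nat.nth` counts from `0`); the value at `n = 0` is not used. -/
def selectedSeq {Ω : Type*} (U : ℕ → Ω → ℕ) (ω : Ω) (n : ℕ) : ℕ :=
  Nat.nth (fun m => m ∈ selectedSet U ω) (n - 1)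

/-- The operator `f ↦ f ∘ T` on `L²(μ)`. -/
def koopman (𝕜 : Type*) [RCLike 𝕜] {X : Type*} [MeasurableSpace X] {μ : Measure X}
    {T : X → X} (hT : MeasurePreserving T μ μ) : Lp 𝕜 2 μ →L[𝕜] Lp 𝕜 2 μ :=
  (Lp.compMeasurePreservingₗᵢ 𝕜 T hT).toContinuousLinearMap

/-- The orthogonal projection of a square-integrable function `F` to the closed subspace
`{f | f ∘ T = f}` of `L²(μ)`. -/
def invariantProj {𝕜 : Type*} [RCLike 𝕜] {X : Type*} [MeasurableSpace X] {μ : Measure X}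
    {T : X → X} (hT : MeasurePreserving T μ μ) {F : X → 𝕜} (hF : MemLp F 2 μ) : Lp 𝕜 2 μ :=
  ((koopman 𝕜 hT).eqLocus (1 : Lp 𝕜 2 μ →L[𝕜] Lp 𝕜 2 μ)).starProjection (hF.toLp F)

end

/-! Write `y i` for the selectors (indices shifted to start at `0`), `p i` for their probabilities,
`selCount y i` for the number selected below `i`. If `i` is selected, its rank counted from `0` is
`selCount y i`, so the averages in question are the sums of `y i * F₁ (T^[selCount y i] x) * F₂
(T^[i] x)` over `i < M`, normalised by `selCount y M`, which is asymptotic to `expCount p M`. The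
proof replaces `y i` by `p i` and then evaluates the smoothed sums.

Centring. The terms with `y i - p i` are cut into blocks on which `p` varies by at most a factor `3`
and `i + 1` by at most `exp (1 / K)`. In each block van der Corput's inequality reduces the mean
square to correlations of the terms `i` and `i + d`. Fix the increment `e` of the count between `i`
and `i + d`, and apply invariance of the measure under `T^[selCount y i]`: the `F₁`-factor no longer
depends on `i`, and what remains is a sum of `c i * G (T^[i - selCount y i] x)`. Its L² norm is
controlled, by transference to the integers, by a trigonometric polynomial at roots of unity
(`integral_norm_sq_sum_iterate_le`). The system has then disappeared, which is why one null set of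
`ω` serves all systems.

These polynomials are sums of predictable multiples of `y (i + d) - p (i + d)`: the count up to `i +
d`, though random, is determined by the past. An exponential supermartingale and a union bound give
square root cancellation outside events of summable probability (`measure_not_goodBlock_le`). The
mean squares of the block sums, divided by the squares of suitable weights, are therefore summable,
so block sums are almost everywhere of smaller order than the weights. By Cauchy–Schwarz over about
`log M` blocks the weights add up to `O(expCount p M)`; this is where `log ^ (3 + δ)` is needed.
Letting `K` grow removes the incomplete last block.

Smoothed sums. Since `p` tends to `0`, the count changes rarely, and `p i * F₁ (T^[selCount y i] x)`
is a weight of small total variation. `F₂` may be replaced by its moving averages, which are close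
in the mean along the orbit to its projection, by the mean ergodic theorem and the maximal
inequality (`ae_exists_moving_average_le`). The remaining sum of `p i * F₁ (T^[selCount y i] x)` is
converted back into an ordinary ergodic sum of `F₁` by the centring result with `F₂ = 1`. -/

/-! ### An exponential inequality for predictable combinations of independent selectors -/

/-- `c` is predictable: `c i y` depends only on the values `y j`, `j < i`. -/
def Predictable {α : Type*} (c : ℕ → (ℕ → ℕ) → α) : Prop :=
  ∀ i y y', (∀ j < i, y j = y' j) → c i y = c i y'

/-- A family of independent `{0,1}`-valued random variables with success probabilities `p`. -/
structure IsSelector {Ω : Type*} [MeasurableSpace Ω] (P : Measure Ω) (Y : ℕ → Ω → ℕ)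
    (p : ℕ → ℝ) : Prop where
  meas : ∀ i, Measurable (Y i)
  zero_or_one : ∀ i ω, Y i ω = 0 ∨ Y i ω = 1
  nonneg : ∀ i, 0 ≤ p i
  le_one : ∀ i, p i ≤ 1
  prob : ∀ i, P {ω | Y i ω = 1} = ENNReal.ofReal (p i)
  indep : ProbabilityTheory.iIndepFun Y P

theorem exists_restrict_of_dependsOn {α : Type*} {n : ℕ} {G : (ℕ → ℕ) → α}
    (hG : ∀ y y', (∀ j < n, y j = y' j) → G y = G y') :
    ∃ g : (Finset.range n → ℕ) → α, ∀ y, G y = g (fun j => y j) := by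
  refine ⟨fun v => G (fun j => if h : j ∈ Finset.range n then v ⟨j, h⟩ else 0), fun y => ?_⟩
  apply hG
  intro j hj
  simp [hj]

/-- From `exp x ≤ 1 + x + x ^ 2` for `|x| ≤ 1`, the centred two-point variable has exponential
moment at most `1 + c ^ 2 * p ≤ exp (c ^ 2 * p)`, which the compensator cancels. -/
theorem two_point_exp_le {p c : ℝ} (hp0 : 0 ≤ p) (hp1 : p ≤ 1) (hc : |c| ≤ 1) :
    p * Real.exp (c * (1 - p) - c ^ 2 * p) + (1 - p) * Real.exp (c * (0 - p) - c ^ 2 * p) ≤ 1 := by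
  have key : ∀ x : ℝ, |x| ≤ 1 → Real.exp x ≤ 1 + x + x ^ 2 := fun x hx => by
    have := (abs_le.mp (Real.abs_exp_sub_one_sub_id_le hx)).2
    linarith
  have hc' := abs_le.mp hc
  have h1 := key (c * (1 - p)) (by
    rw [abs_mul, abs_of_nonneg (by linarith : 0 ≤ 1 - p)]
    calc |c| * (1 - p) ≤ 1 * 1 := by gcongr; linarith
      _ = 1 := by ring)
  have h2 := key (c * (0 - p)) (by
    rw [abs_mul, zero_sub, abs_neg, abs_of_nonneg hp0]
    calc |c| * p ≤ 1 * 1 := by gcongr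
      _ = 1 := by ring)
  have h3 : 1 + c ^ 2 * p ≤ Real.exp (c ^ 2 * p) := by
    have := Real.add_one_le_exp (c ^ 2 * p); linarith
  rw [Real.exp_sub, Real.exp_sub]
  have hpos := Real.exp_pos (c ^ 2 * p)
  rw [mul_div_assoc', mul_div_assoc', ← add_div, div_le_one hpos]
  refine le_trans ?_ h3
  have e1 := mul_le_mul_of_nonneg_left h1 hp0
  have e2 := mul_le_mul_of_nonneg_left h2 (by linarith : 0 ≤ 1 - p)
  have e3 : 0 ≤ c ^ 2 * p ^ 2 := by positivity
  nlinarith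

namespace IsSelector

variable {Ω : Type*} [MeasurableSpace Ω] {P : Measure Ω}
  {Y : ℕ → Ω → ℕ} {p : ℕ → ℝ}

/-- A function of finitely many natural numbers has a countable discrete domain, so predictable
coefficients need no measurability hypothesis. -/
theorem measurable_of_dependsOn (hY : IsSelector P Y p) {α : Type*} [MeasurableSpace α]
    {n : ℕ} {G : (ℕ → ℕ) → α} (hG : ∀ y y', (∀ j < n, y j = y' j) → G y = G y') :
    Measurable (fun ω => G (fun i => Y i ω)) := by
  obtain ⟨g, hg⟩ := exists_restrict_of_dependsOn hG
  simp_rw [hg]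
  exact (Measurable.of_discrete (f := g)).comp (measurable_pi_lambda _ fun j => hY.meas j)

theorem lintegral_mul_comp (hY : IsSelector P Y p) {n : ℕ} {G : (ℕ → ℕ) → ENNReal}
    (hG : ∀ y y', (∀ j < n, y j = y' j) → G y = G y') (h : ℕ → ENNReal) :
    ∫⁻ ω, G (fun i => Y i ω) * h (Y n ω) ∂P
      = (∫⁻ ω, G (fun i => Y i ω) ∂P) * ∫⁻ ω, h (Y n ω) ∂P := by
  have hm := hY.measurable_of_dependsOn hG
  obtain ⟨g, hg⟩ := exists_restrict_of_dependsOn hG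
  have hind := hY.indep.indepFun_finset (Finset.range n) {n} (by simp) hY.meas
  have h2 := hind.comp (φ := g)
    (ψ := fun v : (({n} : Finset ℕ) → ℕ) => h (v ⟨n, by simp⟩))
    Measurable.of_discrete Measurable.of_discrete
  refine ProbabilityTheory.lintegral_mul_eq_lintegral_mul_lintegral_of_indepFun''
    hm.aemeasurable ((Measurable.of_discrete (f := h)).comp (hY.meas n)).aemeasurable ?_
  have e : (fun ω => G (fun i => Y i ω)) = g ∘ fun a (i : Finset.range n) => Y (↑i) a :=
    funext fun ω => hg _
  rw [e]
  exact h2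

theorem lintegral_indicator (hY : IsSelector P Y p) [IsProbabilityMeasure P] (n : ℕ) :
    ∫⁻ ω, (if Y n ω = 1 then 1 else 0 : ENNReal) ∂P = ENNReal.ofReal (p n) ∧
    ∫⁻ ω, (if Y n ω = 1 then 0 else 1 : ENNReal) ∂P = ENNReal.ofReal (1 - p n) := by
  have hm : MeasurableSet {ω | Y n ω = 1} := hY.meas n (measurableSet_singleton 1)
  constructor
  · rw [← hY.prob n, ← lintegral_indicator_one hm]
    simp [Set.indicator]
  · rw [ENNReal.ofReal_sub _ (hY.nonneg n), ENNReal.ofReal_one, ← hY.prob n,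
      ← prob_compl_eq_one_sub hm, ← lintegral_indicator_one hm.compl]
    congr 1
    funext ω
    by_cases h : Y n ω = 1 <;> simp [h]

/-- Supermartingale argument: given the past, the last factor is a two-point variable of mean at
most one by `two_point_exp_le`, and independence lets it be integrated out. -/
theorem lintegral_exp_le_one (hY : IsSelector P Y p) [IsProbabilityMeasure P]
    {c : ℕ → (ℕ → ℕ) → ℝ}
    (hc : Predictable c) (hc1 : ∀ i y, |c i y| ≤ 1) (n : ℕ) :
    ∫⁻ ω, ENNReal.ofReal (Real.exp (∑ i ∈ Finset.range n,
      (c i (fun j => Y j ω) * (Y i ω - p i) - c i (fun j => Y j ω) ^ 2 * p i))) ∂P ≤ 1 := by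
  induction n with
  | zero => simp
  | succ n ih =>
    refine le_trans ?_ ih
    set Z : (ℕ → ℕ) → ENNReal := fun y => ENNReal.ofReal (Real.exp (∑ i ∈ Finset.range n,
      (c i y * (y i - p i) - c i y ^ 2 * p i))) with hZ
    set A : (ℕ → ℕ) → ENNReal := fun y =>
      ENNReal.ofReal (Real.exp (c n y * (1 - p n) - c n y ^ 2 * p n)) with hA
    set B : (ℕ → ℕ) → ENNReal := fun y =>
      ENNReal.ofReal (Real.exp (c n y * (0 - p n) - c n y ^ 2 * p n)) with hB
    have dZ : ∀ y y', (∀ j < n, y j = y' j) → Z y = Z y' := by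
      intro y y' h
      simp only [hZ]
      congr 2
      refine Finset.sum_congr rfl fun i hi => ?_
      rw [Finset.mem_range] at hi
      rw [hc i y y' fun j hj => h j (hj.trans hi), h i hi]
    have dA : ∀ y y', (∀ j < n, y j = y' j) → (Z y * A y) = Z y' * A y' := by
      intro y y' h
      rw [dZ y y' h]; simp only [hA]; rw [hc n y y' h]
    have dB : ∀ y y', (∀ j < n, y j = y' j) → (Z y * B y) = Z y' * B y' := by
      intro y y' h
      rw [dZ y y' h]; simp only [hB]; rw [hc n y y' h]
    have mA := hY.measurable_of_dependsOn dA
    have mB := hY.measurable_of_dependsOn dB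
    have hsplit : ∀ ω, ENNReal.ofReal (Real.exp (∑ i ∈ Finset.range (n + 1),
        (c i (fun j => Y j ω) * (Y i ω - p i) - c i (fun j => Y j ω) ^ 2 * p i)))
        = (Z (fun j => Y j ω) * A (fun j => Y j ω)) * (if Y n ω = 1 then 1 else 0)
          + (Z (fun j => Y j ω) * B (fun j => Y j ω)) * (if Y n ω = 1 then 0 else 1) := by
      intro ω
      rw [Finset.sum_range_succ, Real.exp_add, ENNReal.ofReal_mul (Real.exp_pos _).le]
      rcases hY.zero_or_one n ω with h | h <;> simp [h, hZ, hA, hB]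
    simp_rw [hsplit]
    have mI : Measurable (fun ω => (if Y n ω = 1 then 1 else 0 : ENNReal)) :=
      Measurable.ite (hY.meas n (measurableSet_singleton 1)) measurable_const measurable_const
    have e1 := hY.lintegral_mul_comp (G := fun y => Z y * A y) dA (fun k => if k = 1 then 1 else 0)
    have e2 := hY.lintegral_mul_comp (G := fun y => Z y * B y) dB (fun k => if k = 1 then 0 else 1)
    rw [(hY.lintegral_indicator n).1, ← lintegral_mul_const _ mA] at e1
    rw [(hY.lintegral_indicator n).2, ← lintegral_mul_const _ mB] at e2
    refine (le_of_eq ((lintegral_add_left (mA.mul mI) _).trans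
      ((congrArg₂ (· + ·) e1 e2).trans (lintegral_add_left (mA.mul_const _) _).symm))).trans ?_
    refine lintegral_mono fun ω => ?_
    simp only
    rw [mul_assoc, mul_assoc, ← mul_add]
    refine mul_le_of_le_one_right zero_le ?_
    simp only [hA, hB]
    rw [← ENNReal.ofReal_mul (Real.exp_pos _).le, ← ENNReal.ofReal_mul (Real.exp_pos _).le,
      ← ENNReal.ofReal_add, ENNReal.ofReal_le_one]
    · have := two_point_exp_le (hY.nonneg n) (hY.le_one n) (hc1 n fun j => Y j ω)
      linarith
    · exact mul_nonneg (Real.exp_pos _).le (hY.nonneg n)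
    · exact mul_nonneg (Real.exp_pos _).le (by linarith [hY.le_one n])

/-- Exponential tail bound for sums of predictable multiples of centred selectors. -/
theorem measure_predictable_sum_ge (hY : IsSelector P Y p) [IsProbabilityMeasure P]
    {c : ℕ → (ℕ → ℕ) → ℝ}
    (hc : Predictable c) (hc1 : ∀ i y, |c i y| ≤ 1) (n : ℕ) (L : ℝ) :
    P {ω | L ≤ ∑ i ∈ Finset.range n,
      (c i (fun j => Y j ω) * (Y i ω - p i) - c i (fun j => Y j ω) ^ 2 * p i)}
      ≤ ENNReal.ofReal (Real.exp (-L)) := by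
  have hm : Measurable (fun ω => ENNReal.ofReal (Real.exp (∑ i ∈ Finset.range n,
      (c i (fun j => Y j ω) * (Y i ω - p i) - c i (fun j => Y j ω) ^ 2 * p i)))) := by
    refine hY.measurable_of_dependsOn (n := n) (G := fun y => ENNReal.ofReal
      (Real.exp (∑ i ∈ Finset.range n, (c i y * (y i - p i) - c i y ^ 2 * p i)))) ?_
    intro y y' h
    congr 2
    refine Finset.sum_congr rfl fun i hi => ?_
    rw [Finset.mem_range] at hi
    rw [hc i y y' fun j hj => h j (hj.trans hi), h i hi]
  have h := (mul_meas_ge_le_lintegral₀ (μ := P) hm.aemeasurable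
    (ENNReal.ofReal (Real.exp L))).trans (hY.lintegral_exp_le_one hc hc1 n)
  have hset : {ω | L ≤ ∑ i ∈ Finset.range n,
      (c i (fun j => Y j ω) * (Y i ω - p i) - c i (fun j => Y j ω) ^ 2 * p i)}
      = {ω | ENNReal.ofReal (Real.exp L) ≤ ENNReal.ofReal (Real.exp (∑ i ∈ Finset.range n,
      (c i (fun j => Y j ω) * (Y i ω - p i) - c i (fun j => Y j ω) ^ 2 * p i)))} := by
    ext ω
    simp only [Set.mem_ofPred_eq]
    rw [ENNReal.ofReal_le_ofReal_iff (Real.exp_pos _).le, Real.exp_le_exp]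
  rw [hset, Real.exp_neg, ENNReal.ofReal_inv_of_pos (Real.exp_pos _)]
  rw [mul_comm] at h
  exact ENNReal.le_inv_iff_mul_le.mpr h

end IsSelector

/-! ### Discrete Fourier analysis on roots of unity -/

/-- The standard primitive `R`-th root of unity. -/
noncomputable def unitRoot (R : ℕ) : ℂ := Complex.exp (2 * Real.pi * Complex.I / R)

theorem unitRoot_isPrimitiveRoot {R : ℕ} (hR : R ≠ 0) : IsPrimitiveRoot (unitRoot R) R :=
  Complex.isPrimitiveRoot_exp R hR

theorem norm_unitRoot (R : ℕ) : ‖unitRoot R‖ = 1 := by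
  have : (2 * Real.pi * Complex.I / R : ℂ) = ((2 * Real.pi / R : ℝ) : ℂ) * Complex.I := by
    push_cast; ring
  rw [unitRoot, this, Complex.norm_exp_ofReal_mul_I]

theorem unitRoot_mul_conj (R : ℕ) : unitRoot R * (starRingEnd ℂ) (unitRoot R) = 1 := by
  rw [Complex.mul_conj, Complex.normSq_eq_norm_sq, norm_unitRoot]; simp

theorem sum_unitRoot_orthogonal {R : ℕ} {j k : ℕ} (hj : j < R) (hk : k < R) :
    ∑ l ∈ Finset.range R, unitRoot R ^ (j * l) * (starRingEnd ℂ) (unitRoot R) ^ (k * l)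
      = if j = k then (R : ℂ) else 0 := by
  have hR : R ≠ 0 := by omega
  set ζ := unitRoot R
  have hζ := unitRoot_isPrimitiveRoot hR
  have h1 : ζ * (starRingEnd ℂ) ζ = 1 := unitRoot_mul_conj R
  set w := ζ ^ j * (starRingEnd ℂ) ζ ^ k
  have hsum : ∀ l, ζ ^ (j * l) * (starRingEnd ℂ) ζ ^ (k * l) = w ^ l := fun l => by
    rw [mul_pow, ← pow_mul, ← pow_mul]
  simp_rw [hsum]
  split_ifs with h
  · have : w = 1 := by
      simp only [w, h, ← mul_pow, h1, one_pow]
    simp [this]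
  · have hw1 : w ≠ 1 := by
      intro hw
      apply h
      apply hζ.pow_inj hj hk
      calc ζ ^ j = ζ ^ j * (ζ * (starRingEnd ℂ) ζ) ^ k := by rw [h1]; simp
        _ = w * ζ ^ k := by simp only [w]; rw [mul_pow]; ring
        _ = ζ ^ k := by rw [hw, one_mul]
    have hwR : w ^ R = 1 := by
      simp only [w]
      rw [mul_pow, ← pow_mul, ← pow_mul, mul_comm j, mul_comm k, pow_mul, pow_mul, ← map_pow,
        hζ.pow_eq_one]
      simp
    have := geom_sum_mul w R
    rw [hwR, sub_self] at this
    exact (mul_eq_zero.mp this).resolve_right (sub_ne_zero.mpr hw1)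

theorem sum_norm_sq_fourier (R : ℕ) (a : ℕ → ℂ) :
    ∑ l ∈ Finset.range R, ‖∑ k ∈ Finset.range R, a k * unitRoot R ^ (k * l)‖ ^ 2
      = R * ∑ k ∈ Finset.range R, ‖a k‖ ^ 2 := by
  have h : ((∑ l ∈ Finset.range R, ‖∑ k ∈ Finset.range R, a k * unitRoot R ^ (k * l)‖ ^ 2 : ℝ) : ℂ)
      = ((R * ∑ k ∈ Finset.range R, ‖a k‖ ^ 2 : ℝ) : ℂ) := by
    push_cast
    simp_rw [← Complex.mul_conj', map_sum, Finset.sum_mul_sum]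
    rw [Finset.sum_comm, Finset.mul_sum]
    refine Finset.sum_congr rfl fun k hk => ?_
    rw [Finset.sum_comm]
    rw [Finset.mem_range] at hk
    have : ∀ j ∈ Finset.range R, ∑ l ∈ Finset.range R, a k * unitRoot R ^ (k * l) *
        (starRingEnd ℂ) (a j * unitRoot R ^ (j * l))
        = if k = j then R * (a k * (starRingEnd ℂ) (a j)) else 0 := by
      intro j hj
      have := sum_unitRoot_orthogonal hk (Finset.mem_range.mp hj)
      calc _ = a k * (starRingEnd ℂ) (a j) * ∑ l ∈ Finset.range R,
            unitRoot R ^ (k * l) * (starRingEnd ℂ) (unitRoot R) ^ (j * l) := by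
            rw [Finset.mul_sum]
            refine Finset.sum_congr rfl fun l _ => ?_
            rw [map_mul, map_pow]; ring
        _ = _ := by rw [this]; split_ifs <;> ring
    rw [Finset.sum_congr rfl this]
    simp [hk]
  exact_mod_cast h

theorem sum_fourier_inversion {R : ℕ} (x : ℕ → ℂ) {j : ℕ} (hj : j < R) :
    ∑ k ∈ Finset.range R, (∑ i ∈ Finset.range R, x i * (starRingEnd ℂ) (unitRoot R) ^ (k * i)) *
      unitRoot R ^ (k * j) = R * x j := by
  simp_rw [Finset.sum_mul]
  rw [Finset.sum_comm]
  have : ∀ i ∈ Finset.range R, ∑ k ∈ Finset.range R,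
      x i * (starRingEnd ℂ) (unitRoot R) ^ (k * i) * unitRoot R ^ (k * j)
      = if j = i then R * x i else 0 := by
    intro i hi
    have := sum_unitRoot_orthogonal hj (Finset.mem_range.mp hi)
    calc _ = x i * ∑ k ∈ Finset.range R, unitRoot R ^ (j * k) *
          (starRingEnd ℂ) (unitRoot R) ^ (i * k) := by
          rw [Finset.mul_sum]
          refine Finset.sum_congr rfl fun k _ => ?_
          rw [mul_comm j k, mul_comm i k]; ring
      _ = _ := by rw [this]; split_ifs <;> ring
  rw [Finset.sum_congr rfl this]
  simp [hj]

/-- A convolution operator on `ℓ²` of an interval is bounded by the maximum of its symbol over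
the `R`-th roots of unity. -/
theorem sum_norm_sq_shift_le {ι : Type*} (s : Finset ι) (c : ι → ℂ) (t : ι → ℕ) {L R : ℕ}
    (ht : ∀ m ∈ s, t m + L ≤ R) {S : ℝ}
    (hS : ∀ k < R, ‖∑ m ∈ s, c m * unitRoot R ^ (k * t m)‖ ≤ S) (x : ℕ → ℂ) :
    ∑ l ∈ Finset.range L, ‖∑ m ∈ s, c m * x (l + t m)‖ ^ 2
      ≤ S ^ 2 * ∑ j ∈ Finset.range R, ‖x j‖ ^ 2 := by
  rcases Finset.eq_empty_or_nonempty s with rfl | ⟨m₀, hm₀⟩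
  · simp only [Finset.sum_empty, norm_zero]
    simp only [ne_eq, OfNat.ofNat_ne_zero, not_false_eq_true, zero_pow, Finset.sum_const_zero]
    positivity
  have hLR : L ≤ R := by have := ht m₀ hm₀; omega
  rcases Nat.eq_zero_or_pos L with rfl | hL
  · simp only [Finset.range_zero, Finset.sum_empty]; positivity
  have hR : (0 : ℝ) < R := by exact_mod_cast hL.trans_le hLR
  set ζ := unitRoot R
  set X : ℕ → ℂ := fun k => ∑ i ∈ Finset.range R, x i * (starRingEnd ℂ) ζ ^ (k * i)
  set p : ℕ → ℂ := fun k => ∑ m ∈ s, c m * ζ ^ (k * t m)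
  have h1 : ∀ l ∈ Finset.range L, R * ∑ m ∈ s, c m * x (l + t m)
      = ∑ k ∈ Finset.range R, (X k * p k) * ζ ^ (k * l) := by
    intro l hl
    rw [Finset.mem_range] at hl
    simp only [p, Finset.mul_sum, Finset.sum_mul]
    rw [Finset.sum_comm]
    refine Finset.sum_congr rfl fun m hm => ?_
    -- No wrap-around: the shifted position stays below the period `R`, so the cyclic inversion
    -- formula gives the true shift.
    have hlt : l + t m < R := by have := ht m hm; omega
    have := sum_fourier_inversion x hlt
    calc (R : ℂ) * (c m * x (l + t m)) = c m * (R * x (l + t m)) := by ring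
      _ = _ := by
        rw [← this, Finset.mul_sum]
        refine Finset.sum_congr rfl fun k _ => ?_
        rw [mul_add, pow_add]; ring
  have h2 : ∑ k ∈ Finset.range R, ‖X k‖ ^ 2 = R * ∑ j ∈ Finset.range R, ‖x j‖ ^ 2 := by
    -- `X` uses the conjugate characters, so Parseval is applied to the conjugate sequence.
    have := sum_norm_sq_fourier R (fun j => (starRingEnd ℂ) (x j))
    simp only [RCLike.norm_conj] at this
    rw [← this]
    refine Finset.sum_congr rfl fun k _ => ?_
    rw [← RCLike.norm_conj (X k)]
    simp only [X, map_sum, map_mul, map_pow, Complex.conj_conj, mul_comm k]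
    rfl
  have h3 : (R : ℝ) ^ 2 * ∑ l ∈ Finset.range L, ‖∑ m ∈ s, c m * x (l + t m)‖ ^ 2
      ≤ (R : ℝ) ^ 2 * (S ^ 2 * ∑ j ∈ Finset.range R, ‖x j‖ ^ 2) := by
    calc (R : ℝ) ^ 2 * ∑ l ∈ Finset.range L, ‖∑ m ∈ s, c m * x (l + t m)‖ ^ 2
        = ∑ l ∈ Finset.range L, ‖∑ k ∈ Finset.range R, (X k * p k) * ζ ^ (k * l)‖ ^ 2 := by
          rw [Finset.mul_sum]
          refine Finset.sum_congr rfl fun l hl => ?_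
          rw [← h1 l hl, norm_mul, mul_pow, Complex.norm_natCast]
      _ ≤ ∑ l ∈ Finset.range R, ‖∑ k ∈ Finset.range R, (X k * p k) * ζ ^ (k * l)‖ ^ 2 :=
          Finset.sum_le_sum_of_subset_of_nonneg (Finset.range_subset_range.mpr hLR)
            fun _ _ _ => by positivity
      _ = R * ∑ k ∈ Finset.range R, ‖X k * p k‖ ^ 2 := sum_norm_sq_fourier R _
      _ ≤ R * ∑ k ∈ Finset.range R, S ^ 2 * ‖X k‖ ^ 2 := by
          gcongr with k hk
          rw [norm_mul, mul_pow, mul_comm]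
          gcongr
          exact hS k (Finset.mem_range.mp hk)
      _ = _ := by rw [← Finset.mul_sum, h2]; ring
  exact le_of_mul_le_mul_left h3 (by positivity)

/-! ### The van der Corput inequality -/

/-- The translate of the long window by any `j ≤ D` still covers the support. -/
theorem sum_Ico_shift_of_support {E : Type*} [AddCommMonoid E] (f : ℕ → E) (a b D j : ℕ)
    (hj : j ≤ D) (hf : ∀ i, i ∉ Finset.Ico (a + D) (b + D) → f i = 0) :
    ∑ s ∈ Finset.Ico a (b + D), f (s + j) = ∑ i ∈ Finset.Ico (a + D) (b + D), f i := by
  rw [Finset.sum_Ico_add']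
  symm
  refine Finset.sum_subset (fun i hi => ?_) fun i _ hi => hf i hi
  rw [Finset.mem_Ico] at hi ⊢
  omega

/-- Averaging over `D` translates and Cauchy–Schwarz over the starting points `s`. The support
begins at `a + D` so that starting points remain natural numbers. With truncated subtraction `(j -
j') + (j' - j)` is `|j - j'|`; opposite shifts give conjugate correlations, hence the real part. -/
theorem vanDerCorput_aux (v : ℕ → ℂ) (a b D : ℕ) (hab : a ≤ b)
    (hv : ∀ i, i ∉ Finset.Ico (a + D) (b + D) → v i = 0) :
    (D : ℝ) ^ 2 * ‖∑ i ∈ Finset.Ico (a + D) (b + D), v i‖ ^ 2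
      ≤ ((b - a : ℕ) + D : ℝ) * ∑ j ∈ Finset.range D, ∑ j' ∈ Finset.range D,
        (∑ i ∈ Finset.Ico (a + D) (b + D),
          v i * (starRingEnd ℂ) (v (i + ((j - j') + (j' - j))))).re := by
  set S := Finset.Ico a (b + D)
  have hD : (D : ℂ) * ∑ i ∈ Finset.Ico (a + D) (b + D), v i
      = ∑ s ∈ S, ∑ j ∈ Finset.range D, v (s + j) := by
    rw [Finset.sum_comm]
    rw [Finset.sum_congr rfl fun j hj => sum_Ico_shift_of_support v a b D j
      (Finset.mem_range.mp hj).le hv]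
    simp
  have hcard : (S.card : ℝ) = (b - a : ℕ) + D := by
    simp only [S, Nat.card_Ico]
    rw [show b + D - a = (b - a) + D by omega]; push_cast; rfl
  have hcorr : ∀ j ∈ Finset.range D, ∀ j' ∈ Finset.range D,
      (∑ s ∈ S, v (s + j) * (starRingEnd ℂ) (v (s + j'))).re
      = (∑ i ∈ Finset.Ico (a + D) (b + D),
          v i * (starRingEnd ℂ) (v (i + ((j - j') + (j' - j))))).re := by
    have main : ∀ j j', j ≤ j' → j' ∈ Finset.range D →
      (∑ s ∈ S, v (s + j) * (starRingEnd ℂ) (v (s + j')))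
      = (∑ i ∈ Finset.Ico (a + D) (b + D), v i * (starRingEnd ℂ) (v (i + (j' - j)))) := by
      intro j j' h hj'
      rw [Finset.mem_range] at hj'
      rw [← sum_Ico_shift_of_support (fun i => v i * (starRingEnd ℂ) (v (i + (j' - j)))) a b D j
        (by omega) (fun i hi => by simp [hv i hi])]
      refine Finset.sum_congr rfl fun s _ => ?_
      rw [show s + j + (j' - j) = s + j' by omega]
    intro j hj j' hj'
    rcases le_total j j' with h | h
    · rw [main j j' h hj', Nat.sub_eq_zero_of_le h, zero_add]
    · have := main j' j h hj
      rw [Nat.sub_eq_zero_of_le h, add_zero, ← this, Complex.re_sum, Complex.re_sum]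
      refine Finset.sum_congr rfl fun s _ => ?_
      simp only [Complex.mul_re, Complex.conj_re, Complex.conj_im]
      ring
  have hsq : ∀ s, ‖∑ j ∈ Finset.range D, v (s + j)‖ ^ 2 = ∑ j ∈ Finset.range D,
      ∑ j' ∈ Finset.range D, (v (s + j) * (starRingEnd ℂ) (v (s + j'))).re := by
    intro s
    have : ((‖∑ j ∈ Finset.range D, v (s + j)‖ ^ 2 : ℝ) : ℂ) = ∑ j ∈ Finset.range D,
      ∑ j' ∈ Finset.range D, (v (s + j) * (starRingEnd ℂ) (v (s + j'))) := by
      push_cast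
      rw [← Complex.mul_conj', map_sum, Finset.sum_mul_sum]
    have h2 := congrArg Complex.re this
    rw [Complex.ofReal_re] at h2
    rw [h2]
    simp only [Complex.re_sum]
  calc (D : ℝ) ^ 2 * ‖∑ i ∈ Finset.Ico (a + D) (b + D), v i‖ ^ 2
      = ‖∑ s ∈ S, ∑ j ∈ Finset.range D, v (s + j)‖ ^ 2 := by
        rw [← hD, norm_mul, mul_pow, Complex.norm_natCast]
    _ ≤ (∑ s ∈ S, ‖∑ j ∈ Finset.range D, v (s + j)‖) ^ 2 := by
        gcongr; exact norm_sum_le _ _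
    _ ≤ S.card * ∑ s ∈ S, ‖∑ j ∈ Finset.range D, v (s + j)‖ ^ 2 := sq_sum_le_card_mul_sum_sq
    _ = _ := by
        rw [hcard]
        congr 1
        simp_rw [hsq]
        rw [Finset.sum_comm]
        refine Finset.sum_congr rfl fun j hj => ?_
        rw [Finset.sum_comm]
        refine Finset.sum_congr rfl fun j' hj' => ?_
        rw [← hcorr j hj j' hj', Complex.re_sum]

/-- The van der Corput inequality for a sequence supported in `[a, b)`. -/
theorem vanDerCorput (v : ℕ → ℂ) (a b D : ℕ) (hab : a ≤ b)
    (hv : ∀ i, i ∉ Finset.Ico a b → v i = 0) :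
    (D : ℝ) ^ 2 * ‖∑ i ∈ Finset.Ico a b, v i‖ ^ 2
      ≤ ((b - a : ℕ) + D : ℝ) * ∑ j ∈ Finset.range D, ∑ j' ∈ Finset.range D,
        (∑ i ∈ Finset.Ico a b,
          v i * (starRingEnd ℂ) (v (i + ((j - j') + (j' - j))))).re := by
  -- The sequence is translated by `D` to make room to its left.
  have h := vanDerCorput_aux (fun k => if D ≤ k then v (k - D) else 0) a b D hab (by
    intro i hi
    rw [Finset.mem_Ico] at hi
    split_ifs with h
    · apply hv; rw [Finset.mem_Ico]; omega
    · rfl)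
  rw [← Finset.sum_Ico_add'] at h
  simp_rw [← Finset.sum_Ico_add' _ a b D] at h
  simp only [Nat.le_add_left, ↓reduceIte, Nat.add_sub_cancel] at h
  convert h using 12
  rw [if_pos (by omega)]
  congr 1
  omega

/-! ### Integrated estimates along a measure-preserving transformation -/

theorem integrable_of_norm_le {X E : Type*} [MeasurableSpace X] [NormedAddCommGroup E]
    {μ : Measure X} [IsFiniteMeasure μ]
    {f : X → E} (hf : AEStronglyMeasurable f μ) (C : ℝ) (h : ∀ x, ‖f x‖ ≤ C) : Integrable f μ :=
  Integrable.of_bound hf C (ae_of_all _ h)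

/-- Spectral bound: the `L²` norm of `∑ c m • g ∘ T ^ t m` is controlled by the maximum of the
corresponding trigonometric polynomial over roots of unity. -/
theorem integral_norm_sq_sum_iterate_le {X : Type*} [MeasurableSpace X] {μ : Measure X}
    [IsProbabilityMeasure μ] {T : X → X} (hT : MeasurePreserving T μ μ) {g : X → ℂ}
    (hg : Measurable g) (hg1 : ∀ x, ‖g x‖ ≤ 1) {ι : Type*} (s : Finset ι) (c : ι → ℂ) (t : ι → ℕ)
    {L : ℕ} (hL : 0 < L) (ht : ∀ m ∈ s, t m ≤ L) {S : ℝ}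
    (hS : ∀ k < 2 * L, ‖∑ m ∈ s, c m * unitRoot (2 * L) ^ (k * t m)‖ ≤ S) :
    ∫ x, ‖∑ m ∈ s, c m * g (T^[t m] x)‖ ^ 2 ∂μ ≤ 2 * S ^ 2 := by
  set h : X → ℝ := fun x => ‖∑ m ∈ s, c m * g (T^[t m] x)‖ ^ 2
  have hm : Measurable h := by
    refine (Finset.measurable_sum _ fun m _ => ?_).norm.pow_const 2
    exact (hg.comp (hT.measurable.iterate _)).const_mul _
  have hint : Integrable h μ := by
    refine integrable_of_norm_le hm.aestronglyMeasurable ((∑ m ∈ s, ‖c m‖) ^ 2) fun x => ?_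
    rw [Real.norm_of_nonneg (by positivity)]
    simp only [h]
    gcongr
    refine (norm_sum_le _ _).trans (Finset.sum_le_sum fun m _ => ?_)
    rw [norm_mul]
    exact mul_le_of_le_one_right (norm_nonneg _) (hg1 _)
  have hcomp : ∀ l, ∫ x, h (T^[l] x) ∂μ = ∫ x, h x ∂μ := fun l => by
    have hl := hT.iterate l
    conv_rhs => rw [← hl.map_eq]
    rw [integral_map hl.aemeasurable hm.aestronglyMeasurable]
  have hintl : ∀ l, Integrable (fun x => h (T^[l] x)) μ := fun l =>
    (hT.iterate l).integrable_comp_of_integrable hint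
  -- Transference: by invariance the integral is averaged over `L` points of an orbit, and the `ℓ²`
  -- bound is applied to the orbit segment of length `2 * L`. The ratio of lengths is the factor `2`
  -- in the conclusion.
  have hpt : ∀ x, ∑ l ∈ Finset.range L, h (T^[l] x) ≤ S ^ 2 * (2 * L) := by
    intro x
    have := sum_norm_sq_shift_le s c t (L := L) (R := 2 * L)
      (fun m hm => by have := ht m hm; omega) hS (fun j => g (T^[j] x))
    have e : ∀ l, h (T^[l] x) = ‖∑ m ∈ s, c m * g (T^[l + t m] x)‖ ^ 2 := fun l => by
      simp only [h, ← Function.iterate_add_apply, add_comm l]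
    simp_rw [e]
    refine this.trans ?_
    gcongr
    calc ∑ j ∈ Finset.range (2 * L), ‖g (T^[j] x)‖ ^ 2 ≤ ∑ j ∈ Finset.range (2 * L), (1 : ℝ) := by
          gcongr with j _
          exact pow_le_one₀ (norm_nonneg _) (hg1 _)
      _ = 2 * L := by simp
  have hL' : (0 : ℝ) < L := by exact_mod_cast hL
  have : (L : ℝ) * ∫ x, h x ∂μ ≤ L * (2 * S ^ 2) := by
    calc (L : ℝ) * ∫ x, h x ∂μ = ∑ l ∈ Finset.range L, ∫ x, h (T^[l] x) ∂μ := by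
          simp [hcomp]
      _ = ∫ x, ∑ l ∈ Finset.range L, h (T^[l] x) ∂μ :=
          (integral_finsetSum _ fun l _ => hintl l).symm
      _ ≤ ∫ x, S ^ 2 * (2 * L) ∂μ :=
          integral_mono (integrable_finsetSum _ fun l _ => hintl l) (integrable_const _) hpt
      _ = L * (2 * S ^ 2) := by simp; ring
  exact le_of_mul_le_mul_left this hL'

/-- A pointwise arithmetic–geometric inequality does the work of Cauchy–Schwarz. -/
theorem integral_norm_le_of_integral_sq_le {X : Type*} [MeasurableSpace X] {μ : Measure X}
    [IsProbabilityMeasure μ] {f : X → ℂ} (hf : Integrable f μ)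
    (hf2 : Integrable (fun x => ‖f x‖ ^ 2) μ) {t : ℝ} (ht : 0 < t)
    (h : ∫ x, ‖f x‖ ^ 2 ∂μ ≤ 2 * t ^ 2) : ∫ x, ‖f x‖ ∂μ ≤ 2 * t := by
  have hpt : ∀ x, ‖f x‖ ≤ (4 * t)⁻¹ * ‖f x‖ ^ 2 + t := fun x => by
    have : (4 * t)⁻¹ * ‖f x‖ ^ 2 + t - ‖f x‖ = (4 * t)⁻¹ * (‖f x‖ - 2 * t) ^ 2 := by
      field_simp; ring
    have h2 : 0 ≤ (4 * t)⁻¹ * (‖f x‖ - 2 * t) ^ 2 := by positivity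
    linarith
  calc ∫ x, ‖f x‖ ∂μ ≤ ∫ x, ((4 * t)⁻¹ * ‖f x‖ ^ 2 + t) ∂μ :=
        integral_mono hf.norm ((hf2.const_mul _).add (integrable_const _)) hpt
    _ = (4 * t)⁻¹ * ∫ x, ‖f x‖ ^ 2 ∂μ + t := by
        rw [integral_add (hf2.const_mul _) (integrable_const _), integral_const_mul]; simp
    _ ≤ (4 * t)⁻¹ * (2 * t ^ 2) + t := by gcongr
    _ ≤ 2 * t := by
        have : (4 * t)⁻¹ * (2 * t ^ 2) = t / 2 := by field_simp; ring
        linarith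

/-! ### The mean square of a block of centred selected terms -/

/-- The number of selected integers below `i`. -/
def selCount (y : ℕ → ℕ) (i : ℕ) : ℕ := ∑ j ∈ Finset.range i, y j

/-- The `i`-th centred term `(y i - p i) F₁ (T ^ (selCount y i) x) F₂ (T ^ i x)`. -/
noncomputable def centredTerm {𝕜 : Type*} [RCLike 𝕜] {X : Type*} (y : ℕ → ℕ) (p : ℕ → ℝ)
    (T : X → X) (F₁ F₂ : X → 𝕜) (i : ℕ) (x : X) : 𝕜 :=
  (((y i : ℝ) - p i : ℝ) : 𝕜) * (F₁ (T^[selCount y i] x) * F₂ (T^[i] x))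

theorem selCount_add (y : ℕ → ℕ) (i d : ℕ) :
    selCount y (i + d) = selCount y i + ∑ j ∈ Finset.Ico i (i + d), y j := by
  rw [selCount, selCount, Finset.sum_range_add_sum_Ico _ (Nat.le_add_right i d)]

theorem selCount_mono (y : ℕ → ℕ) : Monotone (selCount y) := fun i j h => by
  obtain ⟨d, rfl⟩ := Nat.exists_eq_add_of_le h
  rw [selCount_add]; omega

theorem selCount_le {y : ℕ → ℕ} (hy : ∀ i, y i = 0 ∨ y i = 1) (i : ℕ) : selCount y i ≤ i := by
  calc selCount y i ≤ ∑ j ∈ Finset.range i, 1 :=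
        Finset.sum_le_sum fun j _ => by rcases hy j with h | h <;> omega
    _ = i := by simp

theorem selCount_congr {y y' : ℕ → ℕ} {i : ℕ} (h : ∀ j < i, y j = y' j) :
    selCount y i = selCount y' i :=
  Finset.sum_congr rfl fun j hj => h j (Finset.mem_range.mp hj)

section Block

variable {X : Type*} [MeasurableSpace X] {μ : Measure X}
  {T : X → X} {F₁ F₂ : X → ℂ} {y : ℕ → ℕ} {p : ℕ → ℝ}

theorem measurable_centredTerm {𝕜 : Type*} [RCLike 𝕜] {F₁ F₂ : X → 𝕜} (hT : Measurable T)
    (h₁ : Measurable F₁) (h₂ : Measurable F₂) (i : ℕ) :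
    Measurable (centredTerm y p T F₁ F₂ i) :=
  ((h₁.comp (hT.iterate _)).mul (h₂.comp (hT.iterate _))).const_mul _

omit [MeasurableSpace X] in
theorem norm_centredTerm_le {𝕜 : Type*} [RCLike 𝕜] {F₁ F₂ : X → 𝕜} (h₁ : ∀ x, ‖F₁ x‖ ≤ 1)
    (h₂ : ∀ x, ‖F₂ x‖ ≤ 1) (i : ℕ) (x : X) :
    ‖centredTerm y p T F₁ F₂ i x‖ ≤ |(y i : ℝ) - p i| := by
  rw [centredTerm, norm_mul, norm_mul, RCLike.norm_ofReal]
  refine mul_le_of_le_one_right (abs_nonneg _) ?_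
  calc _ ≤ (1 : ℝ) * 1 := by gcongr <;> simp only [h₁, h₂]
    _ = 1 := one_mul 1

theorem integral_iterate_mul_iterate (hT : MeasurePreserving T μ μ) {Φ G : X → ℂ}
    (hΦ : Measurable Φ) (hG : Measurable G) {m i : ℕ} (hmi : m ≤ i) :
    ∫ x, Φ (T^[m] x) * G (T^[i] x) ∂μ = ∫ x, Φ x * G (T^[i - m] x) ∂μ := by
  have hm := hT.iterate m
  have hmeas : Measurable (fun x => Φ x * G (T^[i - m] x)) :=
    hΦ.mul (hG.comp (hT.measurable.iterate _))
  conv_rhs => rw [← hm.map_eq]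
  rw [integral_map hm.aemeasurable hmeas.aestronglyMeasurable]
  simp_rw [← Function.iterate_add_apply, Nat.sub_add_cancel hmi]

/-- The shift-`d` correlation of the centred terms is controlled by exponential sums. -/
theorem norm_integral_correlation_le [IsProbabilityMeasure μ] (hT : MeasurePreserving T μ μ)
    (h₁ : Measurable F₁) (h₂ : Measurable F₂) (hb₁ : ∀ x, ‖F₁ x‖ ≤ 1) (hb₂ : ∀ x, ‖F₂ x‖ ≤ 1)
    (hy : ∀ i, y i = 0 ∨ y i = 1) {a b d E : ℕ} {t : ℝ} (ht0 : 0 < t)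
    (hE : ∀ i, a ≤ i → i + d < b → selCount y (i + d) ≤ selCount y i + E)
    (ht : ∀ e ≤ E, ∀ k < 2 * b,
      ‖∑ i ∈ (Finset.Ico a b).filter
          (fun i => i + d < b ∧ selCount y (i + d) = selCount y i + e),
        ((((y i : ℝ) - p i) * ((y (i + d) : ℝ) - p (i + d)) : ℝ) : ℂ) *
          unitRoot (2 * b) ^ (k * (i - selCount y i))‖ ≤ t) :
    ‖∫ x, ∑ i ∈ (Finset.Ico a b).filter (fun i => i + d < b),
      centredTerm y p T F₁ F₂ i x * (starRingEnd ℂ) (centredTerm y p T F₁ F₂ (i + d) x) ∂μ‖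
      ≤ (E + 1) * (2 * t) := by
  rcases Nat.eq_zero_or_pos b with rfl | hbpos
  · simp; positivity
  set c : ℕ → ℂ := fun i => ((((y i : ℝ) - p i) * ((y (i + d) : ℝ) - p (i + d)) : ℝ) : ℂ)
  set Φ : ℕ → X → ℂ := fun e x => F₁ x * (starRingEnd ℂ) (F₁ (T^[e] x))
  set G : X → ℂ := fun x => F₂ x * (starRingEnd ℂ) (F₂ (T^[d] x))
  set s : ℕ → Finset ℕ := fun e => (Finset.Ico a b).filter
          (fun i => i + d < b ∧ selCount y (i + d) = selCount y i + e)
  have mΦ : ∀ e, Measurable (Φ e) := fun e =>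
    h₁.mul (Complex.continuous_conj.measurable.comp (h₁.comp (hT.measurable.iterate _)))
  have mG : Measurable G :=
    h₂.mul (Complex.continuous_conj.measurable.comp (h₂.comp (hT.measurable.iterate _)))
  have bΦ : ∀ e x, ‖Φ e x‖ ≤ 1 := fun e x => by
    simp only [Φ, norm_mul, RCLike.norm_conj]
    exact mul_le_one₀ (hb₁ _) (norm_nonneg _) (hb₁ _)
  have bG : ∀ x, ‖G x‖ ≤ 1 := fun x => by
    simp only [G, norm_mul, RCLike.norm_conj]
    exact mul_le_one₀ (hb₂ _) (norm_nonneg _) (hb₂ _)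
  -- Sorting by the count increment `e` makes the relative shift inside the `F₁`-factor constant on
  -- each class.
  have hpt : ∀ x, ∑ i ∈ (Finset.Ico a b).filter (fun i => i + d < b),
      centredTerm y p T F₁ F₂ i x * (starRingEnd ℂ) (centredTerm y p T F₁ F₂ (i + d) x)
      = ∑ e ∈ Finset.range (E + 1), ∑ i ∈ s e,
        c i * (Φ e (T^[selCount y i] x) * G (T^[i] x)) := by
    intro x
    rw [← Finset.sum_fiberwise_of_maps_to (t := Finset.range (E + 1))
      (g := fun i => selCount y (i + d) - selCount y i)]
    · refine Finset.sum_congr rfl fun e _ => ?_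
      rw [Finset.filter_filter]
      refine Finset.sum_congr ?_ ?_
      · ext i
        simp only [s, Finset.mem_filter]
        have := selCount_mono y (Nat.le_add_right i d)
        constructor
        · rintro ⟨h1, h2, h3⟩; exact ⟨h1, h2, by omega⟩
        · rintro ⟨h1, h2, h3⟩; exact ⟨h1, h2, by omega⟩
      · intro i hi
        simp only [s, Finset.mem_filter] at hi
        simp only [centredTerm, c, Φ, G, ← Function.iterate_add_apply, hi.2.2, map_mul,
          add_comm e, add_comm d]
        push_cast
        simp only [map_sub, map_natCast,
          Complex.coe_algebraMap, Complex.conj_ofReal]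
        ring
    · intro i hi
      simp only [Finset.mem_filter, Finset.mem_Ico] at hi
      have := hE i hi.1.1 hi.2
      rw [Finset.mem_range]; omega
  have hI : ∀ e, ∀ i ∈ s e, Integrable
      (fun x => c i * (Φ e (T^[selCount y i] x) * G (T^[i] x))) μ := fun e i _ => by
    refine integrable_of_norm_le ?_ (‖c i‖) fun x => ?_
    · exact ((((mΦ e).comp (hT.measurable.iterate _)).mul
        (mG.comp (hT.measurable.iterate _))).const_mul _).aestronglyMeasurable
    · rw [norm_mul, norm_mul]
      exact mul_le_of_le_one_right (norm_nonneg _) (mul_le_one₀ (bΦ _ _) (norm_nonneg _) (bG _))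
  have hI2 : ∀ e, ∀ i ∈ s e, Integrable
      (fun x => c i * (Φ e x * G (T^[i - selCount y i] x))) μ := fun e i _ => by
    refine integrable_of_norm_le ?_ (‖c i‖) fun x => ?_
    · exact (((mΦ e).mul
        (mG.comp (hT.measurable.iterate _))).const_mul _).aestronglyMeasurable
    · rw [norm_mul, norm_mul]
      exact mul_le_of_le_one_right (norm_nonneg _) (mul_le_one₀ (bΦ _ _) (norm_nonneg _) (bG _))
  simp_rw [hpt]
  rw [integral_finsetSum _ fun e _ => integrable_finsetSum _ (hI e)]
  refine (norm_sum_le _ _).trans ?_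
  have hone : ∀ e ∈ Finset.range (E + 1),
      ‖∫ x, ∑ i ∈ s e, c i * (Φ e (T^[selCount y i] x) * G (T^[i] x)) ∂μ‖ ≤ 2 * t := by
    intro e he
    rw [Finset.mem_range] at he
    set f : X → ℂ := fun x => ∑ i ∈ s e, c i * G (T^[i - selCount y i] x)
    have mf : Measurable f := Finset.measurable_sum _ fun i _ =>
      (mG.comp (hT.measurable.iterate _)).const_mul _
    have bf : ∀ x, ‖f x‖ ≤ ∑ i ∈ s e, ‖c i‖ := fun x => by
      refine (norm_sum_le _ _).trans (Finset.sum_le_sum fun i _ => ?_)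
      rw [norm_mul]
      exact mul_le_of_le_one_right (norm_nonneg _) (bG _)
    have If : Integrable f μ := integrable_of_norm_le mf.aestronglyMeasurable _ bf
    have If2 : Integrable (fun x => ‖f x‖ ^ 2) μ :=
      integrable_of_norm_le (mf.norm.pow_const 2).aestronglyMeasurable
        ((∑ i ∈ s e, ‖c i‖) ^ 2) fun x => by
          rw [Real.norm_of_nonneg (by positivity)]
          gcongr
          exact bf x
    -- Invariance under `T^[selCount y i]` removes `i` from the argument of `Φ e`, which then
    -- factors out of the sum. Since `selCount y i ≤ i`, only forward iterates occur and
    -- invertibility is not needed.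
    have e1 : ∫ x, ∑ i ∈ s e, c i * (Φ e (T^[selCount y i] x) * G (T^[i] x)) ∂μ
        = ∫ x, Φ e x * f x ∂μ := by
      rw [integral_finsetSum _ (hI e)]
      have : ∀ x, Φ e x * f x = ∑ i ∈ s e, c i * (Φ e x * G (T^[i - selCount y i] x)) :=
        fun x => by
          simp only [f, Finset.mul_sum]
          exact Finset.sum_congr rfl fun i _ => by ring
      simp_rw [this]
      rw [integral_finsetSum _ (hI2 e)]
      refine Finset.sum_congr rfl fun i _ => ?_
      rw [integral_const_mul, integral_const_mul,
        integral_iterate_mul_iterate hT (mΦ e) mG (selCount_le hy i)]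
    rw [e1]
    calc ‖∫ x, Φ e x * f x ∂μ‖ ≤ ∫ x, ‖Φ e x * f x‖ ∂μ := norm_integral_le_integral_norm _
      _ ≤ ∫ x, ‖f x‖ ∂μ := by
          refine integral_mono_of_nonneg (ae_of_all _ fun x => norm_nonneg _) If.norm
            (ae_of_all _ fun x => ?_)
          simp only [norm_mul]
          exact mul_le_of_le_one_left (norm_nonneg _) (bΦ _ _)
      _ ≤ 2 * t := by
          refine integral_norm_le_of_integral_sq_le If If2 ht0 ?_
          refine integral_norm_sq_sum_iterate_le hT mG bG (s e) c (fun i => i - selCount y i)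
            (L := b) hbpos ?_ (ht e (by omega))
          intro i hi
          simp only [s, Finset.mem_filter, Finset.mem_Ico] at hi
          omega
  calc _ ≤ ∑ e ∈ Finset.range (E + 1), 2 * t := Finset.sum_le_sum hone
    _ = _ := by simp

theorem card_filter_dist_lt_le (D H j : ℕ) :
    ((Finset.range D).filter (fun j' => (j - j') + (j' - j) ≠ 0 ∧ (j - j') + (j' - j) < H)).card
      ≤ 2 * H := by
  calc _ ≤ (Finset.Ico (j + 1 - H) (j + H)).card := Finset.card_le_card fun k hk => by
        simp only [Finset.mem_filter, Finset.mem_range, Finset.mem_Ico] at hk ⊢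
        omega
    _ ≤ 2 * H := by rw [Nat.card_Ico]; omega

/-- Mean square bound for a block of centred terms. -/
theorem integral_norm_sq_block_le [IsProbabilityMeasure μ] (hT : MeasurePreserving T μ μ)
    (h₁ : Measurable F₁) (h₂ : Measurable F₂) (hb₁ : ∀ x, ‖F₁ x‖ ≤ 1) (hb₂ : ∀ x, ‖F₂ x‖ ≤ 1)
    (hy : ∀ i, y i = 0 ∨ y i = 1) {a b D E : ℕ} {Q t : ℝ} (hab : a ≤ b) (hD : 0 < D)
    (ht0 : 0 < t)
    (hQ : ∑ i ∈ Finset.Ico a b, ((y i : ℝ) - p i) ^ 2 ≤ Q)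
    (hE : ∀ d < D, ∀ i, a ≤ i → i + d < b → selCount y (i + d) ≤ selCount y i + E)
    (ht : ∀ d < D, 0 < d → ∀ e ≤ E, ∀ k < 2 * b,
      ‖∑ i ∈ (Finset.Ico a b).filter
          (fun i => i + d < b ∧ selCount y (i + d) = selCount y i + e),
        ((((y i : ℝ) - p i) * ((y (i + d) : ℝ) - p (i + d)) : ℝ) : ℂ) *
          unitRoot (2 * b) ^ (k * (i - selCount y i))‖ ≤ t) :
    D * ∫ x, ‖∑ i ∈ Finset.Ico a b, centredTerm y p T F₁ F₂ i x‖ ^ 2 ∂μ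
      ≤ ((b - a : ℕ) + D) * Q + 8 * (b - a : ℕ) * D * ((E + 1) * t) := by
  set H : ℕ := b - a with hH
  set V : ℕ → X → ℂ := fun i x => if i ∈ Finset.Ico a b then centredTerm y p T F₁ F₂ i x else 0
    with hV
  have mV : ∀ i, Measurable (V i) := fun i => by
    by_cases h : i ∈ Finset.Ico a b
    · simpa only [hV, if_pos h] using measurable_centredTerm hT.measurable h₁ h₂ i
    · simp only [hV, if_neg h]; exact measurable_const
  have bV : ∀ i x, ‖V i x‖ ≤ |(y i : ℝ) - p i| := fun i x => by
    by_cases h : i ∈ Finset.Ico a b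
    · simpa only [hV, if_pos h] using norm_centredTerm_le hb₁ hb₂ i x
    · simp only [hV, if_neg h, norm_zero]; positivity
  set γ : ℕ → X → ℂ := fun d x => ∑ i ∈ Finset.Ico a b, V i x * (starRingEnd ℂ) (V (i + d) x)
  have Iγ : ∀ d, Integrable (γ d) μ := fun d => by
    refine integrable_finsetSum _ fun i _ => integrable_of_norm_le
      ((mV i).mul (Complex.continuous_conj.measurable.comp (mV _))).aestronglyMeasurable
      (|(y i : ℝ) - p i| * |(y (i + d) : ℝ) - p (i + d)|) fun x => ?_
    rw [norm_mul]
    change ‖V i x‖ * ‖(starRingEnd ℂ) (V (i + d) x)‖ ≤ _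
    rw [RCLike.norm_conj]
    exact mul_le_mul (bV _ _) (bV _ _) (norm_nonneg _) (abs_nonneg _)
  have IR : ∀ d, Integrable (fun x => (γ d x).re) μ := fun d => (Iγ d).re
  have hre : ∀ d, ∫ x, (γ d x).re ∂μ ≤ ‖∫ x, γ d x ∂μ‖ := fun d => by
    have := integral_re (Iγ d)
    change ∫ x, (γ d x).re ∂μ = (∫ x, γ d x ∂μ).re at this
    rw [this]
    exact Complex.re_le_norm _
  have hγ0 : ∫ x, (γ 0 x).re ∂μ ≤ Q := by
    calc ∫ x, (γ 0 x).re ∂μ ≤ ∫ _, Q ∂μ := by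
          refine integral_mono (IR 0) (integrable_const _) fun x => ?_
          refine le_trans ?_ hQ
          simp only [γ, add_zero, Complex.re_sum]
          refine Finset.sum_le_sum fun i _ => ?_
          rw [Complex.mul_conj', ← Complex.ofReal_pow, Complex.ofReal_re, ← sq_abs ((y i : ℝ) - p i)]
          gcongr
          exact bV i x
      _ = Q := by simp
  have hγeq : ∀ d x, γ d x = ∑ i ∈ (Finset.Ico a b).filter (fun i => i + d < b),
      centredTerm y p T F₁ F₂ i x * (starRingEnd ℂ) (centredTerm y p T F₁ F₂ (i + d) x) := by
    intro d x
    rw [Finset.sum_filter]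
    refine Finset.sum_congr rfl fun i hi => ?_
    have hi' := Finset.mem_Ico.mp hi
    simp only [hV, if_pos hi]
    by_cases h : i + d < b
    · rw [if_pos h, if_pos (Finset.mem_Ico.mpr ⟨by omega, h⟩)]
    · rw [if_neg h, if_neg (fun h' => h (Finset.mem_Ico.mp h').2)]; simp
  have hγd : ∀ d < D, 0 < d → ∫ x, (γ d x).re ∂μ ≤ (E + 1) * (2 * t) := by
    intro d hd hd0
    refine (hre d).trans ?_
    simp_rw [hγeq]
    exact norm_integral_correlation_le hT h₁ h₂ hb₁ hb₂ hy ht0 (hE d hd) (ht d hd hd0)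
  have hγbig : ∀ d, H ≤ d → ∫ x, (γ d x).re ∂μ ≤ 0 := by
    intro d hd
    have : ∀ x, γ d x = 0 := fun x => by
      rw [hγeq, Finset.filter_false_of_mem, Finset.sum_empty]
      intro i hi
      rw [Finset.mem_Ico] at hi
      omega
    simp [this]
  have hvdc : ∀ x, (D : ℝ) ^ 2 * ‖∑ i ∈ Finset.Ico a b, centredTerm y p T F₁ F₂ i x‖ ^ 2
      ≤ (H + D : ℝ) * ∑ j ∈ Finset.range D, ∑ j' ∈ Finset.range D,
        (γ ((j - j') + (j' - j)) x).re := by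
    intro x
    have := vanDerCorput (fun i => V i x) a b D hab (fun i hi => by simp only [hV, if_neg hi])
    convert this using 4
    refine Finset.sum_congr rfl fun i hi => ?_
    simp only [hV, if_pos hi]
  have mS : Measurable (fun x => ‖∑ i ∈ Finset.Ico a b, centredTerm y p T F₁ F₂ i x‖ ^ 2) :=
    (Finset.measurable_sum _ fun i _ => measurable_centredTerm hT.measurable h₁ h₂ i).norm.pow_const 2
  have key : (D : ℝ) ^ 2 * ∫ x, ‖∑ i ∈ Finset.Ico a b, centredTerm y p T F₁ F₂ i x‖ ^ 2 ∂μ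
      ≤ (H + D : ℝ) * ∑ j ∈ Finset.range D, ∑ j' ∈ Finset.range D,
        ∫ x, (γ ((j - j') + (j' - j)) x).re ∂μ := by
    calc _ = ∫ x, (D : ℝ) ^ 2 * ‖∑ i ∈ Finset.Ico a b, centredTerm y p T F₁ F₂ i x‖ ^ 2 ∂μ :=
          (integral_const_mul _ _).symm
      _ ≤ ∫ x, (H + D : ℝ) * ∑ j ∈ Finset.range D, ∑ j' ∈ Finset.range D,
            (γ ((j - j') + (j' - j)) x).re ∂μ := by
          refine integral_mono_of_nonneg (ae_of_all _ fun x => by positivity) ?_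
            (ae_of_all _ hvdc)
          exact (integrable_finsetSum _ fun j _ => integrable_finsetSum _ fun j' _ =>
            IR _).const_mul _
      _ = _ := by
          rw [integral_const_mul, integral_finsetSum _ fun j _ => integrable_finsetSum _
            fun j' _ => IR _]
          congr 1
          refine Finset.sum_congr rfl fun j _ => ?_
          rw [integral_finsetSum _ fun j' _ => IR _]
  have hE0 : (0 : ℝ) ≤ (E + 1) * (2 * t) := by positivity
  have hrow : ∀ j ∈ Finset.range D, ∑ j' ∈ Finset.range D,
      ∫ x, (γ ((j - j') + (j' - j)) x).re ∂μ
      ≤ Q + (min (2 * H) D : ℕ) * ((E + 1) * (2 * t)) := by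
    intro j hj
    have hterm : ∀ j' ∈ Finset.range D, ∫ x, (γ ((j - j') + (j' - j)) x).re ∂μ
        ≤ (if j' = j then Q else 0) +
          (if (j - j') + (j' - j) ≠ 0 ∧ (j - j') + (j' - j) < H then (E + 1) * (2 * t) else 0) := by
      intro j' hj'
      rw [Finset.mem_range] at hj hj'
      by_cases h0 : j' = j
      · subst h0; simpa using hγ0
      · rw [if_neg h0, zero_add]
        split_ifs with h
        · exact hγd _ (by omega) (by omega)
        · exact hγbig _ (by omega)
    refine (Finset.sum_le_sum hterm).trans ?_
    rw [Finset.sum_add_distrib, Finset.sum_ite_eq' , if_pos hj, ← Finset.sum_filter,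
      Finset.sum_const, nsmul_eq_mul]
    gcongr
    refine le_min (card_filter_dist_lt_le D H j) ?_
    exact (Finset.card_filter_le _ _).trans (by simp)
  have hD' : (0 : ℝ) < D := by exact_mod_cast hD
  -- `D` may exceed the block length `H`. Each row has at most `min (2 * H) D` off-diagonal entries
  -- that can be nonzero, and this covers both regimes.
  have hmin : ((H : ℝ) + D) * (min (2 * H) D : ℕ) ≤ 4 * H * D := by
    have : (H + D) * min (2 * H) D ≤ 4 * H * D := by
      rcases le_total D H with h | h
      · calc (H + D) * min (2 * H) D ≤ (2 * H) * D := Nat.mul_le_mul (by omega) (min_le_right _ _)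
          _ ≤ 4 * H * D := Nat.mul_le_mul_right _ (by omega)
      · calc (H + D) * min (2 * H) D ≤ (2 * D) * (2 * H) :=
              Nat.mul_le_mul (by omega) (min_le_left _ _)
          _ = 4 * H * D := by ring
    exact_mod_cast this
  have : (D : ℝ) * (D * ∫ x, ‖∑ i ∈ Finset.Ico a b, centredTerm y p T F₁ F₂ i x‖ ^ 2 ∂μ)
      ≤ D * ((H + D) * Q + 8 * H * D * ((E + 1) * t)) := by
    calc _ = (D : ℝ) ^ 2 * ∫ x, ‖∑ i ∈ Finset.Ico a b, centredTerm y p T F₁ F₂ i x‖ ^ 2 ∂μ := by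
          ring
      _ ≤ _ := key
      _ ≤ (H + D : ℝ) * ∑ j ∈ Finset.range D, (Q + (min (2 * H) D : ℕ) * ((E + 1) * (2 * t))) := by
          gcongr with j hj
          exact hrow j hj
      _ = D * ((H + D) * Q + ((H + D) * (min (2 * H) D : ℕ)) * ((E + 1) * (2 * t))) := by
          rw [Finset.sum_const, Finset.card_range, nsmul_eq_mul]; ring
      _ ≤ D * ((H + D) * Q + (4 * H * D) * ((E + 1) * (2 * t))) := by gcongr
      _ = _ := by ring
  exact le_of_mul_le_mul_left this hD'

end Block

/-! ### Good blocks -/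

/-- The correlation exponential sum of the block `[a, b)` with shift `d` and count increment `e`. -/
noncomputable def corrSum (p : ℕ → ℝ) (y : ℕ → ℕ) (a b d e k : ℕ) : ℂ :=
  ∑ i ∈ (Finset.Ico a b).filter (fun i => i + d < b ∧ selCount y (i + d) = selCount y i + e),
    ((((y i : ℝ) - p i) * ((y (i + d) : ℝ) - p (i + d)) : ℝ) : ℂ) *
      unitRoot (2 * b) ^ (k * (i - selCount y i))

/-- A block `[a, b)` is good for `y` if all its windows contain at most the expected order of
selected integers and all its correlation sums exhibit square root cancellation. -/
structure GoodBlock (p : ℕ → ℝ) (a b : ℕ) (U Λ : ℝ) (y : ℕ → ℕ) : Prop where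
  count : ∀ i j, a ≤ i → i ≤ j → j ≤ b → ∑ l ∈ Finset.Ico i j, (y l : ℝ) ≤ 2 * ((j - i : ℕ) * U) + Λ
  corr : ∀ d, 0 < d → ∀ e k, k < 2 * b → ‖corrSum p y a b d e k‖ ≤
    4 * √(Λ * (U * (3 * ((b - a : ℕ) * U) + Λ) + Λ))

/-- Termwise `(y i - p i) ^ 2 ≤ y i + p i`, as both numbers lie in `[0, 1]`; the count bound then
controls the sum. -/
theorem sum_centred_sq_le {p : ℕ → ℝ} {y : ℕ → ℕ} {a b : ℕ} {U Λ : ℝ}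
    (hp0 : ∀ i, 0 ≤ p i) (hp1 : ∀ i, p i ≤ 1)
    (hU : ∀ i, a ≤ i → i < b → p i ≤ U) (hy : ∀ i, y i = 0 ∨ y i = 1)
    (hcount : ∑ l ∈ Finset.Ico a b, (y l : ℝ) ≤ 2 * ((b - a : ℕ) * U) + Λ) :
    ∑ i ∈ Finset.Ico a b, ((y i : ℝ) - p i) ^ 2 ≤ 3 * ((b - a : ℕ) * U) + Λ := by
  have h1 : ∑ i ∈ Finset.Ico a b, ((y i : ℝ) - p i) ^ 2 ≤ ∑ i ∈ Finset.Ico a b, ((y i : ℝ) + U) := by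
    refine Finset.sum_le_sum fun i hi => ?_
    rw [Finset.mem_Ico] at hi
    have := hU i hi.1 hi.2
    have h0 := hp0 i
    have h1 := hp1 i
    rcases hy i with h | h <;> rw [h] <;> push_cast <;> nlinarith
  rw [Finset.sum_add_distrib, Finset.sum_const, Nat.card_Ico, nsmul_eq_mul] at h1
  linarith

namespace IsSelector

variable {Ω : Type*} [MeasurableSpace Ω] {P : Measure Ω} [IsProbabilityMeasure P]
  {Y : ℕ → Ω → ℕ} {p : ℕ → ℝ}

theorem measure_exists_predictable_sum_ge (hY : IsSelector P Y p) {ι : Type*} (s : Finset ι)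
    {c : ι → ℕ → (ℕ → ℕ) → ℝ} (hc : ∀ m, Predictable (c m))
    (hc1 : ∀ m i y, (∀ j, y j = 0 ∨ y j = 1) → |c m i y| ≤ 1) (n : ℕ) (L : ℝ) :
    P {ω | ∃ m ∈ s, L ≤ ∑ i ∈ Finset.range n,
      (c m i (fun j => Y j ω) * (Y i ω - p i) - c m i (fun j => Y j ω) ^ 2 * p i)}
      ≤ s.card * ENNReal.ofReal (Real.exp (-L)) := by
  have : {ω | ∃ m ∈ s, L ≤ ∑ i ∈ Finset.range n,
      (c m i (fun j => Y j ω) * (Y i ω - p i) - c m i (fun j => Y j ω) ^ 2 * p i)}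
      = ⋃ m ∈ s, {ω | L ≤ ∑ i ∈ Finset.range n,
      (c m i (fun j => Y j ω) * (Y i ω - p i) - c m i (fun j => Y j ω) ^ 2 * p i)} := by
    ext ω; simp
  rw [this]
  refine (measure_biUnion_finset_le _ _).trans ?_
  refine (Finset.sum_le_card_nsmul _ _ _ fun m _ => ?_).trans (nsmul_eq_mul _ _).le
  -- The coefficients are bounded only on `{0,1}`-valued sequences; clipping makes the bound
  -- unconditional without altering the values attained.
  set c' : ℕ → (ℕ → ℕ) → ℝ := fun i y => max (-1) (min 1 (c m i y))
  have hcc : ∀ i ω, c' i (fun j => Y j ω) = c m i (fun j => Y j ω) := fun i ω => by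
    have := abs_le.mp (hc1 m i (fun j => Y j ω) fun j => hY.zero_or_one j ω)
    simp only [c']
    rw [min_eq_right this.2, max_eq_right this.1]
  have := hY.measure_predictable_sum_ge (c := c')
    (fun i y y' h => by simp only [c']; rw [hc m i y y' h])
    (fun i y => abs_le.mpr ⟨le_max_left _ _, max_le (by norm_num) (min_le_left _ _)⟩) n L
  simpa only [hcc] using this

/-- A block is good outside an event of small probability. -/
theorem measure_not_goodBlock_le (hY : IsSelector P Y p) {a b : ℕ} {U Λ : ℝ} (hab : a ≤ b)
    (hU0 : 0 ≤ U) (hU : ∀ i, a ≤ i → i < b → p i ≤ U) (hΛ : 0 < Λ) :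
    P {ω | ¬ GoodBlock p a b U Λ (fun i => Y i ω)}
      ≤ ENNReal.ofReal (12 * (b + 1) ^ 3 * Real.exp (-Λ)) := by
  classical
  set V : ℝ := U * (3 * ((b - a : ℕ) * U) + Λ) + Λ with hV
  have hVΛ : Λ ≤ V := by
    have : 0 ≤ U * (3 * ((b - a : ℕ) * U) + Λ) := by positivity
    linarith
  have hVpos : 0 < V := hΛ.trans_le hVΛ
  -- `V` bounds the predictable variance. This `lam` balances `Λ / lam + lam * V`, giving `2 * √(Λ *
  -- V)`; the extra summand `Λ` in `V` ensures `lam ≤ 1`.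
  set lam : ℝ := √(Λ / V) with hlam
  have hlam0 : 0 < lam := Real.sqrt_pos.mpr (by positivity)
  have hlam1 : lam ≤ 1 := Real.sqrt_le_one.mpr ((div_le_one hVpos).mpr hVΛ)
  have hlamsq : lam ^ 2 * V = Λ := by
    rw [hlam, Real.sq_sqrt (by positivity)]; field_simp
  have hlamV : lam * √(Λ * V) = Λ := by
    rw [hlam, ← Real.sqrt_mul (by positivity)]
    rw [show Λ / V * (Λ * V) = Λ ^ 2 by field_simp]
    exact Real.sqrt_sq hΛ.le
  -- Indicators of subintervals, for the counts: the exponential bound with coefficient `1` controls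
  -- the sum of `y l - 2 * p l`.
  set c₁ : ℕ × ℕ → ℕ → (ℕ → ℕ) → ℝ := fun m l _ => if m.1 ≤ l ∧ l < m.2 then 1 else 0 with hc₁
  set s₁ : Finset (ℕ × ℕ) := Finset.range (b + 1) ×ˢ Finset.range (b + 1)
  -- The index is `(d - 1, e, k, σ)`. Each correlation term is charged to its later time `l = i +
  -- d`, where all its other factors are already determined; `Complex.I ^ σ` selects one of four
  -- directions in the plane.
  set c₂ : ℕ × ℕ × ℕ × ℕ → ℕ → (ℕ → ℕ) → ℝ := fun m l y =>
    if a + (m.1 + 1) ≤ l ∧ l < b ∧ selCount y l = selCount y (l - (m.1 + 1)) + m.2.1 then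
      lam * ((y (l - (m.1 + 1)) : ℝ) - p (l - (m.1 + 1))) *
      (Complex.I ^ m.2.2.2 * unitRoot (2 * b) ^
        (m.2.2.1 * (l - (m.1 + 1) - selCount y (l - (m.1 + 1))))).re
    else 0 with hc₂
  set s₂ : Finset (ℕ × ℕ × ℕ × ℕ) := Finset.range b ×ˢ Finset.range b ×ˢ Finset.range (2 * b) ×ˢ
    Finset.range 4
  have p₁ : ∀ m, Predictable (c₁ m) := fun m i y y' _ => rfl
  have p₂ : ∀ m, Predictable (c₂ m) := fun m i y y' h => by
    simp only [hc₂]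
    by_cases hi : a + (m.1 + 1) ≤ i
    · rw [selCount_congr h, selCount_congr (i := i - (m.1 + 1)) fun j hj => h j (by omega),
        h (i - (m.1 + 1)) (by omega)]
    · rw [if_neg (fun h => hi h.1), if_neg (fun h => hi h.1)]
  have b₁ : ∀ m i y, (∀ j, y j = 0 ∨ y j = 1) → |c₁ m i y| ≤ 1 := fun m i y _ => by
    simp only [hc₁]; split_ifs <;> simp
  have hre : ∀ σ n, |(Complex.I ^ σ * unitRoot (2 * b) ^ n).re| ≤ 1 := fun σ n => by
    refine (Complex.abs_re_le_norm _).trans ?_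
    rw [norm_mul, norm_pow, norm_pow, norm_unitRoot, Complex.norm_I]; simp
  have b₂ : ∀ m i y, (∀ j, y j = 0 ∨ y j = 1) → |c₂ m i y| ≤ 1 := fun m i y hy => by
    simp only [hc₂]
    split_ifs
    · rw [abs_mul, abs_mul]
      refine mul_le_one₀ (mul_le_one₀ (by rw [abs_of_pos hlam0]; exact hlam1) (abs_nonneg _) ?_)
        (abs_nonneg _) (hre _ _)
      have h0 := hY.nonneg (i - (m.1 + 1))
      have h1 := hY.le_one (i - (m.1 + 1))
      rw [abs_le]
      rcases hy (i - (m.1 + 1)) with h | h <;> rw [h] <;> push_cast <;> constructor <;> linarith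
    · simp
  have hsub : {ω | ¬ GoodBlock p a b U Λ (fun i => Y i ω)} ⊆
      {ω | ∃ m ∈ s₁, Λ ≤ ∑ i ∈ Finset.range b,
        (c₁ m i (fun j => Y j ω) * (Y i ω - p i) - c₁ m i (fun j => Y j ω) ^ 2 * p i)} ∪
      {ω | ∃ m ∈ s₂, Λ ≤ ∑ i ∈ Finset.range b,
        (c₂ m i (fun j => Y j ω) * (Y i ω - p i) - c₂ m i (fun j => Y j ω) ^ 2 * p i)} := by
    intro ω hω
    by_contra hcon
    apply hω
    simp only [Set.mem_union, Set.mem_ofPred_eq, not_or, not_exists, not_and, not_le] at hcon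
    obtain ⟨hA, hB⟩ := hcon
    set y : ℕ → ℕ := fun j => Y j ω
    have hy : ∀ i, y i = 0 ∨ y i = 1 := fun i => hY.zero_or_one i ω
    have hcount : ∀ i j, a ≤ i → i ≤ j → j ≤ b →
        ∑ l ∈ Finset.Ico i j, (y l : ℝ) ≤ 2 * ((j - i : ℕ) * U) + Λ := by
      intro i j hai hij hjb
      have h := hA (i, j) (by simp only [s₁, Finset.mem_product, Finset.mem_range]; omega)
      have e : ∑ l ∈ Finset.range b, (c₁ (i, j) l y * (Y l ω - p l) - c₁ (i, j) l y ^ 2 * p l)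
          = ∑ l ∈ Finset.Ico i j, ((y l : ℝ) - 2 * p l) := by
        have : Finset.Ico i j = (Finset.range b).filter (fun l => i ≤ l ∧ l < j) := by
          ext l; simp only [Finset.mem_Ico, Finset.mem_filter, Finset.mem_range]; omega
        rw [this, Finset.sum_filter]
        refine Finset.sum_congr rfl fun l _ => ?_
        simp only [hc₁, y]
        split_ifs <;> ring
      rw [e, Finset.sum_sub_distrib] at h
      have h2 : ∑ l ∈ Finset.Ico i j, 2 * p l ≤ (j - i : ℕ) * (2 * U) := by
        rw [← Nat.card_Ico, ← nsmul_eq_mul]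
        refine Finset.sum_le_card_nsmul _ _ _ fun l hl => ?_
        rw [Finset.mem_Ico] at hl
        linarith [hU l (by omega) (by omega)]
      linarith
    refine ⟨hcount, ?_⟩
    intro d hd e k hk
    obtain ⟨d, rfl⟩ : ∃ d', d = d' + 1 := ⟨d - 1, by omega⟩
    have hnn : 0 ≤ 4 * √(Λ * V) := by positivity
    by_cases hdb : d < b
    swap
    · rw [corrSum, Finset.filter_false_of_mem, Finset.sum_empty, norm_zero]
      · exact hnn
      · intro i _; omega
    by_cases heb : e < b
    swap
    · rw [corrSum, Finset.filter_false_of_mem, Finset.sum_empty, norm_zero]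
      · exact hnn
      · rintro i _ ⟨h1, h2⟩
        have := selCount_le hy (i + (d + 1))
        omega
    have hdir : ∀ σ < 4, (Complex.I ^ σ * corrSum p y a b (d + 1) e k).re ≤ 2 * √(Λ * V) := by
      intro σ hσ
      have h := hB (d, e, k, σ) (by
        simp only [s₂, Finset.mem_product, Finset.mem_range]; omega)
      set F := (Finset.Ico a b).filter
        (fun i => i + (d + 1) < b ∧ selCount y (i + (d + 1)) = selCount y i + e) with hF
      set ρ : ℕ → ℝ := fun i =>
        (Complex.I ^ σ * unitRoot (2 * b) ^ (k * (i - selCount y i))).re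
      have e1 : ∑ l ∈ Finset.range b,
          (c₂ (d, e, k, σ) l y * (Y l ω - p l) - c₂ (d, e, k, σ) l y ^ 2 * p l)
          = ∑ i ∈ F, (lam * (((y i : ℝ) - p i) * ((y (i + (d + 1)) : ℝ) - p (i + (d + 1))) * ρ i)
            - lam ^ 2 * (((y i : ℝ) - p i) ^ 2 * ρ i ^ 2 * p (i + (d + 1)))) := by
        symm
        refine Finset.sum_of_injOn (fun i => i + (d + 1)) (fun i _ j _ h => by simpa using h)
          (fun i hi => ?_) (fun l hl hl2 => ?_) (fun i hi => ?_)
        · simp only [hF, Finset.coe_filter, Set.mem_ofPred_eq] at hi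
          simp only [Finset.coe_range, Set.mem_Iio]; exact hi.2.1
        · have : ¬ (a + (d + 1) ≤ l ∧ l < b ∧
              selCount y l = selCount y (l - (d + 1)) + e) := by
            rintro ⟨h1, h2, h3⟩
            refine hl2 ⟨l - (d + 1), ?_, by simp only; omega⟩
            simp only [hF, Finset.coe_filter, Set.mem_ofPred_eq, Finset.mem_Ico]
            rw [show l - (d + 1) + (d + 1) = l by omega]
            exact ⟨⟨by omega, by omega⟩, h2, h3⟩
          simp only [hc₂, if_neg this]; ring
        · simp only [hF, Finset.mem_filter, Finset.mem_Ico] at hi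
          have : (a + (d + 1) ≤ i + (d + 1) ∧ i + (d + 1) < b ∧
              selCount y (i + (d + 1)) = selCount y (i + (d + 1) - (d + 1)) + e) := by
            rw [Nat.add_sub_cancel]
            exact ⟨by omega, hi.2.1, hi.2.2⟩
          simp only [hc₂, if_pos this, Nat.add_sub_cancel, ρ, y]
          ring
      have e2 : (Complex.I ^ σ * corrSum p y a b (d + 1) e k).re
          = ∑ i ∈ F, ((y i : ℝ) - p i) * ((y (i + (d + 1)) : ℝ) - p (i + (d + 1))) * ρ i := by
        rw [corrSum, Finset.mul_sum, Complex.re_sum]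
        refine Finset.sum_congr rfl fun i _ => ?_
        simp only [ρ]
        rw [← Complex.re_ofReal_mul]
        congr 1
        ring
      -- The variance is bounded deterministically, using the count property just obtained for the
      -- whole block.
      have e3 : ∑ i ∈ F, ((y i : ℝ) - p i) ^ 2 * ρ i ^ 2 * p (i + (d + 1)) ≤ V := by
        calc _ ≤ ∑ i ∈ F, U * ((y i : ℝ) - p i) ^ 2 := by
              refine Finset.sum_le_sum fun i hi => ?_
              simp only [hF, Finset.mem_filter, Finset.mem_Ico] at hi
              have h1 : ρ i ^ 2 ≤ 1 := by
                rw [← sq_abs]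
                exact pow_le_one₀ (abs_nonneg _) (hre _ _)
              have h2 := hU (i + (d + 1)) (by omega) hi.2.1
              calc ((y i : ℝ) - p i) ^ 2 * ρ i ^ 2 * p (i + (d + 1))
                  ≤ ((y i : ℝ) - p i) ^ 2 * 1 * U := by
                    gcongr
                    exact hY.nonneg _
                _ = _ := by ring
          _ ≤ ∑ i ∈ Finset.Ico a b, U * ((y i : ℝ) - p i) ^ 2 :=
              Finset.sum_le_sum_of_subset_of_nonneg (Finset.filter_subset _ _)
                fun _ _ _ => by positivity
          _ = U * ∑ i ∈ Finset.Ico a b, ((y i : ℝ) - p i) ^ 2 := by rw [Finset.mul_sum]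
          _ ≤ U * (3 * ((b - a : ℕ) * U) + Λ) := by
              gcongr
              exact sum_centred_sq_le hY.nonneg hY.le_one hU hy (hcount a b le_rfl hab le_rfl)
          _ ≤ V := by linarith
      rw [e1, Finset.sum_sub_distrib, ← Finset.mul_sum, ← Finset.mul_sum, ← e2] at h
      have h4 := mul_le_mul_of_nonneg_left e3 (sq_nonneg lam)
      have h5 : lam * (Complex.I ^ σ * corrSum p y a b (d + 1) e k).re
          ≤ lam * (2 * √(Λ * V)) := by linarith
      exact le_of_mul_le_mul_left h5 hlam0
    set S := corrSum p y a b (d + 1) e k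
    have h0 := hdir 0 (by norm_num)
    have h1 := hdir 1 (by norm_num)
    have h2 := hdir 2 (by norm_num)
    have h3 := hdir 3 (by norm_num)
    simp only [pow_zero, one_mul, pow_one, Complex.I_sq, Complex.I_pow_three, neg_mul,
      Complex.neg_re, Complex.mul_re, Complex.I_re, Complex.I_im, zero_mul, zero_sub] at h0 h1 h2 h3
    refine (Complex.norm_le_abs_re_add_abs_im S).trans ?_
    have hr : |S.re| ≤ 2 * √(Λ * V) := abs_le.mpr ⟨by linarith, by linarith⟩
    have hi : |S.im| ≤ 2 * √(Λ * V) := abs_le.mpr ⟨by linarith, by linarith⟩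
    linarith
  refine (measure_mono hsub).trans ((measure_union_le _ _).trans ?_)
  refine (add_le_add (hY.measure_exists_predictable_sum_ge s₁ p₁ b₁ b Λ)
    (hY.measure_exists_predictable_sum_ge s₂ p₂ b₂ b Λ)).trans ?_
  rw [← add_mul, ← Nat.cast_add, ENNReal.ofReal_mul (by positivity), ← ENNReal.ofReal_natCast]
  gcongr
  simp only [s₁, s₂, Finset.card_product, Finset.card_range]
  have : (b + 1) * (b + 1) + b * (b * (2 * b * 4)) ≤ 12 * (b + 1) ^ 3 := by
    nlinarith [Nat.zero_le b, Nat.zero_le (b ^ 2), Nat.zero_le (b ^ 3)]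
  exact_mod_cast this

end IsSelector

/-! ### Mean square of good blocks relative to their weights -/

/-- The weight of the block `[a, b)`: its expected number of selected integers plus a correction. -/
noncomputable def blockWeight (p : ℕ → ℝ) (δ x : ℝ) (a b : ℕ) : ℝ :=
  ∑ i ∈ Finset.Ico a b, p i + √((b - a : ℕ) : ℝ) * x ^ (5 / 2 + δ)

/-- Here `r = √H`, `g = √x`, `z = x ^ (δ / 2)`, with `H` the block length, which turns all powers
into integral ones. After multiplication by `g ^ 2 * z` the critical off-diagonal term is `r ^ 3 * U
* g ^ 5 * z ^ 2`, a multiple of the cross term in the square of the weight; the exponent `5 / 2 + δ`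
in `blockWeight` makes these match. -/
theorem block_polynomial_inequality {r g z U w : ℝ} (hr : 1 ≤ r) (hg : 1 ≤ g) (hz : 1 ≤ z)
    (hU : 0 ≤ U) (hw : r ^ 2 * U / 3 + r * g ^ 5 * z ^ 2 ≤ w) :
    (r ^ 2 * U / (g ^ 2 * z) + 1) * (3 * (r ^ 2 * U) + 10 * g ^ 2)
      + 8 * r ^ 2 * (15 * (g ^ 2 * z) * (4 * (6 * (g * r * U) + 15 * g ^ 2)))
      ≤ 20000 * (g ^ 2 * z)⁻¹ * w ^ 2 := by
  set A := r ^ 2 * U with hA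
  have hA0 : 0 ≤ A := by positivity
  have hw2 : (A / 3 + r * g ^ 5 * z ^ 2) ^ 2 ≤ w ^ 2 := by gcongr
  have hX : 0 < g ^ 2 * z := by positivity
  refine le_trans ?_ (mul_le_mul_of_nonneg_left hw2 (by positivity))
  rw [← sub_nonneg]
  have : 20000 * (g ^ 2 * z)⁻¹ * (A / 3 + r * g ^ 5 * z ^ 2) ^ 2 -
      ((A / (g ^ 2 * z) + 1) * (3 * A + 10 * g ^ 2)
      + 8 * r ^ 2 * (15 * (g ^ 2 * z) * (4 * (6 * (g * r * U) + 15 * g ^ 2))))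
      = (g ^ 2 * z)⁻¹ * (20000 * (A / 3 + r * g ^ 5 * z ^ 2) ^ 2 - (3 * A ^ 2 + 10 * A * g ^ 2
        + 3 * A * (g ^ 2 * z) + 10 * g ^ 4 * z + 2880 * (r * A) * (g ^ 5 * z ^ 2)
        + 7200 * r ^ 2 * (g ^ 6 * z ^ 2))) := by
    rw [hA]; field_simp; ring
  rw [this]
  refine mul_nonneg (by positivity) ?_
  have m1 : A * g ^ 2 ≤ A * (r * (g ^ 5 * z ^ 2)) := by
    gcongr
    calc g ^ 2 = 1 * (g ^ 2 * 1 ^ 2) := by ring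
      _ ≤ r * (g ^ 5 * z ^ 2) := by (gcongr; norm_num)
  have m2 : A * (g ^ 2 * z) ≤ A * (r * (g ^ 5 * z ^ 2)) := by
    refine mul_le_mul_of_nonneg_left ?_ hA0
    calc g ^ 2 * z = 1 * (g ^ 2 * z ^ 1) := by ring
      _ ≤ r * (g ^ 5 * z ^ 2) := by gcongr <;> first | exact hg | exact hz | norm_num
  have m3 : g ^ 4 * z ≤ r ^ 2 * (g ^ 10 * z ^ 4) := by
    calc g ^ 4 * z = 1 ^ 2 * (g ^ 4 * z ^ 1) := by ring
      _ ≤ r ^ 2 * (g ^ 10 * z ^ 4) := by gcongr <;> first | exact hg | exact hz | norm_num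
  have m4 : r ^ 2 * (g ^ 6 * z ^ 2) ≤ r ^ 2 * (g ^ 10 * z ^ 4) := by
    gcongr <;> first | exact hg | exact hz | norm_num
  have m5 : 0 ≤ A * (r * (g ^ 5 * z ^ 2)) := by positivity
  have m6 : 0 ≤ r ^ 2 * (g ^ 10 * z ^ 4) := by positivity
  have e : (A / 3 + r * g ^ 5 * z ^ 2) ^ 2
      = A ^ 2 / 9 + 2 / 3 * (A * (r * (g ^ 5 * z ^ 2))) + r ^ 2 * (g ^ 10 * z ^ 4) := by ring
  rw [e]
  have m7 : 0 ≤ A ^ 2 := by positivity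
  nlinarith

/-- The point is the factor `x ^ (-(1 + δ / 2))`, summable when `x` runs through `q + 1`. It comes
from the diagonal term of van der Corput divided by `D`. -/
theorem integral_norm_sq_goodBlock_le {X : Type*} [MeasurableSpace X] {μ : Measure X}
    [IsProbabilityMeasure μ] {T : X → X} (hT : MeasurePreserving T μ μ) {F₁ F₂ : X → ℂ}
    (h₁ : Measurable F₁) (h₂ : Measurable F₂) (hb₁ : ∀ x, ‖F₁ x‖ ≤ 1) (hb₂ : ∀ x, ‖F₂ x‖ ≤ 1)
    {y : ℕ → ℕ} {p : ℕ → ℝ} (hy : ∀ i, y i = 0 ∨ y i = 1) (hp0 : ∀ i, 0 ≤ p i)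
    (hp1 : ∀ i, p i ≤ 1) {a b : ℕ} {U x δ : ℝ} (hx : 1 ≤ x) (hδ : 0 < δ) (hab : a < b)
    (hU0 : 0 < U) (hU1 : U ≤ 1) (hU : ∀ i, a ≤ i → i < b → p i ≤ U)
    (hU3 : ∀ i, a ≤ i → i < b → U / 3 ≤ p i)
    (hgood : GoodBlock p a b U (10 * x) y) :
    ∫ ω, ‖∑ i ∈ Finset.Ico a b, centredTerm y p T F₁ F₂ i ω‖ ^ 2 ∂μ
      ≤ 20000 * x ^ (-(1 + δ / 2)) * blockWeight p δ x a b ^ 2 := by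
  set H : ℕ := b - a with hH
  have hx0 : 0 < x := by linarith
  set g := √x with hg
  set z := x ^ (δ / 2) with hz
  set r := √(H : ℝ) with hr
  have hg1 : 1 ≤ g := Real.one_le_sqrt.mpr hx
  have hz1 : 1 ≤ z := Real.one_le_rpow hx (by positivity)
  have hH1 : (1 : ℝ) ≤ H := by exact_mod_cast (by omega : 1 ≤ H)
  have hr1 : 1 ≤ r := Real.one_le_sqrt.mpr hH1
  have hxg : x = g ^ 2 := (Real.sq_sqrt hx0.le).symm
  have hHr : (H : ℝ) = r ^ 2 := (Real.sq_sqrt (by positivity)).symm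
  have hX : x ^ (1 + δ / 2) = g ^ 2 * z := by
    rw [Real.rpow_add hx0, Real.rpow_one, ← hxg]
  have hs : x ^ (5 / 2 + δ) = g ^ 5 * z ^ 2 := by
    have h1 : x ^ (5 / 2 : ℝ) = g ^ 5 := by
      rw [hg, Real.sqrt_eq_rpow, ← Real.rpow_natCast, ← Real.rpow_mul hx0.le]; norm_num
    have h2 : x ^ δ = z ^ 2 := by
      rw [hz, ← Real.rpow_natCast, ← Real.rpow_mul hx0.le]; congr 1; push_cast; ring
    rw [Real.rpow_add hx0, h1, h2]
  set w := blockWeight p δ x a b with hw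
  have hwlow : r ^ 2 * U / 3 + r * g ^ 5 * z ^ 2 ≤ w := by
    rw [hw, blockWeight, hs, ← hH, ← hr]
    have : (H : ℝ) * (U / 3) ≤ ∑ i ∈ Finset.Ico a b, p i := by
      rw [hH, ← Nat.card_Ico, ← nsmul_eq_mul]
      exact Finset.card_nsmul_le_sum _ _ _ fun i hi =>
        hU3 i (Finset.mem_Ico.mp hi).1 (Finset.mem_Ico.mp hi).2
    rw [hHr] at this
    linarith
  -- A window of length `D` contains about `x ^ (1 + δ / 2)` expected selections: enough to gain
  -- that factor on the diagonal, while few count increments `e` occur.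
  set D : ℕ := ⌈x ^ (1 + δ / 2) / U⌉₊ with hDdef
  have hDlow : g ^ 2 * z / U ≤ D := by rw [← hX]; exact Nat.le_ceil _
  have hDpos : 0 < D := Nat.ceil_pos.mpr (by positivity)
  have hDup : D * U ≤ 2 * (g ^ 2 * z) := by
    have h1 : (D : ℝ) < g ^ 2 * z / U + 1 := by rw [← hX]; exact Nat.ceil_lt_add_one (by positivity)
    have h2 : (1 : ℝ) ≤ g ^ 2 * z := by
      calc (1 : ℝ) = 1 ^ 2 * 1 := by norm_num
        _ ≤ g ^ 2 * z := by gcongr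
    have h3 : (D : ℝ) * U ≤ (g ^ 2 * z / U + 1) * U := by gcongr
    rw [add_mul, div_mul_cancel₀ _ hU0.ne'] at h3
    linarith
  -- The good-block bound for the number of selections in a window shorter than `D`.
  set E : ℕ := ⌊2 * (D * U) + 10 * x⌋₊ with hEdef
  have hE15 : (E : ℝ) + 1 ≤ 15 * (g ^ 2 * z) := by
    have h1 : (E : ℝ) ≤ 2 * (D * U) + 10 * x := Nat.floor_le (by positivity)
    have h2 : (1 : ℝ) ≤ g ^ 2 := one_le_pow₀ hg1
    have h3 : g ^ 2 ≤ g ^ 2 * z := le_mul_of_one_le_right (by positivity) hz1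
    have h4 : x ≤ g ^ 2 * z := hxg.le.trans h3
    linarith
  set t : ℝ := 4 * √(10 * x * (U * (3 * (H * U) + 10 * x) + 10 * x)) with ht
  have htpos : 0 < t := by positivity
  have htup : t ≤ 4 * (6 * (g * r * U) + 15 * g ^ 2) := by
    rw [ht]
    gcongr
    refine Real.sqrt_le_iff.mpr ⟨by positivity, ?_⟩
    rw [hHr, hxg]
    have e1 : g ^ 4 * U ≤ g ^ 4 * 1 := by gcongr
    have e2 : 0 ≤ g ^ 2 * r ^ 2 * U ^ 2 := by positivity
    have e3 : 0 ≤ g ^ 3 * r * U := by positivity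
    have e4 : 0 ≤ g ^ 4 := by positivity
    nlinarith
  have hcount : ∑ l ∈ Finset.Ico a b, (y l : ℝ) ≤ 2 * ((b - a : ℕ) * U) + 10 * x :=
    hgood.count a b le_rfl hab.le le_rfl
  have hblock := integral_norm_sq_block_le hT h₁ h₂ hb₁ hb₂ hy (a := a) (b := b) (D := D) (E := E)
    (Q := 3 * (H * U) + 10 * x) (t := t) hab.le hDpos htpos
    (sum_centred_sq_le hp0 hp1 hU hy hcount)
    (by
      intro d hd i hai hib
      have h1 := hgood.count i (i + d) hai (by omega) (by omega)
      rw [Nat.add_sub_cancel_left] at h1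
      have h2 : ((∑ l ∈ Finset.Ico i (i + d), y l : ℕ) : ℝ) ≤ 2 * (D * U) + 10 * x := by
        push_cast
        refine h1.trans ?_
        gcongr
      rw [selCount_add]
      gcongr
      exact Nat.le_floor h2)
    (fun d _ hd0 e _ k hk => hgood.corr d hd0 e k hk)
  rw [← hH] at hblock
  have hDpos' : (0 : ℝ) < D := by exact_mod_cast hDpos
  set J := ∫ ω, ‖∑ i ∈ Finset.Ico a b, centredTerm y p T F₁ F₂ i ω‖ ^ 2 ∂μ
  have hJ : J ≤ (H / D + 1) * (3 * (H * U) + 10 * x) + 8 * H * ((E + 1) * t) := by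
    have : (D : ℝ) * J ≤ D * ((H / D + 1) * (3 * (H * U) + 10 * x) + 8 * H * ((E + 1) * t)) := by
      refine hblock.trans (le_of_eq ?_)
      field_simp
    exact le_of_mul_le_mul_left this hDpos'
  refine hJ.trans ?_
  rw [Real.rpow_neg hx0.le, hX]
  refine le_trans ?_ (block_polynomial_inequality hr1 hg1 hz1 hU0.le hwlow)
  rw [← hxg, hHr]
  have hHD : r ^ 2 / (D : ℝ) ≤ r ^ 2 * U / (x * z) := by
    rw [hxg, mul_div_assoc, div_eq_mul_inv]
    gcongr
    rw [show U / (g ^ 2 * z) = (g ^ 2 * z / U)⁻¹ by rw [inv_div]]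
    gcongr
  rw [hxg] at hHD ⊢
  gcongr

/-! ### Slowly decaying selection probabilities and their block decomposition -/

/-- Selection probabilities decaying more slowly than `log ^ (3 + δ) n / √n`. -/
structure SlowDecay (p : ℕ → ℝ) (δ : ℝ) : Prop where
  anti : Antitone p
  pos : ∀ i, 0 < p i
  le_one : ∀ i, p i ≤ 1
  slow : Tendsto (fun i : ℕ => p i * (√((i : ℝ) + 1) / Real.log ((i : ℝ) + 1) ^ (3 + δ))) atTop atTop

/-- The expected number of selected integers below `M`. -/
def expCount (p : ℕ → ℝ) (M : ℕ) : ℝ := ∑ i ∈ Finset.range M, p i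

theorem expCount_mono {p : ℕ → ℝ} (hp : ∀ i, 0 ≤ p i) : Monotone (expCount p) := fun _ _ h =>
  Finset.sum_le_sum_of_subset_of_nonneg (Finset.range_subset_range.mpr h) fun i _ _ => hp i

theorem mul_le_expCount {p : ℕ → ℝ} (hp : Antitone p) (M : ℕ) : M * p M ≤ expCount p M := by
  have := Finset.card_nsmul_le_sum (Finset.range M) p (p M) fun i hi =>
    hp (Finset.mem_range.mp hi).le
  rwa [Finset.card_range, nsmul_eq_mul] at this

theorem tendsto_log_succ : Tendsto (fun i : ℕ => Real.log ((i : ℝ) + 1)) atTop atTop :=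
  Real.tendsto_log_atTop.comp (tendsto_atTop_add_const_right _ _ tendsto_natCast_atTop_atTop)

namespace SlowDecay

variable {p : ℕ → ℝ} {δ : ℝ}

theorem eventually_le (hp : SlowDecay p δ) (C : ℝ) : ∀ᶠ i : ℕ in atTop,
    C * (√((i : ℝ) + 1) * Real.log ((i : ℝ) + 1) ^ (3 + δ)) ≤ ((i : ℝ) + 1) * p i := by
  filter_upwards [hp.slow.eventually_ge_atTop C, tendsto_log_succ.eventually_ge_atTop 1] with i h1 h2
  have hL : 0 < Real.log ((i : ℝ) + 1) ^ (3 + δ) := Real.rpow_pos_of_pos (by linarith) _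
  have hs : √((i : ℝ) + 1) * √((i : ℝ) + 1) = (i : ℝ) + 1 := Real.mul_self_sqrt (by positivity)
  calc C * (√((i : ℝ) + 1) * Real.log ((i : ℝ) + 1) ^ (3 + δ))
      ≤ (p i * (√((i : ℝ) + 1) / Real.log ((i : ℝ) + 1) ^ (3 + δ))) *
        (√((i : ℝ) + 1) * Real.log ((i : ℝ) + 1) ^ (3 + δ)) := by gcongr
    _ = (√((i : ℝ) + 1) * √((i : ℝ) + 1)) * p i := by field_simp
    _ = _ := by rw [hs]

theorem eventually_le_expCount (hp : SlowDecay p δ) (C : ℝ) : ∀ᶠ i : ℕ in atTop,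
    C * (√((i : ℝ) + 1) * Real.log ((i : ℝ) + 1) ^ (3 + δ)) ≤ expCount p i := by
  filter_upwards [hp.eventually_le (2 * C), eventually_ge_atTop 1] with i h1 h2
  have h3 := mul_le_expCount hp.anti i
  have h4 := (hp.pos i).le
  have h5 : (1 : ℝ) ≤ i := by exact_mod_cast h2
  nlinarith

theorem eventually_sqrt_le_expCount (hp : SlowDecay p δ) (hδ : 0 < δ) : ∀ᶠ i : ℕ in atTop,
    √((i : ℝ) + 1) ≤ expCount p i := by
  filter_upwards [hp.eventually_le_expCount 1, tendsto_log_succ.eventually_ge_atTop 1] with i h1 h2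
  refine le_trans ?_ h1
  rw [one_mul]
  exact le_mul_of_one_le_right (by positivity) (Real.one_le_rpow h2 (by linarith))

theorem tendsto_expCount (hp : SlowDecay p δ) (hδ : 0 < δ) :
    Tendsto (expCount p) atTop atTop := by
  refine tendsto_atTop_mono' _ (hp.eventually_sqrt_le_expCount hδ) ?_
  exact Real.tendsto_sqrt_atTop.comp
    (tendsto_atTop_add_const_right _ _ tendsto_natCast_atTop_atTop)

/-- Ensures that the second summand of `blockKey` contributes only logarithmically many blocks,
however `p` decays. -/
theorem eventually_neg_log_le (hp : SlowDecay p δ) (hδ : 0 < δ) : ∀ᶠ i : ℕ in atTop,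
    -Real.log (p i) ≤ Real.log ((i : ℝ) + 1) := by
  filter_upwards [hp.eventually_le 1, tendsto_log_succ.eventually_ge_atTop 1] with i h1 h2
  have h3 : (1 : ℝ) ≤ ((i : ℝ) + 1) * p i := by
    refine le_trans ?_ h1
    rw [one_mul]
    have : (1 : ℝ) ≤ √((i : ℝ) + 1) := Real.one_le_sqrt.mpr (by linarith [(Nat.cast_nonneg i : (0 : ℝ) ≤ i)])
    exact one_le_mul_of_one_le_of_one_le this (Real.one_le_rpow h2 (by linarith))
  have h4 := Real.log_nonneg h3
  rw [Real.log_mul (by positivity) (hp.pos i).ne'] at h4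
  linarith

end SlowDecay

/-- Indices with the same key form a block, on which both `i + 1` and `p i` vary little. -/
noncomputable def blockKey (K : ℕ) (p : ℕ → ℝ) (i : ℕ) : ℕ :=
  ⌊K * Real.log ((i : ℝ) + 1)⌋₊ + ⌊-Real.log (p i)⌋₊

/-- The first index whose key is at least `q`. -/
noncomputable def blockStart (K : ℕ) (p : ℕ → ℝ) (q : ℕ) : ℕ := sInf {i | q ≤ blockKey K p i}

section Blocks

variable {p : ℕ → ℝ} {δ : ℝ} {K : ℕ}

theorem monotone_floor_log : Monotone (fun i : ℕ => ⌊K * Real.log ((i : ℝ) + 1)⌋₊) :=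
  fun i j h => by
    refine Nat.floor_mono (mul_le_mul_of_nonneg_left (Real.log_le_log (by positivity) ?_)
      (Nat.cast_nonneg K))
    have : (i : ℝ) ≤ j := by exact_mod_cast h
    linarith

theorem SlowDecay.monotone_floor_neg_log (hp : SlowDecay p δ) :
    Monotone (fun i : ℕ => ⌊-Real.log (p i)⌋₊) := fun _ j h =>
  Nat.floor_mono (neg_le_neg (Real.log_le_log (hp.pos j) (hp.anti h)))

theorem SlowDecay.blockKey_mono (hp : SlowDecay p δ) : Monotone (blockKey K p) :=
  monotone_floor_log.add hp.monotone_floor_neg_log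

theorem tendsto_blockKey (hK : 0 < K) : Tendsto (blockKey K p) atTop atTop := by
  have hK' : (0 : ℝ) < K := by exact_mod_cast hK
  refine tendsto_atTop_mono (fun i => Nat.le_add_right _ _) ?_
  exact tendsto_nat_floor_atTop.comp (tendsto_log_succ.const_mul_atTop hK')

theorem SlowDecay.lt_blockStart_iff (hp : SlowDecay p δ) (hK : 0 < K) {i q : ℕ} :
    i < blockStart K p q ↔ blockKey K p i < q := by
  have hne : {i | q ≤ blockKey K p i}.Nonempty :=
    ((tendsto_blockKey hK).eventually_ge_atTop q).exists
  constructor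
  · intro h
    by_contra hcon
    exact absurd (Nat.sInf_le (show i ∈ {i | q ≤ blockKey K p i} from not_lt.mp hcon)) (not_le.mpr h)
  · intro h
    by_contra hcon
    have h1 : q ≤ blockKey K p (blockStart K p q) := Nat.sInf_mem hne
    have h2 := hp.blockKey_mono (K := K) (not_lt.mp hcon)
    omega

theorem SlowDecay.blockStart_mono (hp : SlowDecay p δ) (hK : 0 < K) :
    Monotone (blockStart K p) := fun q q' h => by
  by_contra hcon
  have h1 := (hp.lt_blockStart_iff hK).mp (not_le.mp hcon)
  have h2 := mt (hp.lt_blockStart_iff (K := K) (q := q') hK).mpr (lt_irrefl _)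
  omega

theorem blockStart_zero : blockStart K p 0 = 0 := by
  simp [blockStart]

theorem SlowDecay.blockKey_eq (hp : SlowDecay p δ) (hK : 0 < K) {i q : ℕ}
    (h1 : blockStart K p q ≤ i) (h2 : i < blockStart K p (q + 1)) : blockKey K p i = q := by
  have := (hp.lt_blockStart_iff hK).mp h2
  have := mt (hp.lt_blockStart_iff hK).mpr (not_lt.mpr h1)
  omega

theorem SlowDecay.blockStart_le (hp : SlowDecay p δ) (hK : 0 < K) (i : ℕ) :
    blockStart K p (blockKey K p i) ≤ i ∧ i < blockStart K p (blockKey K p i + 1) :=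
  ⟨not_lt.mp fun h => lt_irrefl _ ((hp.lt_blockStart_iff hK).mp h),
    (hp.lt_blockStart_iff hK).mpr (Nat.lt_succ_self _)⟩

theorem SlowDecay.tendsto_blockStart (hp : SlowDecay p δ) (hK : 0 < K) :
    Tendsto (blockStart K p) atTop atTop := by
  refine tendsto_atTop_atTop.mpr fun b => ⟨blockKey K p b + 1, fun q hq => ?_⟩
  exact ((hp.lt_blockStart_iff hK).mpr (by omega)).le

/-- The last index before the block end has key at most `q`, and the key dominates the logarithm up
to rounding. Hence the polynomial loss of the union bound in block `q` is only exponential in `q`.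
-/
theorem SlowDecay.blockStart_succ_le_exp (hp : SlowDecay p δ) (hK : 0 < K) (q : ℕ) :
    (blockStart K p (q + 1) : ℝ) ≤ Real.exp (q + 1) := by
  rcases Nat.eq_zero_or_pos (blockStart K p (q + 1)) with h | h
  · rw [h]; simpa using (Real.exp_pos _).le
  · obtain ⟨i, hi⟩ : ∃ i, blockStart K p (q + 1) = i + 1 := ⟨_, (Nat.succ_pred_eq_of_pos h).symm⟩
    have h1 := (hp.lt_blockStart_iff (K := K) (i := i) (q := q + 1) hK).mp (by omega)
    have h2 : ⌊K * Real.log ((i : ℝ) + 1)⌋₊ < q + 1 := lt_of_le_of_lt (Nat.le_add_right _ _) h1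
    have h3 : K * Real.log ((i : ℝ) + 1) < q + 1 := by
      exact_mod_cast (Nat.floor_lt' (by omega)).mp h2
    have h4 : Real.log ((i : ℝ) + 1) ≤ K * Real.log ((i : ℝ) + 1) :=
      le_mul_of_one_le_left (Real.log_nonneg (by linarith [(Nat.cast_nonneg i : (0 : ℝ) ≤ i)]))
        (by exact_mod_cast hK)
    rw [hi]
    push_cast
    exact (Real.log_le_iff_le_exp (by positivity)).mp (by linarith)

/-- Both summands of the key are monotone, so equality of the sums forces equality of each. -/
theorem SlowDecay.floor_eq_of_blockKey_eq (hp : SlowDecay p δ) {i j : ℕ} (hij : i ≤ j)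
    (h : blockKey K p i = blockKey K p j) :
    ⌊K * Real.log ((i : ℝ) + 1)⌋₊ = ⌊K * Real.log ((j : ℝ) + 1)⌋₊ ∧
    ⌊-Real.log (p i)⌋₊ = ⌊-Real.log (p j)⌋₊ := by
  have h1 := monotone_floor_log (K := K) hij
  have h2 := hp.monotone_floor_neg_log hij
  simp only [blockKey] at h h1 h2
  omega

theorem SlowDecay.div_three_le (hp : SlowDecay p δ) {i j : ℕ} (hij : i ≤ j)
    (h : blockKey K p i = blockKey K p j) : p i / 3 ≤ p j := by
  have h1 := (hp.floor_eq_of_blockKey_eq hij h).2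
  have h2 : (⌊-Real.log (p i)⌋₊ : ℝ) ≤ -Real.log (p i) :=
    Nat.floor_le (neg_nonneg.mpr (Real.log_nonpos (hp.pos i).le (hp.le_one i)))
  have h3 := Nat.lt_floor_add_one (-Real.log (p j))
  rw [← h1] at h3
  have h4 : Real.log (p i) ≤ Real.log (p j) + 1 := by linarith
  have h5 : p i ≤ p j * Real.exp 1 := by
    rw [← Real.exp_log (hp.pos i), ← Real.exp_log (hp.pos j), ← Real.exp_add]
    simpa using h4
  have h6 := Real.exp_one_lt_d9
  have h7 := hp.pos j
  nlinarith

theorem SlowDecay.succ_le_of_blockKey_eq (hp : SlowDecay p δ) (hK : 0 < K) {i j : ℕ} (hij : i ≤ j)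
    (h : blockKey K p i = blockKey K p j) :
    (j : ℝ) + 1 ≤ Real.exp (1 / K) * (i + 1) := by
  have hK' : (0 : ℝ) < K := by exact_mod_cast hK
  have h1 := (hp.floor_eq_of_blockKey_eq hij h).1
  have hi : (0 : ℝ) ≤ Real.log ((i : ℝ) + 1) :=
    Real.log_nonneg (by linarith [(Nat.cast_nonneg i : (0 : ℝ) ≤ i)])
  have h2 : (⌊K * Real.log ((i : ℝ) + 1)⌋₊ : ℝ) ≤ K * Real.log ((i : ℝ) + 1) :=
    Nat.floor_le (by positivity)
  have h3 := Nat.lt_floor_add_one (K * Real.log ((j : ℝ) + 1))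
  rw [← h1] at h3
  have h4 : Real.log ((j : ℝ) + 1) ≤ 1 / K + Real.log ((i : ℝ) + 1) := by
    have : K * Real.log ((j : ℝ) + 1) ≤ K * (1 / K + Real.log ((i : ℝ) + 1)) := by
      rw [mul_add, mul_one_div_cancel hK'.ne']; linarith
    exact le_of_mul_le_mul_left this hK'
  calc (j : ℝ) + 1 = Real.exp (Real.log ((j : ℝ) + 1)) := (Real.exp_log (by positivity)).symm
    _ ≤ Real.exp (1 / K + Real.log ((i : ℝ) + 1)) := Real.exp_le_exp.mpr h4
    _ = _ := by rw [Real.exp_add, Real.exp_log (by positivity)]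

theorem sum_range_sum_Ico_blockStart {E : Type*} [AddCommMonoid E] (hp : SlowDecay p δ)
    (hK : 0 < K) (f : ℕ → E) (Q : ℕ) :
    ∑ q ∈ Finset.range Q, ∑ i ∈ Finset.Ico (blockStart K p q) (blockStart K p (q + 1)), f i
      = ∑ i ∈ Finset.range (blockStart K p Q), f i := by
  induction Q with
  | zero => simp [blockStart_zero]
  | succ Q ih =>
    rw [Finset.sum_range_succ, ih, Finset.sum_range_add_sum_Ico _
      (hp.blockStart_mono hK (Nat.le_succ Q))]

/-- The expected number of selected integers of an initial segment of a block is a small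
proportion of the expected number of all integers selected before. -/
theorem SlowDecay.expCount_sub_le (hp : SlowDecay p δ) (hK : 0 < K) {s M : ℕ} (hsM : s ≤ M)
    (h : blockKey K p s = blockKey K p M) :
    expCount p M - expCount p s ≤ (Real.exp (1 / K) - 1) * expCount p M := by
  have hexp : 0 ≤ Real.exp (1 / (K : ℝ)) - 1 := by
    have : (0 : ℝ) ≤ 1 / K := by positivity
    linarith [Real.add_one_le_exp (1 / (K : ℝ))]
  have hnn : ∀ M, 0 ≤ expCount p M := fun M => Finset.sum_nonneg fun i _ => (hp.pos i).le
  rcases hsM.eq_or_lt with rfl | hlt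
  · rw [sub_self]; exact mul_nonneg hexp (hnn _)
  have h1 : expCount p M - expCount p s ≤ (M - s : ℕ) * p s := by
    rw [expCount, expCount, ← Finset.sum_Ico_eq_sub _ hsM, ← Nat.card_Ico, ← nsmul_eq_mul]
    exact Finset.sum_le_card_nsmul _ _ _ fun i hi => hp.anti (Finset.mem_Ico.mp hi).1
  have h2 := hp.succ_le_of_blockKey_eq hK hsM h
  have h3 : ((M - s : ℕ) : ℝ) ≤ (Real.exp (1 / K) - 1) * (s + 1) := by
    rw [Nat.cast_sub hsM]; linarith
  -- Monotonicity of `p` bounds the first `s + 1` terms from below; `s < M` is what puts them all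
  -- below `M`.
  have h4 : ((s : ℝ) + 1) * p s ≤ expCount p M := by
    refine le_trans ?_ (expCount_mono (fun i => (hp.pos i).le) (show s + 1 ≤ M from hlt))
    rw [expCount, Finset.sum_range_succ]
    have := mul_le_expCount hp.anti s
    rw [expCount] at this
    linarith
  calc expCount p M - expCount p s ≤ (M - s : ℕ) * p s := h1
    _ ≤ ((Real.exp (1 / K) - 1) * (s + 1)) * p s := by gcongr; exact (hp.pos s).le
    _ = (Real.exp (1 / K) - 1) * ((s + 1) * p s) := by ring
    _ ≤ _ := by gcongr

/-- The total weight of the blocks before `M` is comparable with the expected number of selected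
integers below `M`. -/
theorem SlowDecay.eventually_sum_blockWeight_le (hp : SlowDecay p δ) (hδ : 0 < δ) (hK : 0 < K) :
    ∀ᶠ M : ℕ in atTop, ∑ q ∈ Finset.range (blockKey K p M),
      blockWeight p δ ((q : ℝ) + 1) (blockStart K p q) (blockStart K p (q + 1))
      ≤ 2 * expCount p M := by
  filter_upwards [hp.eventually_le_expCount ((K + 1) ^ (3 + δ)), hp.eventually_neg_log_le hδ]
    with M h1 h2
  set Q := blockKey K p M with hQ
  have hlog : (0 : ℝ) ≤ Real.log ((M : ℝ) + 1) :=
    Real.log_nonneg (by linarith [(Nat.cast_nonneg M : (0 : ℝ) ≤ M)])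
  have hQle : (Q : ℝ) ≤ (K + 1) * Real.log ((M : ℝ) + 1) := by
    rw [hQ, blockKey]
    push_cast
    have e1 : (⌊K * Real.log ((M : ℝ) + 1)⌋₊ : ℝ) ≤ K * Real.log ((M : ℝ) + 1) :=
      Nat.floor_le (by positivity)
    have e2 : (⌊-Real.log (p M)⌋₊ : ℝ) ≤ -Real.log (p M) :=
      Nat.floor_le (neg_nonneg.mpr (Real.log_nonpos (hp.pos M).le (hp.le_one M)))
    linarith
  have hmono := hp.blockStart_mono hK
  have hsM : blockStart K p Q ≤ M := (hp.blockStart_le hK M).1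
  have hH : ∑ q ∈ Finset.range Q, ((blockStart K p (q + 1) - blockStart K p q : ℕ) : ℝ) ≤ M + 1 := by
    have : ∑ q ∈ Finset.range Q, (blockStart K p (q + 1) - blockStart K p q) = blockStart K p Q := by
      rw [Finset.sum_range_tsub hmono, blockStart_zero, Nat.sub_zero]
    rw [← Nat.cast_sum, this]
    have : (blockStart K p Q : ℝ) ≤ M := by exact_mod_cast hsM
    linarith
  -- Cauchy–Schwarz over the `Q` blocks. The factor `√Q` raises the exponent `5 / 2 + δ` to `3 + δ`,
  -- the power of the logarithm in the decay hypothesis.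
  have hsqrt : ∑ q ∈ Finset.range Q, √((blockStart K p (q + 1) - blockStart K p q : ℕ) : ℝ)
      ≤ √Q * √((M : ℝ) + 1) := by
    rw [← Real.sqrt_mul (Nat.cast_nonneg Q)]
    refine Real.le_sqrt_of_sq_le ?_
    refine (sq_sum_le_card_mul_sum_sq).trans ?_
    rw [Finset.card_range]
    refine mul_le_mul_of_nonneg_left ?_ (Nat.cast_nonneg Q)
    refine le_trans (le_of_eq ?_) hH
    exact Finset.sum_congr rfl fun q _ => Real.sq_sqrt (Nat.cast_nonneg _)
  have hW := sum_range_sum_Ico_blockStart hp hK p Q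
  have hrow : ∀ q ∈ Finset.range Q,
      blockWeight p δ ((q : ℝ) + 1) (blockStart K p q) (blockStart K p (q + 1))
      ≤ ∑ i ∈ Finset.Ico (blockStart K p q) (blockStart K p (q + 1)), p i
        + √((blockStart K p (q + 1) - blockStart K p q : ℕ) : ℝ) * (Q : ℝ) ^ (5 / 2 + δ) := by
    intro q hq
    rw [blockWeight]
    gcongr
    rw [Finset.mem_range] at hq
    exact_mod_cast hq
  have hQpow : √(Q : ℝ) * (Q : ℝ) ^ (5 / 2 + δ) = (Q : ℝ) ^ (3 + δ) := by
    rw [Real.sqrt_eq_rpow, ← Real.rpow_add_of_nonneg (Nat.cast_nonneg Q) (by norm_num)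
      (by positivity)]
    congr 1; ring
  calc _ ≤ ∑ q ∈ Finset.range Q,
        (∑ i ∈ Finset.Ico (blockStart K p q) (blockStart K p (q + 1)), p i
        + √((blockStart K p (q + 1) - blockStart K p q : ℕ) : ℝ) * (Q : ℝ) ^ (5 / 2 + δ)) :=
        Finset.sum_le_sum hrow
    _ = expCount p (blockStart K p Q) +
        (∑ q ∈ Finset.range Q, √((blockStart K p (q + 1) - blockStart K p q : ℕ) : ℝ)) *
          (Q : ℝ) ^ (5 / 2 + δ) := by
        rw [Finset.sum_add_distrib, hW, Finset.sum_mul, expCount]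
    _ ≤ expCount p M + (√Q * √((M : ℝ) + 1)) * (Q : ℝ) ^ (5 / 2 + δ) := by
        gcongr
        exact expCount_mono (fun i => (hp.pos i).le) hsM
    _ = expCount p M + √((M : ℝ) + 1) * (Q : ℝ) ^ (3 + δ) := by rw [← hQpow]; ring
    _ ≤ expCount p M + √((M : ℝ) + 1) * ((K + 1) * Real.log ((M : ℝ) + 1)) ^ (3 + δ) := by
        gcongr
    _ = expCount p M + (K + 1) ^ (3 + δ) *
        (√((M : ℝ) + 1) * Real.log ((M : ℝ) + 1) ^ (3 + δ)) := by
        rw [Real.mul_rpow (by positivity) hlog]; ring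
    _ ≤ 2 * expCount p M := by linarith

end Blocks

/-! ### Typical selections -/

/-- The pathwise properties of a random selection that are used below. -/
structure TypicalSelection (p : ℕ → ℝ) (y : ℕ → ℕ) : Prop where
  zero_or_one : ∀ i, y i = 0 ∨ y i = 1
  blocks : ∀ K : ℕ, 0 < K → ∀ᶠ q : ℕ in atTop, blockStart K p q < blockStart K p (q + 1) →
    GoodBlock p (blockStart K p q) (blockStart K p (q + 1)) (p (blockStart K p q))
      (10 * ((q : ℝ) + 1)) y
  count : Tendsto (fun M => (selCount y M : ℝ) / expCount p M) atTop (𝓝 1)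

theorem tsum_ofReal_ne_top_of_le {f g : ℕ → ℝ} (hg : Summable g) (h : ∀ᶠ n in atTop, f n ≤ g n)
    (hg0 : ∀ n, 0 ≤ g n) : ∃ n₀, ∑' n, ENNReal.ofReal (f (n + n₀)) ≠ ⊤ := by
  obtain ⟨n₀, hn₀⟩ := eventually_atTop.mp h
  refine ⟨n₀, ne_top_of_le_ne_top ?_ (ENNReal.tsum_le_tsum fun n =>
    ENNReal.ofReal_le_ofReal (hn₀ (n + n₀) (by omega)))⟩
  rw [← ENNReal.ofReal_tsum_of_nonneg (fun n => hg0 _) ((summable_nat_add_iff n₀).mpr hg)]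
  exact ENNReal.ofReal_ne_top

/-- Borel–Cantelli, with a summable majorant required only eventually. -/
theorem ae_eventually_not_of_measure_le {Ω : Type*} [MeasurableSpace Ω] {P : Measure Ω}
    {B : ℕ → Ω → Prop} {f g : ℕ → ℝ} (hB : ∀ n, P {ω | B n ω} ≤ ENNReal.ofReal (f n))
    (hg : Summable g) (h : ∀ᶠ n in atTop, f n ≤ g n) (hg0 : ∀ n, 0 ≤ g n) :
    ∀ᵐ ω ∂P, ∀ᶠ n in atTop, ¬ B n ω := by
  obtain ⟨n₀, hn₀⟩ := tsum_ofReal_ne_top_of_le hg h hg0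
  have := ae_eventually_notMem (μ := P) (s := fun n => {ω | B (n + n₀) ω})
    (ne_top_of_le_ne_top hn₀ (ENNReal.tsum_le_tsum fun n => hB (n + n₀)))
  filter_upwards [this] with ω hω
  rw [← map_add_atTop_eq_nat n₀, eventually_map]
  exact hω

namespace IsSelector

variable {Ω : Type*} [MeasurableSpace Ω] {P : Measure Ω} [IsProbabilityMeasure P]
  {Y : ℕ → Ω → ℕ} {p : ℕ → ℝ} {δ : ℝ}

/-- The union bound costs at most a constant times `exp (3 * (q + 1))`, against the tail `exp (-10 *
(q + 1))`; this is the purpose of `Λ = 10 * (q + 1)`. -/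
theorem ae_eventually_goodBlock (hY : IsSelector P Y p) (hp : SlowDecay p δ) {K : ℕ} (hK : 0 < K) :
    ∀ᵐ ω ∂P, ∀ᶠ q : ℕ in atTop, blockStart K p q < blockStart K p (q + 1) →
    GoodBlock p (blockStart K p q) (blockStart K p (q + 1)) (p (blockStart K p q))
      (10 * ((q : ℝ) + 1)) (fun i => Y i ω) := by
  have h := ae_eventually_not_of_measure_le (P := P)
    (B := fun q ω => ¬ GoodBlock p (blockStart K p q) (blockStart K p (q + 1)) (p (blockStart K p q))
      (10 * ((q : ℝ) + 1)) (fun i => Y i ω))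
    (f := fun q => 12 * (blockStart K p (q + 1) + 1) ^ 3 * Real.exp (-(10 * ((q : ℝ) + 1))))
    (g := fun q => 96 * Real.exp (-(q : ℝ))) (fun q => ?_) ?_ ?_ ?_
  · filter_upwards [h] with ω hω
    filter_upwards [hω] with q hq _
    exact not_not.mp hq
  · exact hY.measure_not_goodBlock_le (hp.blockStart_mono hK (Nat.le_succ q)) (hp.pos _).le
      (fun i hi _ => hp.anti hi) (by positivity)
  · exact Real.summable_exp_neg_nat.mul_left 96
  · refine Eventually.of_forall fun q => ?_
    have h1 := hp.blockStart_succ_le_exp hK q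
    have h2 : (1 : ℝ) ≤ Real.exp (q + 1) := Real.one_le_exp (by positivity)
    calc 12 * ((blockStart K p (q + 1) : ℝ) + 1) ^ 3 * Real.exp (-(10 * ((q : ℝ) + 1)))
        ≤ 12 * (2 * Real.exp (q + 1)) ^ 3 * Real.exp (-(10 * ((q : ℝ) + 1))) := by
          gcongr; linarith
      _ = 96 * Real.exp (3 * ((q : ℝ) + 1) - 10 * ((q : ℝ) + 1)) := by
          rw [mul_pow, ← Real.exp_nat_mul, Real.exp_sub, Real.exp_neg]
          push_cast
          rw [div_eq_mul_inv]; ring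
      _ ≤ 96 * Real.exp (-(q : ℝ)) := by
          gcongr
          linarith [(Nat.cast_nonneg q : (0 : ℝ) ≤ q)]
  · intro q; positivity

/-- The exponential inequality with constant coefficients `lam` and `-lam`, one for each sign of the
deviation. -/
theorem measure_abs_selCount_sub_ge (hY : IsSelector P Y p) {lam : ℝ} (hl0 : 0 < lam)
    (hl1 : lam ≤ 1) (M : ℕ) :
    P {ω | 2 * lam * expCount p M ≤ |(selCount (fun i => Y i ω) M : ℝ) - expCount p M|}
      ≤ ENNReal.ofReal (2 * Real.exp (-(lam ^ 2 * expCount p M))) := by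
  have h := hY.measure_exists_predictable_sum_ge ({1, -1} : Finset ℝ)
    (c := fun σ _ _ => if σ = 1 then lam else -lam) (fun _ _ _ _ _ => rfl)
    (fun σ _ _ _ => by split_ifs <;> simp [abs_of_pos hl0, hl1]) M (lam ^ 2 * expCount p M)
  refine (measure_mono ?_).trans (h.trans ?_)
  · intro ω hω
    have e : ∀ s : ℝ, ∑ i ∈ Finset.range M, (s * ((Y i ω : ℝ) - p i) - s ^ 2 * p i)
        = s * ((selCount (fun i => Y i ω) M : ℝ) - expCount p M) - s ^ 2 * expCount p M := by
      intro s
      rw [Finset.sum_sub_distrib, ← Finset.mul_sum, ← Finset.mul_sum, Finset.sum_sub_distrib,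
        selCount, expCount]
      push_cast; rfl
    simp only [Set.mem_ofPred_eq] at hω ⊢
    rcases le_abs.mp hω with h | h
    · refine ⟨1, by simp, ?_⟩
      simp only [if_true]
      rw [e]
      nlinarith
    · refine ⟨-1, by simp, ?_⟩
      rw [if_neg (by norm_num), e]
      nlinarith
  · rw [ENNReal.ofReal_mul (by norm_num)]
    gcongr
    rw [Finset.card_pair (by norm_num)]
    simp

/-- `expCount p M` eventually exceeds any multiple of `log (M + 1)`, so the deviation probabilities
are at most `2 / (M + 1) ^ 2` and no passage to a subsequence is needed. -/
theorem ae_tendsto_selCount_div (hY : IsSelector P Y p) (hp : SlowDecay p δ) (hδ : 0 < δ) :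
    ∀ᵐ ω ∂P, Tendsto (fun M => (selCount (fun i => Y i ω) M : ℝ) / expCount p M) atTop (𝓝 1) := by
  have hone : ∀ k : ℕ, ∀ᵐ ω ∂P, ∀ᶠ M in atTop,
      ¬ (2 * (1 / ((k : ℝ) + 1)) * expCount p M
        ≤ |(selCount (fun i => Y i ω) M : ℝ) - expCount p M|) := by
    intro k
    set lam : ℝ := 1 / ((k : ℝ) + 1)
    have hl0 : 0 < lam := by positivity
    have hl1 : lam ≤ 1 := by
      rw [div_le_one (by positivity)]; linarith [(Nat.cast_nonneg k : (0 : ℝ) ≤ k)]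
    refine ae_eventually_not_of_measure_le (fun M => hY.measure_abs_selCount_sub_ge hl0 hl1 M)
      (g := fun M => 2 * (1 / ((M : ℝ) + 1) ^ 2)) ?_ ?_ (fun M => by positivity)
    · refine Summable.mul_left 2 ?_
      have := (summable_nat_add_iff 1).mpr (Real.summable_one_div_nat_pow.mpr one_lt_two)
      simpa using this
    · filter_upwards [hp.eventually_le_expCount (2 / lam ^ 2),
        tendsto_log_succ.eventually_ge_atTop 1] with M h1 h2
      have hs : (1 : ℝ) ≤ √((M : ℝ) + 1) :=
        Real.one_le_sqrt.mpr (by linarith [(Nat.cast_nonneg M : (0 : ℝ) ≤ M)])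
      have h3 : Real.log ((M : ℝ) + 1) ≤ √((M : ℝ) + 1) * Real.log ((M : ℝ) + 1) ^ (3 + δ) := by
        calc Real.log ((M : ℝ) + 1) = 1 * Real.log ((M : ℝ) + 1) ^ (1 : ℝ) := by
              rw [one_mul, Real.rpow_one]
          _ ≤ _ := by
              gcongr
              linarith
      have h4 : 2 * Real.log ((M : ℝ) + 1) ≤ lam ^ 2 * expCount p M := by
        calc 2 * Real.log ((M : ℝ) + 1) = lam ^ 2 * (2 / lam ^ 2 * Real.log ((M : ℝ) + 1)) := by
              field_simp
          _ ≤ lam ^ 2 * (2 / lam ^ 2 * (√((M : ℝ) + 1) * Real.log ((M : ℝ) + 1) ^ (3 + δ))) := by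
              gcongr
          _ ≤ _ := by gcongr
      have h5 : Real.exp (-(2 * Real.log ((M : ℝ) + 1))) = 1 / ((M : ℝ) + 1) ^ 2 := by
        rw [Real.exp_neg, mul_comm, Real.exp_mul, Real.exp_log (by positivity), one_div]
        norm_num
      rw [← h5]
      gcongr
  filter_upwards [ae_all_iff.mpr hone] with ω hω
  rw [Metric.tendsto_nhds]
  intro ε hε
  obtain ⟨k, hk⟩ := exists_nat_one_div_lt (half_pos hε)
  filter_upwards [hω k, (hp.tendsto_expCount hδ).eventually_gt_atTop 0] with M h1 h2
  rw [Real.dist_eq, div_sub_one h2.ne', abs_div, abs_of_pos h2, div_lt_iff₀ h2]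
  refine (not_le.mp h1).trans_le ?_
  gcongr
  linarith

theorem ae_typicalSelection (hY : IsSelector P Y p) (hp : SlowDecay p δ) (hδ : 0 < δ) :
    ∀ᵐ ω ∂P, TypicalSelection p (fun i => Y i ω) := by
  have h : ∀ᵐ ω ∂P, ∀ K : ℕ, 0 < K → ∀ᶠ q : ℕ in atTop,
      blockStart K p q < blockStart K p (q + 1) →
      GoodBlock p (blockStart K p q) (blockStart K p (q + 1)) (p (blockStart K p q))
        (10 * ((q : ℝ) + 1)) (fun i => Y i ω) := by
    rw [ae_all_iff]
    intro K
    by_cases hK : 0 < K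
    · filter_upwards [hY.ae_eventually_goodBlock hp hK] with ω hω _ using hω
    · exact ae_of_all _ fun ω h => absurd h hK
  filter_upwards [h, hY.ae_tendsto_selCount_div hp hδ] with ω h1 h2
  exact ⟨fun i => hY.zero_or_one i ω, h1, h2⟩

end IsSelector

/-! ### Almost everywhere convergence of the centred averages -/

/-- By monotone convergence the series of the functions has finite integral, so it converges almost
everywhere and its terms tend to zero. -/
theorem ae_tendsto_zero_of_summable_integral {X : Type*} [MeasurableSpace X] {μ : Measure X}
    {f : ℕ → X → ℝ} (hf : ∀ n, Measurable (f n)) (hi : ∀ n, Integrable (f n) μ)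
    (hf0 : ∀ n x, 0 ≤ f n x)
    {g : ℕ → ℝ} (hg : Summable g) (hg0 : ∀ n, 0 ≤ g n)
    (h : ∀ᶠ n in atTop, ∫ x, f n x ∂μ ≤ g n) :
    ∀ᵐ x ∂μ, Tendsto (fun n => f n x) atTop (𝓝 0) := by
  obtain ⟨n₀, hn₀⟩ := tsum_ofReal_ne_top_of_le hg h hg0
  have hlin : ∫⁻ x, ∑' n, ENNReal.ofReal (f (n + n₀) x) ∂μ ≠ ⊤ := by
    rw [lintegral_tsum fun n => (hf _).ennreal_ofReal.aemeasurable]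
    simp_rw [← ofReal_integral_eq_lintegral_ofReal (hi _) (ae_of_all _ (hf0 _))]
    exact hn₀
  filter_upwards [ae_lt_top (Measurable.tsum fun n => (hf _).ennreal_ofReal) hlin] with x hx
  have h1 := ENNReal.tendsto_atTop_zero_of_tsum_ne_top hx.ne
  have h2 := (ENNReal.tendsto_toReal ENNReal.zero_ne_top).comp h1
  rw [← tendsto_add_atTop_iff_nat n₀]
  simpa [Function.comp_def, ENNReal.toReal_ofReal (hf0 _ _)] using h2

theorem sum_norm_centredTerm_Ico_le {𝕜 : Type*} [RCLike 𝕜] {X : Type*} {T : X → X} {F₁ F₂ : X → 𝕜}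
    (hb₁ : ∀ x, ‖F₁ x‖ ≤ 1) (hb₂ : ∀ x, ‖F₂ x‖ ≤ 1) {y : ℕ → ℕ} {p : ℕ → ℝ} (hp0 : ∀ i, 0 ≤ p i)
    {s M : ℕ} (h : s ≤ M) (x : X) :
    ‖∑ i ∈ Finset.Ico s M, centredTerm y p T F₁ F₂ i x‖
      ≤ ((selCount y M : ℝ) - selCount y s) + (expCount p M - expCount p s) := by
  calc _ ≤ ∑ i ∈ Finset.Ico s M, ((y i : ℝ) + p i) := by
        refine (norm_sum_le _ _).trans (Finset.sum_le_sum fun i _ => ?_)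
        refine (norm_centredTerm_le hb₁ hb₂ i x).trans ?_
        have h0 := hp0 i
        have h1 : (0 : ℝ) ≤ y i := Nat.cast_nonneg _
        exact abs_le.mpr ⟨by linarith, by linarith⟩
    _ = _ := by
        rw [Finset.sum_add_distrib, Finset.sum_Ico_eq_sub _ h, Finset.sum_Ico_eq_sub _ h,
          selCount, selCount, expCount, expCount]
        push_cast; rfl

namespace TypicalSelection

variable {X : Type*} [MeasurableSpace X] {μ : Measure X} [IsProbabilityMeasure μ] {T : X → X}
  {y : ℕ → ℕ} {p : ℕ → ℝ} {δ : ℝ}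

/-- Summable normalised mean squares make each block sum negligible against its weight, almost
everywhere. As the weights have divergent sum, the comparison passes to partial sums. Empty blocks,
which occur when the key skips a value, contribute zero. -/
theorem ae_isLittleO_block (hy : TypicalSelection p y) (hp : SlowDecay p δ) (hδ : 0 < δ)
    {K : ℕ} (hK : 0 < K) (hT : MeasurePreserving T μ μ) {F₁ F₂ : X → ℂ}
    (h₁ : Measurable F₁) (h₂ : Measurable F₂) (hb₁ : ∀ x, ‖F₁ x‖ ≤ 1) (hb₂ : ∀ x, ‖F₂ x‖ ≤ 1) :
    ∀ᵐ x ∂μ, (fun Q => ∑ i ∈ Finset.range (blockStart K p Q), centredTerm y p T F₁ F₂ i x)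
      =o[atTop] fun Q => ∑ q ∈ Finset.range Q,
        blockWeight p δ ((q : ℝ) + 1) (blockStart K p q) (blockStart K p (q + 1)) := by
  set β := blockStart K p
  set w : ℕ → ℝ := fun q => blockWeight p δ ((q : ℝ) + 1) (β q) (β (q + 1)) with hw
  set S : ℕ → X → ℂ := fun q x => ∑ i ∈ Finset.Ico (β q) (β (q + 1)), centredTerm y p T F₁ F₂ i x
  have hp0 : ∀ i, 0 ≤ p i := fun i => (hp.pos i).le
  have hβ : Monotone β := hp.blockStart_mono hK
  have hwp : ∀ q, ∑ i ∈ Finset.Ico (β q) (β (q + 1)), p i ≤ w q := fun q =>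
    le_add_of_nonneg_right (by positivity)
  have hw0 : ∀ q, 0 ≤ w q := fun q => (Finset.sum_nonneg fun i _ => hp0 i).trans (hwp q)
  have hwpos : ∀ q, β q < β (q + 1) → 0 < w q := fun q hq =>
    (Finset.sum_pos (fun i _ => hp.pos i) (Finset.nonempty_Ico.mpr hq)).trans_le (hwp q)
  have mS : ∀ q, Measurable (S q) := fun q =>
    Finset.measurable_sum _ fun i _ => measurable_centredTerm hT.measurable h₁ h₂ i
  have hconv : ∀ᵐ x ∂μ, Tendsto (fun q => ‖S q x‖ ^ 2 / w q ^ 2) atTop (𝓝 0) := by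
    refine ae_tendsto_zero_of_summable_integral (f := fun q x => ‖S q x‖ ^ 2 / w q ^ 2)
      (g := fun q : ℕ => 20000 * ((q : ℝ) + 1) ^ (-(1 + δ / 2)))
      (fun q => ((mS q).norm.pow_const 2).div_const _) (fun q => ?_) (fun q x => by positivity)
      (Summable.mul_left _ ?_) (fun q => by positivity) ?_
    · refine integrable_of_norm_le (((mS q).norm.pow_const 2).div_const _).aestronglyMeasurable
        ((((selCount y (β (q + 1)) : ℝ) - selCount y (β q)) +
          (expCount p (β (q + 1)) - expCount p (β q))) ^ 2 / w q ^ 2) fun x => ?_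
      rw [Real.norm_of_nonneg (by positivity)]
      gcongr
      exact sum_norm_centredTerm_Ico_le hb₁ hb₂ hp0 (hβ (Nat.le_succ q)) x
    · have := (summable_nat_add_iff 1).mpr
        (Real.summable_nat_rpow.mpr (show -(1 + δ / 2) < -1 by linarith))
      simpa using this
    · filter_upwards [hy.blocks K hK] with q hq
      rw [integral_div]
      rcases (hβ (Nat.le_succ q)).eq_or_lt with h | h
      · have : ∀ x, S q x = 0 := fun x => by simp only [S, h, Nat.succ_eq_add_one, Finset.Ico_self,
          Finset.sum_empty]
        simp only [this, norm_zero, ne_eq, OfNat.ofNat_ne_zero, not_false_eq_true, zero_pow,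
          integral_zero, zero_div]
        positivity
      · rw [div_le_iff₀ (by have := hwpos q h; positivity)]
        exact integral_norm_sq_goodBlock_le hT h₁ h₂ hb₁ hb₂ hy.zero_or_one hp0 hp.le_one
          (by linarith [(Nat.cast_nonneg q : (0 : ℝ) ≤ q)]) hδ h (hp.pos _) (hp.le_one _)
          (fun i hi _ => hp.anti hi)
          (fun i hi hi2 => hp.div_three_le hi
            ((hp.blockKey_eq hK le_rfl h).trans (hp.blockKey_eq hK hi hi2).symm)) (hq h)
  have hsum : Tendsto (fun Q => ∑ q ∈ Finset.range Q, w q) atTop atTop := by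
    refine tendsto_atTop_mono (fun Q => ?_)
      ((hp.tendsto_expCount hδ).comp (hp.tendsto_blockStart hK))
    rw [Function.comp, expCount, ← sum_range_sum_Ico_blockStart hp hK]
    exact Finset.sum_le_sum fun q _ => hwp q
  filter_upwards [hconv] with x hx
  have hlo : (fun q => S q x) =o[atTop] w := by
    have h1 : Tendsto (fun q => ‖S q x‖ / w q) atTop (𝓝 0) := by
      have := (Real.continuous_sqrt.tendsto 0).comp hx
      rw [Real.sqrt_zero] at this
      refine this.congr fun q => ?_
      rw [Function.comp, ← div_pow, Real.sqrt_sq (div_nonneg (norm_nonneg _) (hw0 q))]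
    rw [← Asymptotics.isLittleO_norm_left]
    refine (Asymptotics.isLittleO_iff_tendsto fun q hq => ?_).mpr h1
    rcases (hβ (Nat.le_succ q)).eq_or_lt with h | h
    · simp only [S, h, Nat.succ_eq_add_one, Finset.Ico_self, Finset.sum_empty, norm_zero]
    · exact absurd hq (hwpos q h).ne'
  have := hlo.sum_range hw0 hsum
  simpa only [S, sum_range_sum_Ico_blockStart hp hK, β] using this

/-- For a typical selection, the centred averages converge to zero almost everywhere in every
measure-preserving system. -/
theorem ae_tendsto_centred (hy : TypicalSelection p y) (hp : SlowDecay p δ) (hδ : 0 < δ)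
    (hT : MeasurePreserving T μ μ) {F₁ F₂ : X → ℂ}
    (h₁ : Measurable F₁) (h₂ : Measurable F₂) (hb₁ : ∀ x, ‖F₁ x‖ ≤ 1) (hb₂ : ∀ x, ‖F₂ x‖ ≤ 1) :
    ∀ᵐ x ∂μ, Tendsto (fun M => ‖∑ i ∈ Finset.range M, centredTerm y p T F₁ F₂ i x‖ / expCount p M)
      atTop (𝓝 0) := by
  have hall : ∀ᵐ x ∂μ, ∀ k : ℕ,
      (fun Q => ∑ i ∈ Finset.range (blockStart (k + 1) p Q), centredTerm y p T F₁ F₂ i x)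
      =o[atTop] fun Q => ∑ q ∈ Finset.range Q,
        blockWeight p δ ((q : ℝ) + 1) (blockStart (k + 1) p q) (blockStart (k + 1) p (q + 1)) :=
    ae_all_iff.mpr fun k => hy.ae_isLittleO_block hp hδ (Nat.succ_pos k) hT h₁ h₂ hb₁ hb₂
  have hp0 : ∀ i, 0 ≤ p i := fun i => (hp.pos i).le
  filter_upwards [hall] with x hx
  rw [Metric.tendsto_nhds]
  intro ε hε
  have hexp : Tendsto (fun k : ℕ => Real.exp (1 / ((k + 1 : ℕ) : ℝ)) - 1) atTop (𝓝 0) := by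
    have h1 : Tendsto (fun k : ℕ => 1 / ((k + 1 : ℕ) : ℝ)) atTop (𝓝 0) := by
      simpa using tendsto_one_div_add_atTop_nhds_zero_nat (𝕜 := ℝ)
    have h2 := ((Real.continuous_exp.tendsto 0).comp h1).sub_const 1
    simpa using h2
  -- `K` is chosen so fine that an incomplete block carries at most a proportion `ε / 8` of the
  -- expected count.
  obtain ⟨k, hk⟩ := (hexp.eventually_lt_const (show (0 : ℝ) < ε / 8 by positivity)).exists
  set K := k + 1
  have hK : 0 < K := Nat.succ_pos k
  have hkey := tendsto_blockKey (p := p) hK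
  have hs : Tendsto (fun M => blockStart K p (blockKey K p M)) atTop atTop :=
    (hp.tendsto_blockStart hK).comp hkey
  have hdev : ∀ᶠ M in atTop, |(selCount y M : ℝ) - expCount p M| ≤ ε / 8 * expCount p M := by
    filter_upwards [(Metric.tendsto_nhds.mp hy.count) (ε / 8) (by positivity),
      (hp.tendsto_expCount hδ).eventually_gt_atTop 0] with M h1 h2
    rw [Real.dist_eq, div_sub_one h2.ne', abs_div, abs_of_pos h2, div_lt_iff₀ h2] at h1
    exact h1.le
  filter_upwards [hkey.eventually ((hx k).def (show (0 : ℝ) < ε / 8 by positivity)),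
    hp.eventually_sum_blockWeight_le hδ hK, hdev, hs.eventually hdev,
    (hp.tendsto_expCount hδ).eventually_gt_atTop 0] with M h1 h2 h3 h4 h5
  set s := blockStart K p (blockKey K p M)
  have hsM : s ≤ M := (hp.blockStart_le hK M).1
  have hsub := hp.expCount_sub_le hK hsM
    (hp.blockKey_eq hK le_rfl (hsM.trans_lt (hp.blockStart_le hK M).2))
  have hW0 : 0 ≤ expCount p s := Finset.sum_nonneg fun i _ => hp0 i
  have hWs : expCount p s ≤ expCount p M := expCount_mono hp0 hsM
  have hmain : ‖∑ i ∈ Finset.range s, centredTerm y p T F₁ F₂ i x‖ ≤ ε / 8 * (2 * expCount p M) := by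
    refine h1.trans ?_
    gcongr
    rw [Real.norm_of_nonneg]
    · exact h2
    · refine Finset.sum_nonneg fun q _ => ?_
      rw [blockWeight]
      have : 0 ≤ ∑ i ∈ Finset.Ico (blockStart K p q) (blockStart K p (q + 1)), p i :=
        Finset.sum_nonneg fun i _ => hp0 i
      positivity
  have hrest := sum_norm_centredTerm_Ico_le (T := T) hb₁ hb₂ hp0 (y := y) hsM x
  rw [Real.dist_eq, sub_zero, abs_of_nonneg (by positivity), div_lt_iff₀ h5,
    ← Finset.sum_range_add_sum_Ico _ hsM]
  refine (norm_add_le _ _).trans_lt ?_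
  -- In units of `expCount p M`: complete blocks give `ε / 4`, the two count deviations `ε / 4`, and
  -- the expected count of the incomplete block, entering twice, `ε / 4`.
  have h3' := (abs_le.mp h3).2
  have h4' := (abs_le.mp h4).1
  have h6 : (Real.exp (1 / (K : ℝ)) - 1) * expCount p M ≤ ε / 8 * expCount p M := by
    gcongr
  have h7 : ε / 8 * expCount p s ≤ ε / 8 * expCount p M := by gcongr
  have h8 : 0 < ε * expCount p M := by positivity
  linarith

end TypicalSelection

/-! ### The maximal ergodic inequality -/

/-- The maximum of the Birkhoff sums of `f` of length at most `n`, and of zero. -/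
def maxBirkhoff {X : Type*} (T : X → X) (f : X → ℝ) : ℕ → X → ℝ
  | 0 => fun _ => 0
  | n + 1 => fun x => max 0 (f x + maxBirkhoff T f n (T x))

section MaximalErgodic

variable {X : Type*} {T : X → X} {f : X → ℝ}

theorem maxBirkhoff_nonneg (n : ℕ) (x : X) : 0 ≤ maxBirkhoff T f n x := by
  cases n with
  | zero => exact le_rfl
  | succ n => exact le_max_left _ _

theorem maxBirkhoff_le_succ (n : ℕ) (x : X) : maxBirkhoff T f n x ≤ maxBirkhoff T f (n + 1) x := by
  induction n generalizing x with
  | zero => exact maxBirkhoff_nonneg 1 x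
  | succ n ih => exact max_le_max le_rfl (add_le_add_right (ih (T x)) _)

theorem birkhoffSum_le_maxBirkhoff (n : ℕ) (x : X) :
    ∑ i ∈ Finset.range n, f (T^[i] x) ≤ maxBirkhoff T f n x := by
  induction n generalizing x with
  | zero => simp [maxBirkhoff]
  | succ n ih =>
    rw [Finset.sum_range_succ']
    simp only [Function.iterate_succ_apply, Function.iterate_zero, id]
    have := ih (T x)
    exact le_trans (by linarith) (le_max_right _ _)

variable [MeasurableSpace X] {μ : Measure X}

theorem measurable_maxBirkhoff (hT : Measurable T) (hf : Measurable f) (n : ℕ) :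
    Measurable (maxBirkhoff T f n) := by
  induction n with
  | zero => exact measurable_const
  | succ n ih => exact measurable_const.max (hf.add (ih.comp hT))

theorem integrable_maxBirkhoff (hT : MeasurePreserving T μ μ) (hf : Integrable f μ) (n : ℕ) :
    Integrable (maxBirkhoff T f n) μ := by
  induction n with
  | zero => exact integrable_zero _ _ _
  | succ n ih =>
    have h : Integrable (fun x => f x + maxBirkhoff T f n (T x)) μ :=
      hf.add (hT.integrable_comp_of_integrable ih)
    exact (integrable_zero X ℝ μ).sup h

/-- The maximal ergodic theorem. -/
theorem setIntegral_maxBirkhoff_pos_nonneg (hT : MeasurePreserving T μ μ) (hf : Integrable f μ)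
    (hfm : Measurable f) (n : ℕ) : 0 ≤ ∫ x in {x | 0 < maxBirkhoff T f n x}, f x ∂μ := by
  set E := {x | 0 < maxBirkhoff T f n x} with hE
  have mM := measurable_maxBirkhoff hT.measurable hfm n
  have iM := integrable_maxBirkhoff hT hf n
  have iMT : Integrable (fun x => maxBirkhoff T f n (T x)) μ := hT.integrable_comp_of_integrable iM
  have mE : MeasurableSet E := mM measurableSet_Ioi
  -- Garsia's argument: where the maximum is positive it equals `f x` plus the shorter maximum at `T
  -- x`, which is at most the full maximum there.
  have h1 : ∀ x ∈ E, maxBirkhoff T f n x - maxBirkhoff T f n (T x) ≤ f x := by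
    intro x hx
    cases n with
    | zero => exact (lt_irrefl (0 : ℝ) hx).elim
    | succ n =>
      have h2 : maxBirkhoff T f (n + 1) x = f x + maxBirkhoff T f n (T x) := by
        have h0 : 0 < max 0 (f x + maxBirkhoff T f n (T x)) := hx
        exact max_eq_right ((lt_max_iff.mp h0).resolve_left (lt_irrefl _)).le
      have h3 := maxBirkhoff_le_succ (T := T) (f := f) n (T x)
      linarith
  have h4 : ∫ x in E, maxBirkhoff T f n x ∂μ = ∫ x, maxBirkhoff T f n x ∂μ := by
    refine setIntegral_eq_integral_of_forall_compl_eq_zero fun x hx => ?_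
    exact le_antisymm (not_lt.mp hx) (maxBirkhoff_nonneg n x)
  have h5 : ∫ x in E, maxBirkhoff T f n (T x) ∂μ ≤ ∫ x, maxBirkhoff T f n (T x) ∂μ :=
    setIntegral_le_integral iMT (ae_of_all _ fun x => maxBirkhoff_nonneg n (T x))
  have h6 : ∫ x, maxBirkhoff T f n (T x) ∂μ = ∫ x, maxBirkhoff T f n x ∂μ := by
    conv_rhs => rw [← hT.map_eq]
    rw [integral_map hT.aemeasurable mM.aestronglyMeasurable]
  calc 0 ≤ ∫ x in E, (maxBirkhoff T f n x - maxBirkhoff T f n (T x)) ∂μ := by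
        rw [integral_sub iM.integrableOn iMT.integrableOn]; linarith
    _ ≤ ∫ x in E, f x ∂μ :=
        setIntegral_mono_on (iM.sub iMT).integrableOn hf.integrableOn mE h1

/-- The weak type maximal inequality for ergodic averages. -/
theorem measure_exists_birkhoffSum_gt_le [IsProbabilityMeasure μ] (hT : MeasurePreserving T μ μ)
    {r : X → ℝ} (hr : Integrable r μ) (hrm : Measurable r) (hr0 : ∀ x, 0 ≤ r x) {ε : ℝ}
    (hε : 0 < ε) :
    μ {x | ∃ N : ℕ, ε * N < ∑ i ∈ Finset.range N, r (T^[i] x)} ≤ ENNReal.ofReal ((∫ x, r x ∂μ) / ε) := by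
  set f : X → ℝ := fun x => r x - ε
  have hf : Integrable f μ := hr.sub (integrable_const _)
  have hfm : Measurable f := hrm.sub_const _
  set E : ℕ → Set X := fun n => {x | 0 < maxBirkhoff T f n x}
  have hEmono : Monotone E := monotone_nat_of_le_succ fun n x hx =>
    lt_of_lt_of_le hx (maxBirkhoff_le_succ n x)
  have hsub : {x | ∃ N : ℕ, ε * N < ∑ i ∈ Finset.range N, r (T^[i] x)} ⊆ ⋃ n, E n := by
    rintro x ⟨N, hN⟩
    refine Set.mem_iUnion.mpr ⟨N, lt_of_lt_of_le ?_ (birkhoffSum_le_maxBirkhoff N x)⟩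
    simp only [f, Finset.sum_sub_distrib, Finset.sum_const, Finset.card_range, nsmul_eq_mul]
    linarith
  refine (measure_mono hsub).trans ?_
  rw [hEmono.measure_iUnion]
  refine iSup_le fun n => ?_
  have h1 := setIntegral_maxBirkhoff_pos_nonneg hT hf hfm n
  have h2 : ∫ x in E n, f x ∂μ = ∫ x in E n, r x ∂μ - ε * μ.real (E n) := by
    simp only [f]
    rw [integral_sub hr.integrableOn (integrable_const _)]
    simp [mul_comm]
  have h3 : ∫ x in E n, r x ∂μ ≤ ∫ x, r x ∂μ := setIntegral_le_integral hr (ae_of_all _ hr0)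
  rw [← ENNReal.ofReal_toReal (measure_ne_top μ (E n))]
  refine ENNReal.ofReal_le_ofReal ?_
  rw [le_div_iff₀ hε]
  change 0 ≤ ∫ x in E n, f x ∂μ at h1
  rw [h2] at h1
  change μ.real (E n) * ε ≤ _
  linarith

/-- A point violating the bound for every `k` lies in an exceptional set of measure at most `(∫ r k)
/ ε` for each `k`, which tends to zero. Countably many values of `ε` suffice. -/
theorem ae_exists_birkhoffSum_le [IsProbabilityMeasure μ] (hT : MeasurePreserving T μ μ)
    {r : ℕ → X → ℝ} (hr : ∀ k, Integrable (r k) μ) (hrm : ∀ k, Measurable (r k))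
    (hr0 : ∀ k x, 0 ≤ r k x) (hlim : Tendsto (fun k => ∫ x, r k x ∂μ) atTop (𝓝 0)) :
    ∀ᵐ x ∂μ, ∀ ε > 0, ∃ k, ∀ N : ℕ, ∑ i ∈ Finset.range N, r k (T^[i] x) ≤ ε * N := by
  have hone : ∀ j : ℕ, ∀ᵐ x ∂μ, ∃ k, ∀ N : ℕ,
      ∑ i ∈ Finset.range N, r k (T^[i] x) ≤ 1 / ((j : ℝ) + 1) * N := by
    intro j
    rw [ae_iff]
    have hj : (0 : ℝ) < 1 / ((j : ℝ) + 1) := by positivity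
    have hle : ∀ k, μ {x | ¬ ∃ k, ∀ N : ℕ,
        ∑ i ∈ Finset.range N, r k (T^[i] x) ≤ 1 / ((j : ℝ) + 1) * N}
        ≤ ENNReal.ofReal ((∫ x, r k x ∂μ) / (1 / ((j : ℝ) + 1))) := fun k => by
      refine le_trans (measure_mono fun x hx => ?_)
        (measure_exists_birkhoffSum_gt_le hT (hr k) (hrm k) (hr0 k) hj)
      simp only [Set.mem_ofPred_eq, not_exists, not_forall, not_le] at hx
      exact hx k
    have hlim2 : Tendsto (fun k => ENNReal.ofReal ((∫ x, r k x ∂μ) / (1 / ((j : ℝ) + 1)))) atTop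
        (𝓝 0) := by
      have := ENNReal.tendsto_ofReal (hlim.div_const (1 / ((j : ℝ) + 1)))
      simpa using this
    exact le_antisymm (ge_of_tendsto' hlim2 hle) (zero_le)
  filter_upwards [ae_all_iff.mpr hone] with x hx ε hε
  obtain ⟨j, hj⟩ := exists_nat_one_div_lt hε
  obtain ⟨k, hk⟩ := hx j
  exact ⟨k, fun N => (hk N).trans (by gcongr)⟩

end MaximalErgodic

/-! ### Weighted averages of sequences with small local fluctuations -/

/-- Abel summation, in the inductive form that the weighted sum dominates the last weight times the
plain sum. It transfers unweighted mean bounds to decreasing weights. -/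
theorem sum_mul_nonneg_of_antitone {w b : ℕ → ℝ} (hw : Antitone w) (hw0 : ∀ i, 0 ≤ w i)
    (hb : ∀ N, 0 ≤ ∑ i ∈ Finset.range N, b i) (M : ℕ) : 0 ≤ ∑ i ∈ Finset.range M, w i * b i := by
  have h : ∀ M, w M * ∑ i ∈ Finset.range M, b i ≤ ∑ i ∈ Finset.range M, w i * b i := by
    intro M
    induction M with
    | zero => simp
    | succ M ih =>
      rw [Finset.sum_range_succ (fun i => w i * b i)]
      calc w (M + 1) * ∑ i ∈ Finset.range (M + 1), b i
          ≤ w M * ∑ i ∈ Finset.range (M + 1), b i := by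
            gcongr
            · exact hb _
            · exact hw (Nat.le_succ M)
        _ = w M * ∑ i ∈ Finset.range M, b i + w M * b M := by
            rw [Finset.sum_range_succ]; ring
        _ ≤ _ := by gcongr
  exact (mul_nonneg (hw0 M) (hb M)).trans (h M)

section Weighted

variable {𝕜 : Type*} [RCLike 𝕜]

/-- Summation by parts for a shift by one, repeated `k` times: shifting `a` costs only boundary
terms and the variation of `c`. -/
theorem norm_sum_mul_sub_shift_le {c a : ℕ → 𝕜} {C : ℝ} (ha : ∀ i, ‖a i‖ ≤ C) (k M : ℕ) :
    ‖∑ m ∈ Finset.range M, c m * (a m - a (m + k))‖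
      ≤ k * (C * (‖c 0‖ + ‖c M‖ + ∑ m ∈ Finset.range M, ‖c (m + 1) - c m‖)) := by
  have hone : ∀ a : ℕ → 𝕜, (∀ i, ‖a i‖ ≤ C) → ‖∑ m ∈ Finset.range M, c m * (a m - a (m + 1))‖
      ≤ C * (‖c 0‖ + ‖c M‖ + ∑ m ∈ Finset.range M, ‖c (m + 1) - c m‖) := by
    intro a ha
    have e : ∑ m ∈ Finset.range M, c m * (a m - a (m + 1))
        = c 0 * a 0 - c M * a M + ∑ m ∈ Finset.range M, (c (m + 1) - c m) * a (m + 1) := by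
      induction M with
      | zero => simp
      | succ M ih => rw [Finset.sum_range_succ, ih, Finset.sum_range_succ]; ring
    have hmul : ∀ (z : 𝕜) i, ‖z * a i‖ ≤ C * ‖z‖ := fun z i => by
      rw [norm_mul, mul_comm]; gcongr; exact ha i
    rw [e]
    calc _ ≤ ‖c 0 * a 0‖ + ‖c M * a M‖ + ∑ m ∈ Finset.range M, ‖(c (m + 1) - c m) * a (m + 1)‖ :=
          (norm_add_le _ _).trans (add_le_add (norm_sub_le _ _) (norm_sum_le _ _))
      _ ≤ C * ‖c 0‖ + C * ‖c M‖ + ∑ m ∈ Finset.range M, C * ‖c (m + 1) - c m‖ := by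
          gcongr <;> apply hmul
      _ = _ := by rw [← Finset.mul_sum]; ring
  induction k with
  | zero => simp
  | succ k ih =>
    have e : ∑ m ∈ Finset.range M, c m * (a m - a (m + (k + 1)))
        = ∑ m ∈ Finset.range M, c m * (a m - a (m + k))
          + ∑ m ∈ Finset.range M, c m * (a (m + k) - a (m + 1 + k)) := by
      rw [← Finset.sum_add_distrib]
      refine Finset.sum_congr rfl fun m _ => ?_
      rw [show m + (k + 1) = m + 1 + k by ring]; ring
    rw [e]
    refine (norm_add_le _ _).trans ?_
    have := hone (fun i => a (i + k)) fun i => ha _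
    push_cast
    linarith

/-- If the moving averages of a bounded sequence `a` are close to `l` in the mean, then averages
of `a` with slowly varying weights converge to `l`. -/
theorem tendsto_weighted_sum_sub {c a : ℕ → 𝕜} {w : ℕ → ℝ} {l : 𝕜} {C : ℝ}
    (ha : ∀ i, ‖a i‖ ≤ C) (hw : Antitone w) (hw0 : ∀ i, 0 ≤ w i) (hc : ∀ i, ‖c i‖ ≤ w i)
    (hW : Tendsto (fun M => ∑ i ∈ Finset.range M, w i) atTop atTop)
    (hV : Tendsto (fun M => (∑ m ∈ Finset.range M, ‖c (m + 1) - c m‖) / ∑ i ∈ Finset.range M, w i)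
      atTop (𝓝 0))
    (hloc : ∀ ε > 0, ∃ k : ℕ, 0 < k ∧ ∀ N : ℕ, ∑ m ∈ Finset.range N,
      ‖(k : 𝕜)⁻¹ * ∑ i ∈ Finset.range k, a (m + i) - l‖ ≤ ε * N) :
    Tendsto (fun M => ‖∑ m ∈ Finset.range M, c m * (a m - l)‖ / ∑ i ∈ Finset.range M, w i)
      atTop (𝓝 0) := by
  rw [Metric.tendsto_nhds]
  intro ε hε
  obtain ⟨k, hk, hloc⟩ := hloc (ε / 2) (half_pos hε)
  have hk' : (0 : ℝ) < k := by exact_mod_cast hk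
  have hkk : (k : 𝕜) ≠ 0 := by exact_mod_cast hk.ne'
  set b : ℕ → 𝕜 := fun m => (k : 𝕜)⁻¹ * ∑ i ∈ Finset.range k, a (m + i)
  have hC : 0 ≤ C := (norm_nonneg _).trans (ha 0)
  -- Replacing `a` by its moving average of the fixed length `k` costs an amount that is negligible
  -- by the variation hypothesis.
  have hfirst : ∀ M, ‖∑ m ∈ Finset.range M, c m * (a m - b m)‖
      ≤ k * (C * (w 0 + w 0 + ∑ m ∈ Finset.range M, ‖c (m + 1) - c m‖)) := by
    intro M
    have e : ∑ m ∈ Finset.range M, c m * (a m - b m)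
        = (k : 𝕜)⁻¹ * ∑ i ∈ Finset.range k, ∑ m ∈ Finset.range M, c m * (a m - a (m + i)) := by
      rw [Finset.sum_comm, Finset.mul_sum]
      refine Finset.sum_congr rfl fun m _ => ?_
      simp only [b]
      rw [← Finset.mul_sum, Finset.sum_sub_distrib, Finset.sum_const, Finset.card_range,
        nsmul_eq_mul]
      field_simp
    rw [e, norm_mul, norm_inv, RCLike.norm_natCast]
    rw [inv_mul_le_iff₀ hk']
    refine (norm_sum_le _ _).trans ?_
    refine (Finset.sum_le_card_nsmul _ _
      (k * (C * (w 0 + w 0 + ∑ m ∈ Finset.range M, ‖c (m + 1) - c m‖))) fun i hi => ?_).trans ?_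
    · refine (norm_sum_mul_sub_shift_le ha i M).trans ?_
      have h1 : (i : ℝ) ≤ k := by exact_mod_cast (Finset.mem_range.mp hi).le
      have h2 := hc 0
      have h3 := (hc M).trans (hw (Nat.zero_le M))
      gcongr
    · rw [Finset.card_range, nsmul_eq_mul]
  -- The mean bound on the moving averages is carried over to the decreasing weights `w` by Abel
  -- summation.
  have hsecond : ∀ M, ‖∑ m ∈ Finset.range M, c m * (b m - l)‖ ≤ ε / 2 * ∑ i ∈ Finset.range M, w i := by
    intro M
    have h := sum_mul_nonneg_of_antitone hw hw0 (b := fun m => ε / 2 - ‖b m - l‖) (fun N => by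
      rw [Finset.sum_sub_distrib, Finset.sum_const, Finset.card_range, nsmul_eq_mul]
      have := hloc N
      linarith) M
    simp only [mul_sub, Finset.sum_sub_distrib, ← Finset.sum_mul] at h
    calc _ ≤ ∑ m ∈ Finset.range M, w m * ‖b m - l‖ := by
          refine (norm_sum_le _ _).trans (Finset.sum_le_sum fun m _ => ?_)
          rw [norm_mul]
          gcongr
          exact hc m
      _ ≤ _ := by linarith
  have hlim : Tendsto (fun M => k * (C * (2 * w 0 / (∑ i ∈ Finset.range M, w i)
      + (∑ m ∈ Finset.range M, ‖c (m + 1) - c m‖) / ∑ i ∈ Finset.range M, w i))) atTop (𝓝 0) := by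
    have h1 := (hW.const_div_atTop (2 * w 0)).add hV
    have h2 := (h1.const_mul C).const_mul (k : ℝ)
    simpa using h2
  filter_upwards [hlim.eventually_lt_const (half_pos hε), hW.eventually_gt_atTop 0] with M h1 h2
  rw [Real.dist_eq, sub_zero, abs_of_nonneg (by positivity), div_lt_iff₀ h2]
  have e : ∑ m ∈ Finset.range M, c m * (a m - l)
      = ∑ m ∈ Finset.range M, c m * (a m - b m) + ∑ m ∈ Finset.range M, c m * (b m - l) := by
    rw [← Finset.sum_add_distrib]
    exact Finset.sum_congr rfl fun m _ => by ring
  rw [e]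
  refine (norm_add_le _ _).trans_lt ?_
  have h3 := mul_lt_mul_of_pos_right h1 h2
  have h4 : k * (C * (2 * w 0 / (∑ i ∈ Finset.range M, w i)
      + (∑ m ∈ Finset.range M, ‖c (m + 1) - c m‖) / ∑ i ∈ Finset.range M, w i))
      * ∑ i ∈ Finset.range M, w i
      = k * (C * (w 0 + w 0 + ∑ m ∈ Finset.range M, ‖c (m + 1) - c m‖)) := by
    field_simp; ring
  rw [h4] at h3
  have h5 := hfirst M
  have h6 := hsecond M
  linarith

end Weighted

/-! ### Ergodic averages and the invariant projection -/

section Invariant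

variable {𝕜 : Type*} [RCLike 𝕜] {X : Type*} [MeasurableSpace X] {μ : Measure X}
  [IsProbabilityMeasure μ] {T : X → X}

omit [IsProbabilityMeasure μ] in
theorem koopman_iterate_toLp (hT : MeasurePreserving T μ μ) {F : X → 𝕜} (hF : MemLp F 2 μ) (n : ℕ) :
    (koopman 𝕜 hT)^[n] (hF.toLp F) = (hF.comp_measurePreserving (hT.iterate n)).toLp (F ∘ T^[n]) := by
  induction n with
  | zero => rfl
  | succ n ih =>
    rw [Function.iterate_succ_apply', ih]
    exact (Lp.toLp_compMeasurePreserving _ hT).trans rfl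

omit [IsProbabilityMeasure μ] in
theorem birkhoffSum_koopman_coeFn (hT : MeasurePreserving T μ μ) {F : X → 𝕜} (hF : MemLp F 2 μ)
    (n : ℕ) : ⇑(birkhoffSum (koopman 𝕜 hT) id n (hF.toLp F)) =ᵐ[μ]
      fun x => ∑ i ∈ Finset.range n, F (T^[i] x) := by
  induction n with
  | zero =>
    simp only [birkhoffSum_zero, Finset.range_zero, Finset.sum_empty]
    exact Lp.coeFn_zero _ _ _
  | succ n ih =>
    rw [birkhoffSum_succ]
    simp only [id, koopman_iterate_toLp hT hF]
    filter_upwards [Lp.coeFn_add (birkhoffSum (koopman 𝕜 hT) id n (hF.toLp F))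
      ((hF.comp_measurePreserving (hT.iterate n)).toLp (F ∘ T^[n])), ih,
      (hF.comp_measurePreserving (hT.iterate n)).coeFn_toLp] with x h1 h2 h3
    rw [Finset.sum_range_succ, h1, Pi.add_apply, h2, h3, Function.comp]

omit [IsProbabilityMeasure μ] in
theorem invariantProj_comp_ae_eq (hT : MeasurePreserving T μ μ) {F : X → 𝕜} (hF : MemLp F 2 μ) :
    ⇑(invariantProj hT hF) ∘ T =ᵐ[μ] invariantProj hT hF := by
  have h : invariantProj hT hF ∈ (koopman 𝕜 hT).eqLocus (1 : Lp 𝕜 2 μ →L[𝕜] Lp 𝕜 2 μ) :=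
    Submodule.starProjection_apply_mem _ _
  have h2 : Lp.compMeasurePreserving T hT (invariantProj hT hF) = invariantProj hT hF := h
  have h3 := Lp.coeFn_compMeasurePreserving (invariantProj hT hF) hT
  rw [h2] at h3
  exact h3.symm

omit [IsProbabilityMeasure μ] in
theorem ae_invariantProj_iterate (hT : MeasurePreserving T μ μ) {F : X → 𝕜} (hF : MemLp F 2 μ) :
    ∀ᵐ x ∂μ, ∀ n, invariantProj hT hF (T^[n] x) = invariantProj hT hF x := by
  rw [ae_all_iff]
  intro n
  induction n with
  | zero => exact ae_of_all _ fun x => rfl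
  | succ n ih =>
    filter_upwards [hT.quasiMeasurePreserving.ae ih, invariantProj_comp_ae_eq hT hF] with x h1 h2
    rw [Function.iterate_succ_apply, h1]
    exact h2

/-- Von Neumann's mean ergodic theorem for the Koopman operator, weakened from L² to L¹ on a
probability space. -/
theorem tendsto_integral_norm_average_sub (hT : MeasurePreserving T μ μ) {F : X → 𝕜}
    (hF : MemLp F 2 μ) :
    Tendsto (fun k : ℕ => ∫ x, ‖(k : 𝕜)⁻¹ * ∑ i ∈ Finset.range k, F (T^[i] x)
      - invariantProj hT hF x‖ ∂μ) atTop (𝓝 0) := by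
  have hnorm : ‖koopman 𝕜 hT‖ ≤ 1 := LinearIsometry.norm_toContinuousLinearMap_le _
  have h1 := (koopman 𝕜 hT).tendsto_birkhoffAverage_orthogonalProjection hnorm (hF.toLp F)
  have h2 : Tendsto (fun k : ℕ => ‖birkhoffAverage 𝕜 (koopman 𝕜 hT) id k (hF.toLp F)
      - invariantProj hT hF‖) atTop (𝓝 0) := tendsto_iff_norm_sub_tendsto_zero.mp h1
  refine squeeze_zero (fun k => integral_nonneg fun x => norm_nonneg _) (fun k => ?_) h2
  set G := birkhoffAverage 𝕜 (koopman 𝕜 hT) id k (hF.toLp F) - invariantProj hT hF with hG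
  have hae : ⇑G =ᵐ[μ] fun x => (k : 𝕜)⁻¹ * ∑ i ∈ Finset.range k, F (T^[i] x)
      - invariantProj hT hF x := by
    filter_upwards [Lp.coeFn_sub (birkhoffAverage 𝕜 (koopman 𝕜 hT) id k (hF.toLp F))
      (invariantProj hT hF), Lp.coeFn_smul ((k : 𝕜)⁻¹)
      (birkhoffSum (koopman 𝕜 hT) id k (hF.toLp F)), birkhoffSum_koopman_coeFn hT hF k]
      with x e1 e2 e3
    rw [hG, e1, Pi.sub_apply]
    change ((k : 𝕜)⁻¹ • birkhoffSum (koopman 𝕜 hT) id k (hF.toLp F) : Lp 𝕜 2 μ) x - _ = _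
    rw [e2, Pi.smul_apply, e3, smul_eq_mul]
  have hae2 : ∫ x, ‖G x‖ ∂μ = ∫ x, ‖(k : 𝕜)⁻¹ * ∑ i ∈ Finset.range k, F (T^[i] x)
      - invariantProj hT hF x‖ ∂μ := integral_congr_ae (hae.fun_comp norm)
  rw [← hae2, integral_norm_eq_lintegral_enorm (Lp.aestronglyMeasurable G),
    Lp.norm_def, ← eLpNorm_one_eq_lintegral_enorm]
  exact ENNReal.toReal_mono (Lp.eLpNorm_ne_top G)
    (eLpNorm_le_eLpNorm_of_exponent_le (by norm_num) (Lp.aestronglyMeasurable G))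

/-- For almost every point, moving averages along the orbit are close in the mean to the value of
the invariant projection. -/
theorem ae_exists_moving_average_le (hT : MeasurePreserving T μ μ) {F : X → 𝕜} (hFm : Measurable F)
    (hF : MemLp F 2 μ) :
    ∀ᵐ x ∂μ, ∀ ε > 0, ∃ k : ℕ, 0 < k ∧ ∀ N : ℕ, ∑ m ∈ Finset.range N,
      ‖(k : 𝕜)⁻¹ * ∑ i ∈ Finset.range k, F (T^[m + i] x) - invariantProj hT hF x‖ ≤ ε * N := by
  set L := invariantProj hT hF with hL
  -- Length `k + 1` excludes the empty average. Along the orbit `r k` still compares with `L x`,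
  -- because `L` is invariant almost everywhere.
  set r : ℕ → X → ℝ := fun k x => ‖((k + 1 : ℕ) : 𝕜)⁻¹ * ∑ i ∈ Finset.range (k + 1), F (T^[i] x) - L x‖
  have hLm : Measurable L := (Lp.stronglyMeasurable L).measurable
  have hLi : Integrable L μ := (Lp.memLp L).integrable (by norm_num)
  have hFi : ∀ i, Integrable (fun x => F (T^[i] x)) μ := fun i =>
    (hT.iterate i).integrable_comp_of_integrable (hF.integrable (by norm_num))
  have hrm : ∀ k, Measurable (r k) := fun k =>
    (((Finset.measurable_sum _ fun i _ => hFm.comp (hT.measurable.iterate i)).const_mul _).sub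
      hLm).norm
  have hri : ∀ k, Integrable (r k) μ := fun k =>
    (((integrable_finsetSum _ fun i _ => hFi i).const_mul _).sub hLi).norm
  have hlim := (tendsto_add_atTop_iff_nat 1).mpr (tendsto_integral_norm_average_sub hT hF)
  filter_upwards [ae_exists_birkhoffSum_le hT hri hrm (fun k x => norm_nonneg _) hlim,
    ae_invariantProj_iterate hT hF] with x h1 h2 ε hε
  obtain ⟨k, hk⟩ := h1 ε hε
  refine ⟨k + 1, Nat.succ_pos k, fun N => (le_of_eq ?_).trans (hk N)⟩
  refine Finset.sum_congr rfl fun m _ => ?_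
  simp only [r, ← Function.iterate_add_apply, hL, h2 m, add_comm m]

end Invariant

/-! ### Extension of the centred averages to arbitrary scalars -/

/-- The embedding of an `RCLike` field into the complex numbers. -/
noncomputable def rclikeToComplex (𝕜 : Type*) [RCLike 𝕜] : 𝕜 →+* ℂ where
  toFun z := ⟨RCLike.re z, RCLike.im z⟩
  map_one' := by apply Complex.ext <;> simp
  map_zero' := by apply Complex.ext <;> simp
  map_mul' z w := by apply Complex.ext <;> simp
  map_add' z w := by apply Complex.ext <;> simp

section Embedding

variable {𝕜 : Type*} [RCLike 𝕜]

theorem norm_rclikeToComplex (z : 𝕜) : ‖rclikeToComplex 𝕜 z‖ = ‖z‖ := by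
  rw [← sq_eq_sq₀ (norm_nonneg _) (norm_nonneg _), Complex.sq_norm, Complex.normSq_apply,
    RCLike.norm_sq_eq_def]
  rfl

theorem rclikeToComplex_ofReal (t : ℝ) : rclikeToComplex 𝕜 (t : 𝕜) = (t : ℂ) := by
  apply Complex.ext <;> simp [rclikeToComplex]

theorem measurable_rclikeToComplex : Measurable (rclikeToComplex 𝕜) :=
  (AddMonoidHomClass.isometry_of_norm (rclikeToComplex 𝕜) norm_rclikeToComplex).continuous.measurable

/-- For a typical selection, the centred averages of bounded functions converge to zero almost
everywhere in every measure-preserving system. -/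
theorem TypicalSelection.ae_tendsto_centred_of_bounded {X : Type*} [MeasurableSpace X]
    {μ : Measure X} [IsProbabilityMeasure μ] {T : X → X} {y : ℕ → ℕ} {p : ℕ → ℝ} {δ : ℝ}
    (hy : TypicalSelection p y) (hp : SlowDecay p δ) (hδ : 0 < δ)
    (hT : MeasurePreserving T μ μ) {F₁ F₂ : X → 𝕜} {C₁ C₂ : ℝ} (hC₁ : 0 < C₁) (hC₂ : 0 < C₂)
    (h₁ : Measurable F₁) (h₂ : Measurable F₂) (hb₁ : ∀ x, ‖F₁ x‖ ≤ C₁) (hb₂ : ∀ x, ‖F₂ x‖ ≤ C₂) :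
    ∀ᵐ x ∂μ, Tendsto (fun M => ‖∑ i ∈ Finset.range M, centredTerm y p T F₁ F₂ i x‖ / expCount p M)
      atTop (𝓝 0) := by
  set G : ℝ → (X → 𝕜) → X → ℂ := fun C F x => ((C⁻¹ : ℝ) : ℂ) * rclikeToComplex 𝕜 (F x)
  have hGm : ∀ C F, Measurable F → Measurable (G C F) := fun C F hF =>
    (measurable_rclikeToComplex.comp hF).const_mul _
  have hGb : ∀ C > 0, ∀ F : X → 𝕜, (∀ x, ‖F x‖ ≤ C) → ∀ x, ‖G C F x‖ ≤ 1 := fun C hC F hF x => by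
    simp only [G]
    rw [norm_mul, Complex.norm_real, norm_rclikeToComplex, Real.norm_of_nonneg (by positivity),
      inv_mul_le_one₀ hC]
    exact hF x
  filter_upwards [hy.ae_tendsto_centred hp hδ hT (hGm C₁ F₁ h₁) (hGm C₂ F₂ h₂)
    (hGb C₁ hC₁ F₁ hb₁) (hGb C₂ hC₂ F₂ hb₂)] with x hx
  have e : ∀ M, ‖∑ i ∈ Finset.range M, centredTerm y p T F₁ F₂ i x‖ / expCount p M
      = C₁ * C₂ *
        (‖∑ i ∈ Finset.range M, centredTerm y p T (G C₁ F₁) (G C₂ F₂) i x‖ / expCount p M) := by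
    intro M
    have : ∑ i ∈ Finset.range M, centredTerm y p T (G C₁ F₁) (G C₂ F₂) i x
        = ((C₁⁻¹ * C₂⁻¹ : ℝ) : ℂ) *
          rclikeToComplex 𝕜 (∑ i ∈ Finset.range M, centredTerm y p T F₁ F₂ i x) := by
      rw [map_sum, Finset.mul_sum]
      refine Finset.sum_congr rfl fun i _ => ?_
      simp only [centredTerm, map_mul, rclikeToComplex_ofReal, G, RCLike.ofReal_eq_complex_ofReal]
      push_cast
      ring
    rw [this, norm_mul, norm_rclikeToComplex, Complex.norm_real, Real.norm_of_nonneg (by positivity)]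
    field_simp
  simp_rw [e]
  simpa using hx.const_mul (C₁ * C₂)

end Embedding

/-! ### Averages along a typical selection -/

section Pathwise

variable {𝕜 : Type*} [RCLike 𝕜] {y : ℕ → ℕ} {p : ℕ → ℝ} {δ : ℝ}

theorem selCount_succ (y : ℕ → ℕ) (i : ℕ) : selCount y (i + 1) = selCount y i + y i :=
  Finset.sum_range_succ _ _

theorem selCount_eq_count (hy : ∀ i, y i = 0 ∨ y i = 1) (M : ℕ) :
    selCount y M = Nat.count (fun i => y i = 1) M := by
  induction M with
  | zero => simp [selCount]
  | succ M ih =>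
    rw [selCount_succ, Nat.count_succ, ih]
    rcases hy M with h | h <;> simp [h]

/-- At a selected index the count of earlier selections is its rank from `0`, so `selCount y i`
enumerates the first argument of `g` while `i` runs through the selected integers. -/
theorem sum_selected (hy : ∀ i, y i = 0 ∨ y i = 1) (g : ℕ → ℕ → 𝕜) (M : ℕ) :
    ∑ i ∈ Finset.range M, (y i : 𝕜) * g (selCount y i) i
      = ∑ n ∈ Finset.range (selCount y M), g n (Nat.nth (fun i => y i = 1) n) := by
  induction M with
  | zero => simp [selCount]
  | succ M ih =>
    rw [Finset.sum_range_succ, ih, selCount_succ]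
    rcases hy M with h | h
    · simp [h]
    · rw [h, Finset.sum_range_succ, selCount_eq_count hy M,
        Nat.nth_count (p := fun i => y i = 1) h]
      simp

namespace TypicalSelection

theorem tendsto_selCount (hy : TypicalSelection p y) (hp : SlowDecay p δ) (hδ : 0 < δ) :
    Tendsto (selCount y) atTop atTop := by
  have h := hy.count.pos_mul_atTop one_pos (hp.tendsto_expCount hδ)
  refine tendsto_natCast_atTop_iff.mp (h.congr' ?_)
  filter_upwards [(hp.tendsto_expCount hδ).eventually_gt_atTop 0] with M hM
  field_simp

theorem infinite (hy : TypicalSelection p y) (hp : SlowDecay p δ) (hδ : 0 < δ) :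
    {i | y i = 1}.Infinite := by
  intro hfin
  obtain ⟨M, hM⟩ := ((hy.tendsto_selCount hp hδ).eventually_gt_atTop hfin.toFinset.card).exists
  rw [selCount_eq_count hy.zero_or_one, Nat.count_eq_card_filter_range] at hM
  refine absurd hM (not_lt.mpr (Finset.card_le_card fun i hi => ?_))
  rw [Set.Finite.mem_toFinset]
  exact (Finset.mem_filter.mp hi).2

/-- The decrease of `p` telescopes to a bounded amount. The count changes only at selected `m`, at
cost `2 * C * p m`, and the sum of `p m * y m` is negligible against the count because `p` tends to
zero. -/
theorem tendsto_sum_variation (hy : TypicalSelection p y) (hp : SlowDecay p δ) (hδ : 0 < δ)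
    (hzero : Tendsto p atTop (𝓝 0)) {f : ℕ → 𝕜} {C : ℝ} (hC : 0 < C) (hf : ∀ i, ‖f i‖ ≤ C) :
    Tendsto (fun M => (∑ m ∈ Finset.range M,
      ‖(p (m + 1) : 𝕜) * f (selCount y (m + 1)) - (p m : 𝕜) * f (selCount y m)‖) / expCount p M)
      atTop (𝓝 0) := by
  have hlo : (fun i => p i * (y i : ℝ)) =o[atTop] fun i => (y i : ℝ) := by
    have := ((Asymptotics.isLittleO_one_iff ℝ).mpr hzero).mul_isBigO
      (Asymptotics.isBigO_refl (fun i => (y i : ℝ)) atTop)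
    simpa using this
  have hcast : ∀ M, ∑ i ∈ Finset.range M, (y i : ℝ) = selCount y M := fun M => by
    rw [selCount]; push_cast; rfl
  have hsum := hlo.sum_range (fun i => Nat.cast_nonneg _) (by
    simp_rw [hcast]
    exact tendsto_natCast_atTop_iff.mpr (hy.tendsto_selCount hp hδ))
  simp_rw [hcast] at hsum
  have hW := hp.tendsto_expCount hδ
  have h1 : Tendsto (fun M => (∑ i ∈ Finset.range M, p i * (y i : ℝ)) / expCount p M) atTop (𝓝 0) := by
    have := hsum.tendsto_div_nhds_zero.mul hy.count
    rw [zero_mul] at this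
    refine this.congr' ?_
    filter_upwards [(hy.tendsto_selCount hp hδ).eventually_gt_atTop 0] with M hM
    have : (selCount y M : ℝ) ≠ 0 := by exact_mod_cast hM.ne'
    field_simp
  have h2 : Tendsto (fun M => C * (p 0 / expCount p M)
      + 2 * C * ((∑ i ∈ Finset.range M, p i * (y i : ℝ)) / expCount p M)) atTop (𝓝 0) := by
    simpa using ((hW.const_div_atTop (p 0)).const_mul C).add (h1.const_mul (2 * C))
  refine squeeze_zero' ?_ ?_ h2
  · filter_upwards [hW.eventually_gt_atTop 0] with M hM
    positivity
  · filter_upwards [hW.eventually_gt_atTop 0] with M hM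
    have hterm : ∀ m, ‖(p (m + 1) : 𝕜) * f (selCount y (m + 1)) - (p m : 𝕜) * f (selCount y m)‖
        ≤ C * (p m - p (m + 1)) + 2 * C * (p m * y m) := by
      intro m
      have hpm := hp.anti (Nat.le_succ m)
      have e : (p (m + 1) : 𝕜) * f (selCount y (m + 1)) - (p m : 𝕜) * f (selCount y m)
          = -(((p m - p (m + 1) : ℝ) : 𝕜) * f (selCount y (m + 1)))
            + (p m : 𝕜) * (f (selCount y (m + 1)) - f (selCount y m)) := by
        push_cast; ring
      have h3 : ‖-(((p m - p (m + 1) : ℝ) : 𝕜) * f (selCount y (m + 1)))‖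
          ≤ C * (p m - p (m + 1)) := by
        rw [norm_neg, norm_mul, RCLike.norm_ofReal, abs_of_nonneg (by linarith), mul_comm]
        exact mul_le_mul_of_nonneg_right (hf _) (by linarith)
      have h4 : ‖(p m : 𝕜) * (f (selCount y (m + 1)) - f (selCount y m))‖
          ≤ 2 * C * (p m * y m) := by
        rw [norm_mul, RCLike.norm_ofReal, abs_of_pos (hp.pos m), selCount_succ]
        rcases hy.zero_or_one m with h | h
        · simp [h]
        · rw [h]
          have := (norm_sub_le (f (selCount y m + 1)) (f (selCount y m))).trans
            (add_le_add (hf _) (hf _))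
          have := mul_le_mul_of_nonneg_left this (hp.pos m).le
          push_cast
          linarith
      rw [e]
      exact (norm_add_le _ _).trans (add_le_add h3 h4)
    rw [div_le_iff₀ hM]
    calc _ ≤ ∑ m ∈ Finset.range M, (C * (p m - p (m + 1)) + 2 * C * (p m * y m)) :=
          Finset.sum_le_sum fun m _ => hterm m
      _ = C * (p 0 - p M) + 2 * C * ∑ m ∈ Finset.range M, p m * y m := by
          rw [Finset.sum_add_distrib, ← Finset.mul_sum, ← Finset.mul_sum,
            Finset.sum_range_sub' p M]
      _ ≤ C * p 0 + 2 * C * ∑ m ∈ Finset.range M, p m * y m := by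
          gcongr
          linarith [hp.pos M]
      _ = _ := by field_simp

/-- Pathwise convergence of the averages along a typical selection. -/
theorem tendsto_average_of_pathwise (hy : TypicalSelection p y) (hp : SlowDecay p δ) (hδ : 0 < δ)
    (hzero : Tendsto p atTop (𝓝 0)) {f₁ f₂ : ℕ → 𝕜} {l₁ l₂ : 𝕜} {C : ℝ} (hC : 0 < C)
    (hf₁ : ∀ i, ‖f₁ i‖ ≤ C) (hf₂ : ∀ i, ‖f₂ i‖ ≤ C)
    (hcent : Tendsto (fun M => ‖∑ i ∈ Finset.range M, (((y i : ℝ) - p i : ℝ) : 𝕜) *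
      (f₁ (selCount y i) * f₂ i)‖ / expCount p M) atTop (𝓝 0))
    (hcent₁ : Tendsto (fun M => ‖∑ i ∈ Finset.range M, (((y i : ℝ) - p i : ℝ) : 𝕜) *
      (f₁ (selCount y i) * 1)‖ / expCount p M) atTop (𝓝 0))
    (hloc₁ : ∀ ε > 0, ∃ k : ℕ, 0 < k ∧ ∀ N : ℕ, ∑ m ∈ Finset.range N,
      ‖(k : 𝕜)⁻¹ * ∑ i ∈ Finset.range k, f₁ (m + i) - l₁‖ ≤ ε * N)
    (hloc₂ : ∀ ε > 0, ∃ k : ℕ, 0 < k ∧ ∀ N : ℕ, ∑ m ∈ Finset.range N,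
      ‖(k : 𝕜)⁻¹ * ∑ i ∈ Finset.range k, f₂ (m + i) - l₂‖ ≤ ε * N) :
    Tendsto (fun N : ℕ => (N : 𝕜)⁻¹ * ∑ n ∈ Finset.range N,
      f₁ n * f₂ (Nat.nth (fun i => y i = 1) n)) atTop (𝓝 (l₁ * l₂)) := by
  have hW := hp.tendsto_expCount hδ
  have hcnt := hy.tendsto_selCount hp hδ
  have hWpos := hW.eventually_gt_atTop 0
  -- With constant weights this is the pointwise ergodic theorem along the orbit of `f₁`.
  have hS1 : Tendsto (fun M : ℕ => ‖∑ m ∈ Finset.range M, (f₁ m - l₁)‖ / (M : ℝ)) atTop (𝓝 0) := by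
    have := tendsto_weighted_sum_sub (c := fun _ => (1 : 𝕜)) (w := fun _ => 1) hf₁
      antitone_const (fun _ => zero_le_one) (fun _ => by simp)
      (by simpa using tendsto_natCast_atTop_atTop) (by simp) hloc₁
    simpa using this
  have hS2 : Tendsto (fun M : ℕ => ‖∑ i ∈ Finset.range M, (y i : 𝕜) * (f₁ (selCount y i) - l₁)‖
      / expCount p M) atTop (𝓝 0) := by
    have := (hS1.comp hcnt).mul hy.count
    rw [zero_mul] at this
    refine this.congr' ?_
    filter_upwards [hcnt.eventually_gt_atTop 0] with M hM
    rw [sum_selected hy.zero_or_one (fun n _ => f₁ n - l₁) M]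
    have : (selCount y M : ℝ) ≠ 0 := by exact_mod_cast hM.ne'
    simp only [Function.comp]
    field_simp
  have hS0 : Tendsto (fun M : ℕ => ‖∑ i ∈ Finset.range M, (((y i : ℝ) - p i : ℝ) : 𝕜)‖
      / expCount p M) atTop (𝓝 0) := by
    have h1 := (hy.count.sub_const 1).abs
    rw [sub_self, abs_zero] at h1
    refine h1.congr' ?_
    filter_upwards [hWpos] with M hM
    rw [← RCLike.ofReal_sum, RCLike.norm_ofReal, Finset.sum_sub_distrib]
    have : ∑ i ∈ Finset.range M, (y i : ℝ) = selCount y M := by rw [selCount]; push_cast; rfl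
    rw [this, div_sub_one hM.ne', abs_div, abs_of_pos hM]
    rfl
  -- The centring result with second function `1` turns selected sums of `f₁` into sums weighted by
  -- `p`.
  have hS3 : Tendsto (fun M : ℕ => ‖∑ i ∈ Finset.range M, (p i : 𝕜) * (f₁ (selCount y i) - l₁)‖
      / expCount p M) atTop (𝓝 0) := by
    have h := (hS2.add hcent₁).add (hS0.const_mul ‖l₁‖)
    simp only [add_zero, mul_zero] at h
    refine squeeze_zero' (hWpos.mono fun M hM => by positivity) ?_ h
    filter_upwards [hWpos] with M hM
    rw [mul_div_assoc', ← add_div, ← add_div]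
    gcongr
    have e : ∑ i ∈ Finset.range M, (p i : 𝕜) * (f₁ (selCount y i) - l₁)
        = ∑ i ∈ Finset.range M, (y i : 𝕜) * (f₁ (selCount y i) - l₁)
          - ∑ i ∈ Finset.range M, (((y i : ℝ) - p i : ℝ) : 𝕜) * (f₁ (selCount y i) * 1)
          + l₁ * ∑ i ∈ Finset.range M, (((y i : ℝ) - p i : ℝ) : 𝕜) := by
      rw [Finset.mul_sum, ← Finset.sum_sub_distrib, ← Finset.sum_add_distrib]
      refine Finset.sum_congr rfl fun i _ => ?_
      push_cast; ring
    rw [e, ← norm_mul]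
    exact (norm_add_le _ _).trans (add_le_add_left (norm_sub_le _ _) _)
  -- Here `p i * f₁ (selCount y i)` is the slowly varying weight and `f₂` the sequence being
  -- averaged.
  have hS4 : Tendsto (fun M : ℕ => ‖∑ i ∈ Finset.range M,
      ((p i : 𝕜) * f₁ (selCount y i)) * (f₂ i - l₂)‖ / expCount p M) atTop (𝓝 0) := by
    have hCW : ∀ M, ∑ i ∈ Finset.range M, C * p i = C * expCount p M := fun M => by
      rw [expCount, Finset.mul_sum]
    have h := tendsto_weighted_sum_sub (c := fun i => (p i : 𝕜) * f₁ (selCount y i))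
      (w := fun i => C * p i) hf₂ (fun i j h => mul_le_mul_of_nonneg_left (hp.anti h) hC.le)
      (fun i => by have := (hp.pos i).le; positivity)
      (fun i => by
        rw [norm_mul, RCLike.norm_ofReal, abs_of_pos (hp.pos i), mul_comm]
        exact mul_le_mul_of_nonneg_right (hf₁ _) (hp.pos i).le)
      (by simp_rw [hCW]; exact hW.const_mul_atTop hC)
      (by
        simp_rw [hCW]
        have := (hy.tendsto_sum_variation hp hδ hzero hC hf₁).const_mul C⁻¹
        rw [mul_zero] at this
        refine this.congr fun M => ?_
        rw [inv_mul_eq_div, div_div, mul_comm C]) hloc₂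
    simp_rw [hCW] at h
    have h2 := h.const_mul C
    rw [mul_zero] at h2
    refine h2.congr fun M => ?_
    rw [mul_div_assoc', mul_div_mul_left _ _ hC.ne']
  have hS5 : Tendsto (fun M : ℕ => ‖∑ i ∈ Finset.range M,
      (y i : 𝕜) * (f₁ (selCount y i) * f₂ i - l₁ * l₂)‖ / expCount p M) atTop (𝓝 0) := by
    have h := ((hcent.add hS4).add (hS3.const_mul ‖l₂‖)).add (hS0.const_mul ‖l₁ * l₂‖)
    simp only [add_zero, mul_zero] at h
    refine squeeze_zero' (hWpos.mono fun M hM => by positivity) ?_ h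
    filter_upwards [hWpos] with M hM
    rw [mul_div_assoc', mul_div_assoc', ← add_div, ← add_div, ← add_div]
    gcongr
    have e : ∑ i ∈ Finset.range M, (y i : 𝕜) * (f₁ (selCount y i) * f₂ i - l₁ * l₂)
        = ∑ i ∈ Finset.range M, (((y i : ℝ) - p i : ℝ) : 𝕜) * (f₁ (selCount y i) * f₂ i)
          + ∑ i ∈ Finset.range M, ((p i : 𝕜) * f₁ (selCount y i)) * (f₂ i - l₂)
          + l₂ * ∑ i ∈ Finset.range M, (p i : 𝕜) * (f₁ (selCount y i) - l₁)
          - l₁ * l₂ * ∑ i ∈ Finset.range M, (((y i : ℝ) - p i : ℝ) : 𝕜) := by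
      rw [Finset.mul_sum, Finset.mul_sum, ← Finset.sum_add_distrib, ← Finset.sum_add_distrib,
        ← Finset.sum_sub_distrib]
      refine Finset.sum_congr rfl fun i _ => ?_
      push_cast; ring
    rw [e, ← norm_mul l₂, ← norm_mul (l₁ * l₂)]
    exact (norm_sub_le _ _).trans (add_le_add_left ((norm_add_le _ _).trans
      (add_le_add_left (norm_add_le _ _) _)) _)
  have hS6 : Tendsto (fun M : ℕ => ‖∑ i ∈ Finset.range M,
      (y i : 𝕜) * (f₁ (selCount y i) * f₂ i - l₁ * l₂)‖ / (selCount y M : ℝ)) atTop (𝓝 0) := by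
    have h := hS5.mul (hy.count.inv₀ one_ne_zero)
    rw [zero_mul] at h
    refine h.congr' ?_
    filter_upwards [hWpos] with M hM
    rw [inv_div]
    field_simp
  have hinf := hy.infinite hp hδ
  have hnth : Tendsto (Nat.nth (fun i => y i = 1)) atTop atTop :=
    (Nat.nth_strictMono hinf).tendsto_atTop
  -- Taking `M` to be the selected integer of rank `N` makes the count exactly `N`, so all `N` are
  -- reached.
  have hS7 : Tendsto (fun N : ℕ => ‖∑ n ∈ Finset.range N,
      (f₁ n * f₂ (Nat.nth (fun i => y i = 1) n) - l₁ * l₂)‖ / (N : ℝ)) atTop (𝓝 0) := by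
    refine (hS6.comp hnth).congr fun N => ?_
    simp only [Function.comp]
    rw [sum_selected hy.zero_or_one (fun n i => f₁ n * f₂ i - l₁ * l₂),
      selCount_eq_count hy.zero_or_one, Nat.count_nth_of_infinite hinf]
  rw [tendsto_iff_norm_sub_tendsto_zero]
  refine hS7.congr' ?_
  filter_upwards [eventually_gt_atTop 0] with N hN
  have hN' : (N : 𝕜) ≠ 0 := by exact_mod_cast hN.ne'
  have : (N : 𝕜)⁻¹ * ∑ n ∈ Finset.range N, f₁ n * f₂ (Nat.nth (fun i => y i = 1) n) - l₁ * l₂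
      = (N : 𝕜)⁻¹ * ∑ n ∈ Finset.range N,
        (f₁ n * f₂ (Nat.nth (fun i => y i = 1) n) - l₁ * l₂) := by
    rw [Finset.sum_sub_distrib, Finset.sum_const, Finset.card_range, nsmul_eq_mul]
    field_simp
  rw [this, norm_mul, norm_inv, RCLike.norm_natCast, inv_mul_eq_div]

end TypicalSelection

end Pathwise

section System

variable {𝕜 : Type*} [RCLike 𝕜] {y : ℕ → ℕ} {p : ℕ → ℝ} {δ : ℝ} {X : Type*} [MeasurableSpace X]
  {μ : Measure X} [IsProbabilityMeasure μ] {T : X → X}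

/-- Almost everywhere convergence along a typical selection, for bounded measurable functions. -/
theorem TypicalSelection.ae_tendsto_average (hy : TypicalSelection p y) (hp : SlowDecay p δ)
    (hδ : 0 < δ) (hzero : Tendsto p atTop (𝓝 0)) (hT : MeasurePreserving T μ μ) {F₁ F₂ : X → 𝕜}
    {C : ℝ} (hC : 0 < C) (h₁ : Measurable F₁) (h₂ : Measurable F₂) (hb₁ : ∀ x, ‖F₁ x‖ ≤ C)
    (hb₂ : ∀ x, ‖F₂ x‖ ≤ C) (hF₁ : MemLp F₁ 2 μ) (hF₂ : MemLp F₂ 2 μ) :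
    ∀ᵐ x ∂μ, Tendsto (fun N : ℕ => (N : 𝕜)⁻¹ * ∑ n ∈ Finset.range N,
      F₁ (T^[n] x) * F₂ (T^[Nat.nth (fun i => y i = 1) n] x)) atTop
      (𝓝 (invariantProj hT hF₁ x * invariantProj hT hF₂ x)) := by
  filter_upwards [hy.ae_tendsto_centred_of_bounded hp hδ hT hC hC h₁ h₂ hb₁ hb₂,
    hy.ae_tendsto_centred_of_bounded hp hδ hT hC one_pos h₁
      (measurable_const (a := (1 : 𝕜))) hb₁ (fun _ => by simp),
    ae_exists_moving_average_le hT h₁ hF₁, ae_exists_moving_average_le hT h₂ hF₂]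
    with x hx1 hx2 hx3 hx4
  exact hy.tendsto_average_of_pathwise hp hδ hzero (f₁ := fun n => F₁ (T^[n] x))
    (f₂ := fun n => F₂ (T^[n] x)) hC (fun _ => hb₁ _) (fun _ => hb₂ _) hx1 hx2 hx3 hx4

omit [IsProbabilityMeasure μ] in
/-- An essentially bounded function agrees almost everywhere with a bounded measurable one. -/
theorem exists_bounded_measurable_ae_eq {F : X → 𝕜} (hF : MemLp F ⊤ μ) :
    ∃ G : X → 𝕜, ∃ C : ℝ, Measurable G ∧ (∀ x, ‖G x‖ ≤ C) ∧ F =ᵐ[μ] G := by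
  set G₀ := hF.1.mk F
  have hG₀ : Measurable G₀ := hF.1.stronglyMeasurable_mk.measurable
  have h0 : F =ᵐ[μ] G₀ := hF.1.ae_eq_mk
  set C : ℝ := (eLpNorm F ⊤ μ).toReal
  have hC : ∀ᵐ x ∂μ, ‖F x‖ ≤ C := by
    have h := ae_le_eLpNormEssSup (f := F) (μ := μ)
    filter_upwards [h] with x hx
    rw [← eLpNorm_exponent_top] at hx
    have := ENNReal.toReal_mono hF.2.ne hx
    simpa [C] using this
  refine ⟨fun x => if ‖G₀ x‖ ≤ C then G₀ x else 0, C,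
    Measurable.ite (measurableSet_le hG₀.norm measurable_const) hG₀ measurable_const,
    fun x => ?_, ?_⟩
  · beta_reduce
    split_ifs with h
    · exact h
    · rw [norm_zero]; exact ENNReal.toReal_nonneg
  · filter_upwards [h0, hC] with x h1 h2
    rw [h1] at h2
    rw [if_pos h2, h1]

/-- Modification on a null set affects the orbits of only a null set of points, since `T` preserves
the measure, and leaves the L² class unchanged. -/
theorem TypicalSelection.ae_tendsto_average_of_memLp_top (hy : TypicalSelection p y)
    (hp : SlowDecay p δ) (hδ : 0 < δ) (hzero : Tendsto p atTop (𝓝 0))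
    (hT : MeasurePreserving T μ μ) {F₁ F₂ : X → 𝕜} (hF₁ : MemLp F₁ ⊤ μ) (hF₂ : MemLp F₂ ⊤ μ) :
    ∀ᵐ x ∂μ, Tendsto (fun N : ℕ => (N : 𝕜)⁻¹ * ∑ n ∈ Finset.range N,
      F₁ (T^[n] x) * F₂ (T^[Nat.nth (fun i => y i = 1) n] x)) atTop
      (𝓝 (invariantProj hT (hF₁.mono_exponent le_top) x *
        invariantProj hT (hF₂.mono_exponent le_top) x)) := by
  obtain ⟨G₁, C₁, m₁, b₁, e₁⟩ := exists_bounded_measurable_ae_eq hF₁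
  obtain ⟨G₂, C₂, m₂, b₂, e₂⟩ := exists_bounded_measurable_ae_eq hF₂
  have hG : ∀ {F G : X → 𝕜} (hF : MemLp F 2 μ) (e : F =ᵐ[μ] G),
      ∃ hG : MemLp G 2 μ, invariantProj hT hF = invariantProj hT hG := fun hF e =>
    ⟨(memLp_congr_ae e).mp hF, by
      simp only [invariantProj]
      rw [(MemLp.toLp_eq_toLp_iff hF ((memLp_congr_ae e).mp hF)).mpr e]⟩
  obtain ⟨l₁, i₁⟩ := hG (hF₁.mono_exponent le_top) e₁
  obtain ⟨l₂, i₂⟩ := hG (hF₂.mono_exponent le_top) e₂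
  have horb : ∀ {F G : X → 𝕜}, F =ᵐ[μ] G → ∀ᵐ x ∂μ, ∀ n, F (T^[n] x) = G (T^[n] x) := fun e =>
    ae_all_iff.mpr fun n => (hT.iterate n).quasiMeasurePreserving.ae e
  rw [i₁, i₂]
  filter_upwards [hy.ae_tendsto_average hp hδ hzero hT (C := max 1 (max C₁ C₂))
    (lt_max_of_lt_left one_pos) m₁ m₂
    (fun x => (b₁ x).trans ((le_max_left _ _).trans (le_max_right _ _)))
    (fun x => (b₂ x).trans ((le_max_right _ _).trans (le_max_right _ _))) l₁ l₂,
    horb e₁, horb e₂] with x hx h1 h2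
  simpa only [h1, h2] using hx

end System

/-! ### From indices `0, 1, 2, …` to indices `1, 2, 3, …` -/

theorem nth_shift {Q : ℕ → Prop} (hQ : {i | Q i}.Infinite) (n : ℕ) :
    Nat.nth (fun m => 1 ≤ m ∧ Q (m - 1)) n = Nat.nth Q n + 1 := by
  classical
  set R : ℕ → Prop := fun m => 1 ≤ m ∧ Q (m - 1)
  have h1 : Nat.count R (Nat.nth Q n + 1) = n := by
    rw [Nat.count_succ', if_neg (by simp [R]), add_zero]
    have : (fun k => R (k + 1)) = Q := by
      funext k; simp [R]
    simp only [this]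
    convert Nat.count_nth_of_infinite hQ n
  have h2 : R (Nat.nth Q n + 1) := ⟨by omega, by simpa using Nat.nth_mem_of_infinite hQ n⟩
  have h3 := Nat.nth_count h2
  rwa [h1] at h3

theorem tendsto_average_shift {𝕜 : Type*} [RCLike 𝕜] {g : ℕ → 𝕜} {l : 𝕜}
    (h : Tendsto (fun N : ℕ => (N : 𝕜)⁻¹ * ∑ n ∈ Finset.range N, g n) atTop (𝓝 l)) :
    Tendsto (fun N : ℕ => (N : 𝕜)⁻¹ * ∑ n ∈ Finset.Ico 1 N, g (n - 1)) atTop (𝓝 l) := by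
  rw [← tendsto_add_atTop_iff_nat 1]
  have h1 : Tendsto (fun N : ℕ => (N : 𝕜) / ((N : 𝕜) + 1)) atTop (𝓝 1) :=
    tendsto_natCast_div_add_atTop (1 : 𝕜)
  have h2 := h1.mul h
  rw [one_mul] at h2
  refine h2.congr' ?_
  filter_upwards [eventually_gt_atTop 0] with N hN
  have hN' : (N : 𝕜) ≠ 0 := by exact_mod_cast hN.ne'
  have hN1 : (N : 𝕜) + 1 ≠ 0 := by exact_mod_cast (Nat.succ_ne_zero N)
  have : ∑ n ∈ Finset.Ico 1 (N + 1), g (n - 1) = ∑ n ∈ Finset.range N, g n := by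
    rw [Finset.sum_Ico_eq_sum_range]
    simp
  rw [this]
  push_cast
  field_simp

theorem theoremC {𝕜 : Type*} [RCLike 𝕜]
    -- the non-increasing sequence of probabilities `u 1 ≥ u 2 ≥ …` (`u 0` plays no role)
    (u : ℕ → ℝ)
    (hu01 : ∀ n, 1 ≤ n → u n ∈ Set.Icc (0 : ℝ) 1)
    (hu_anti : AntitoneOn u (Set.Ici 1))
    (δ : ℝ) (hδ : 0 < δ)
    (hu_slow : Tendsto
      (fun n : ℕ => u n * ((n : ℝ) ^ (1 / 2 : ℝ) / (Real.log n) ^ (3 + δ))) atTop atTop)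
    (hu_zero : Tendsto u atTop (𝓝 0))
    -- independent selectors `U 1, U 2, …` (`U 0` plays no role)
    {Ω : Type*} [MeasurableSpace Ω] (P : Measure Ω) [IsProbabilityMeasure P]
    (U : ℕ → Ω → ℕ)
    (hU_meas : ∀ n, 1 ≤ n → Measurable (U n))
    (hU01 : ∀ n, 1 ≤ n → ∀ ω, U n ω = 0 ∨ U n ω = 1)
    (hU_prob : ∀ n, 1 ≤ n → P {ω | U n ω = 1} = ENNReal.ofReal (u n))
    (hU_indep : ProbabilityTheory.iIndepFun (fun n : ℕ => U (n + 1)) P) :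
    ∀ᵐ ω ∂P, (selectedSet U ω).Infinite ∧
      ∀ (X : Type*) [MeasurableSpace X] (μ : Measure X) [IsProbabilityMeasure μ]
        (T : X → X) (hT : MeasurePreserving T μ μ)
        (F₁ F₂ : X → 𝕜) (hF₁ : MemLp F₁ ⊤ μ) (hF₂ : MemLp F₂ ⊤ μ),
        ∀ᵐ x ∂μ, Tendsto
          (fun N : ℕ => (N : 𝕜)⁻¹ *
            ∑ n ∈ Finset.Ico 1 N, F₁ (T^[n] x) * F₂ (T^[selectedSeq U ω n] x))
          atTop
          (𝓝 (invariantProj hT (hF₁.mono_exponent le_top) x *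
            invariantProj hT (hF₂.mono_exponent le_top) x)) := by
  set p : ℕ → ℝ := fun i => u (i + 1)
  have hanti : Antitone p := fun i j h =>
    hu_anti (Set.mem_Ici.mpr (by omega)) (Set.mem_Ici.mpr (by omega)) (by omega)
  have hslow : Tendsto (fun i : ℕ => p i * (√((i : ℝ) + 1) / Real.log ((i : ℝ) + 1) ^ (3 + δ)))
      atTop atTop := by
    have := (tendsto_add_atTop_iff_nat 1).mpr hu_slow
    simpa only [Real.sqrt_eq_rpow, p, Nat.cast_add, Nat.cast_one] using this
  -- A zero of `p` would persist by monotonicity, contradicting the divergence in `hslow`.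
  have hpos : ∀ i, 0 < p i := fun i => by
    obtain ⟨j, h1, h2⟩ := ((hslow.eventually_gt_atTop 0).and (eventually_ge_atTop i)).exists
    refine lt_of_lt_of_le ?_ (hanti h2)
    refine lt_of_le_of_ne (hu01 (j + 1) (by omega)).1 fun h => ?_
    rw [show p j = 0 from h.symm, zero_mul] at h1
    exact lt_irrefl _ h1
  have hp : SlowDecay p δ := ⟨hanti, hpos, fun i => (hu01 (i + 1) (by omega)).2, hslow⟩
  have hzero : Tendsto p atTop (𝓝 0) := (tendsto_add_atTop_iff_nat 1).mpr hu_zero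
  have hY : IsSelector P (fun i => U (i + 1)) p :=
    ⟨fun i => hU_meas _ (by omega), fun i => hU01 _ (by omega), fun i => (hpos i).le, hp.le_one,
      fun i => hU_prob _ (by omega), hU_indep⟩
  filter_upwards [hY.ae_typicalSelection hp hδ] with ω hω
  set y : ℕ → ℕ := fun i => U (i + 1) ω
  have hinf : {i | y i = 1}.Infinite := hω.infinite hp hδ
  have hsel : (fun m => m ∈ selectedSet U ω) = fun m => 1 ≤ m ∧ y (m - 1) = 1 := by
    funext m
    refine propext (and_congr_right fun hm => ?_)
    simp only [y, Nat.sub_add_cancel hm]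
  refine ⟨?_, ?_⟩
  · refine (hinf.image (Nat.succ_injective.injOn)).mono ?_
    rintro _ ⟨i, hi, rfl⟩
    exact ⟨Nat.succ_pos i, hi⟩
  · intro X _ μ _ T hT F₁ F₂ hF₁ hF₂
    -- The result for indices from `0` is used at the point `T x`: this raises both the rank and the
    -- selected integer by one, and invariance of the projections returns the limit to `x`.
    filter_upwards [hT.quasiMeasurePreserving.ae
      (hω.ae_tendsto_average_of_memLp_top hp hδ hzero hT hF₁ hF₂),
      invariantProj_comp_ae_eq hT (hF₁.mono_exponent le_top),
      invariantProj_comp_ae_eq hT (hF₂.mono_exponent le_top)] with x hx h1 h2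
    rw [Function.comp] at h1 h2
    rw [h1, h2] at hx
    refine (tendsto_average_shift hx).congr fun N => ?_
    congr 1
    refine Finset.sum_congr rfl fun n hn => ?_
    have hn1 : 1 ≤ n := (Finset.mem_Ico.mp hn).1
    rw [selectedSeq, hsel, nth_shift hinf, ← Function.iterate_succ_apply,
      ← Function.iterate_succ_apply, Nat.succ_eq_add_one, Nat.sub_add_cancel hn1]
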